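/- **Problem.** Let $F(x)=\frac1n\sum_{i=1}^n f_i(g_i(x))$ on $\mathbb R^d$ with $g_i(x)=\mathbb E_\zeta[g_i(x,\zeta)]\in\mathbb R$, let $h_k(x)=\mathbb E_\xi[h_k(x,\xi)]$ for $k=1,\dots,m$, and for $\beta>0$ let $$\Phi(x)=F(x)+\frac{\beta}{m}\sum_{k=1}^m[h_k(x)]_+ ,\qquad \Phi_\lambda(x)=\min_y\Big\{\Phi(y)+\frac1{2\lambda}\|y-x\|^2\Big\}.$$ Let $\partial\psi(x)=\{v:\psi(x')\ge\psi(x)+\langle v,x'-x\rangle+o(\|x'-x\|)\}$. Call $\psi$ $\rho$-weakly convex if $\psi(x)\ge\psi(x')+\langle v,x-x'\rangle-\frac\rho2\|x-x'\|^2$ for all $x,x'$ and $v\in\partial\psi(x')$, and $L$-smooth if it is differentiable and $|\psi(x)-\psi(x')-\langle\nabla\psi(x'),x-x'\rangle|\le\frac L2\|x-x'\|^2$ for all $x,x'$. **Assumptions.** $F$ is $\rho_0$-weakly convex and $L_F$-Lipschitz, each $h_k$ is $\rho_1$-weakly convex and $L_h$-Lipschitz ($\rho_0,\rho_1>0$);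 each $f_i:\mathbb R\to\mathbb R$ is $L_f$-Lipschitz and $L_{\nabla f}$-smooth, each $g_i$ is $L_{\nabla g}$-smooth. For all $x,y$: $\mathbb E|g_i(x,\zeta)-g_i(y,\zeta)|^2\le L_g^2\|x-y\|^2$, $\mathbb E|g_i(x,\zeta)-g_i(x)|^2\le\sigma_g^2$, $\mathbb E|h_k(x,\xi)-h_k(y,\xi)|^2\le L_h^2\|x-y\|^2$, $\mathbb E|h_k(x,\xi)-h_k(x)|^2\le\sigma_h^2$. There are stochastic subgradients $\partial g_i(x,\zeta)$ and $\partial h_k(x,\xi)$, that is, measurable functions which for each $x$ are almost surely subgradients at $x$ of $g_i(\cdot,\zeta)$ and $h_k(\cdot,\xi)$, with $\mathbb E[\partial h_k(x,\xi)]\in\partial h_k(x)$. **Algorithm.** Start from $x_0=x_{-1}$ and numbers $u_{1,i}^0,u_{2,k}^0$. In iteration $t=0,1,\dots$ draw independently uniformly random sets $\mathcal B^t\subseteq\{1,\dots,n\}$ of size $|\mathcal B|$ and $\mathcal B_c^t\subseteq\{1,\dots,m\}$ of size $|\mathcal B_c|$, and i.i.d. mini-batches $\mathcal B_{1,i}^t$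 of $|\mathcal B_{1,i}|$ samples of $\zeta$ and $\mathcal B_{2,k}^t$ of $|\mathcal B_{2,k}|$ samples of $\xi$ (these sizes do not depend on $i$, $k$, $t$; all sizes are at least $1$). An argument $\mathcal B_{1,i}^t$ or $\mathcal B_{2,k}^t$ in place of $\zeta$ or $\xi$ means the average over the batch. Set $$G_1^t=\frac1{|\mathcal B|}\sum_{i\in\mathcal B^t}f_i'(u_{1,i}^t)\,\partial g_i(x_t;\mathcal B_{1,i}^t),\qquad G_2^t=\frac{\beta}{|\mathcal B_c|}\sum_{k\in\mathcal B_c^t}[u_{2,k}^t]_+'\,\partial h_k(x_t;\mathcal B_{2,k}^t),\qquad x_{t+1}=x_t-\eta(G_1^t+G_2^t),$$ where $[u]_+'\in\partial[u]_+$ is a fixed choice, and for $i\in\mathcal B^t$ $$u_{1,i}^{t+1}=(1-\gamma)u_{1,i}^t+\gamma g_i(x_t;\mathcal B_{1,i}^t)+\gamma_1'\big(g_i(x_t;\mathcal B_{1,i}^t)-g_i(x_{t-1};\mathcal B_{1,i}^t)\big),\qquad \gamma_1'=\tfrac{n-|\mathcal B|}{|\mathcal B|(1-\gamma)}+1-\gamma,$$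 while $u_{1,i}^{t+1}=u_{1,i}^t$ for $i\notin\mathcal B^t$; $u_{2,k}$ is updated in the same way with $h_k,\mathcal B_{2,k}^t,\mathcal B_c^t,m,|\mathcal B_c|$ in place of $g_i,\mathcal B_{1,i}^t,\mathcal B^t,n,|\mathcal B|$. **Theorem.** Given $d$, the constants $L_F,L_f,L_g,L_h,L_{\nabla f},L_{\nabla g},\sigma_g,\sigma_h,\rho_0,\rho_1$ and numbers $D,\Delta\ge0$, $\beta_0>0$, there are constants $c_\gamma,c_\eta,c_T>0$ and $c_\lambda\in(0,1)$, depending on nothing else, such that the following holds for all $n$, $m$, mini-batch sizes, problems as above, $\beta\ge\beta_0$, and initializations with $\Phi(x_0)-\inf\Phi\le\Delta(1+\beta)$, $\frac1n\sum_i|u_{1,i}^0-g_i(x_0)|^2\le D^2$, $\frac1m\sum_k|u_{2,k}^0-h_k(x_0)|^2\le D^2$. Let $\varepsilon>0$ be small enough that $$|\mathcal B_{2,k}|\,\varepsilon^4\le\beta^4,\qquad |\mathcal B_{2,k}|\,\varepsilon^2\le|\mathcal B_{1,i}|\,\beta^3,\qquad \frac{|\mathcal B_c|}{m}\,\varepsilon\le\frac{|\mathcal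 B|}{n}\,\beta ,$$ and put $$\gamma=c_\gamma\min\Big\{\tfrac{|\mathcal B_{2,k}|}{\beta^4}\varepsilon^4,\tfrac{|\mathcal B_{1,i}|}{\beta}\varepsilon^2\Big\},\quad \eta=c_\eta\min\Big\{\tfrac{|\mathcal B||\mathcal B_{1,i}|^{1/2}\varepsilon^2}{n\beta^2},\tfrac{|\mathcal B_c||\mathcal B_{2,k}|^{1/2}\varepsilon^4}{\beta^5m}\Big\},\quad \lambda=\frac{c_\lambda}{\rho_0+\rho_1\beta}.$$ Then $\gamma<1$, $\Phi_\lambda$ is differentiable, and for every number of iterations $$T\ \ge\ c_T\max\Big\{\tfrac{m\beta^6}{|\mathcal B_{2,k}|^{1/2}|\mathcal B_c|\varepsilon^6},\tfrac{n\beta^3}{|\mathcal B||\mathcal B_{1,i}|^{1/2}\varepsilon^4},\tfrac{n\beta^2}{|\mathcal B||\mathcal B_{1,i}|\varepsilon^4}\Big\}$$ the iterates satisfy $\mathbb E\|\nabla\Phi_\lambda(x_{\hat t})\|\le\varepsilon$, where $\hat t$ is uniformly distributed on $\{1,\dots,T\}$ and independent of the algorithm. -/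

import Mathlib

open MeasureTheory ProbabilityTheory
open scoped NNReal

noncomputable section

namespace FCCO

/-! ### Nonsmooth analysis -/

section Analysis

variable {E : Type*} [NormedAddCommGroup E] [InnerProductSpace ℝ E]

/-- The subdifferential of `ψ` at `x`: all `v` with
`ψ x' ≥ ψ x + ⟪v, x' - x⟫ + o(‖x' - x‖)` as `x' → x`. -/
def subdifferential (ψ : E → ℝ) (x : E) : Set E :=
  {v | ∀ δ : ℝ, 0 < δ → ∀ᶠ x' in nhds x,
    ψ x + inner ℝ v (x' - x) - δ * ‖x' - x‖ ≤ ψ x'}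

/-- `ψ` is `ρ`-weakly convex: every subgradient gives a lower bound up to the quadratic
`(ρ / 2) ‖x - x'‖ ^ 2`. -/
def WeaklyConvex (ρ : ℝ) (ψ : E → ℝ) : Prop :=
  ∀ x x' : E, ∀ v ∈ subdifferential ψ x',
    ψ x' + inner ℝ v (x - x') - ρ / 2 * ‖x - x'‖ ^ 2 ≤ ψ x

/-- `ψ` is `L`-smooth. -/
def IsSmooth [CompleteSpace E] (L : ℝ) (ψ : E → ℝ) : Prop :=
  Differentiable ℝ ψ ∧ ∀ x x' : E,
    |ψ x - ψ x' - inner ℝ (gradient ψ x') (x - x')| ≤ L / 2 * ‖x - x'‖ ^ 2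

/-- The Moreau envelope `ψ_θ(x) = min_y { ψ y + (1 / (2 θ)) ‖y - x‖ ^ 2 }`. -/
def moreauEnvelope (ψ : E → ℝ) (θ : ℝ) (x : E) : ℝ :=
  ⨅ y : E, (ψ y + 1 / (2 * θ) * ‖y - x‖ ^ 2)

end Analysis

/-- The hinge function `[z]_+`. -/
def hinge (z : ℝ) : ℝ := max 0 z

/-! ### The problem -/

/-- Euclidean space of dimension `d`. -/
abbrev Vec (d : ℕ) : Type := EuclideanSpace ℝ (Fin d)

/-- The data of a problem with objective `(1 / n) ∑ i, f i (E_ζ [g i x ζ])` and constraints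
`E_ξ [h k x ξ] ≤ 0`, together with the stochastic oracles: `ζ` has law `P`, `ξ` has law `Q`, and
`dg i x ζ`, `dh k x ξ` are the stochastic (sub)gradients. -/
structure Problem (d n m : ℕ) (Z Ξ : Type*) [MeasurableSpace Z] [MeasurableSpace Ξ] where
  /-- law of `ζ` -/
  P : Measure Z
  /-- law of `ξ` -/
  Q : Measure Ξ
  /-- outer functions -/
  f : Fin n → ℝ → ℝ
  /-- stochastic inner functions -/
  g : Fin n → Vec d → Z → ℝ
  /-- stochastic (sub)gradients of the inner functions -/
  dg : Fin n → Vec d → Z → Vec d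
  /-- stochastic constraint functions -/
  h : Fin m → Vec d → Ξ → ℝ
  /-- stochastic subgradients of the constraint functions -/
  dh : Fin m → Vec d → Ξ → Vec d

section ProblemDefs

variable {d n m : ℕ} {Z Ξ : Type*} [MeasurableSpace Z] [MeasurableSpace Ξ]

/-- `g_i(x) = E_ζ [g_i(x, ζ)]`. -/
def Problem.gMean (p : Problem d n m Z Ξ) (i : Fin n) (x : Vec d) : ℝ := ∫ z, p.g i x z ∂p.P

/-- `h_k(x) = E_ξ [h_k(x, ξ)]`. -/
def Problem.hMean (p : Problem d n m Z Ξ) (k : Fin m) (x : Vec d) : ℝ := ∫ z, p.h k x z ∂p.Q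

/-- `F(x) = (1 / n) ∑ i, f_i(g_i(x))`. -/
def Problem.F (p : Problem d n m Z Ξ) (x : Vec d) : ℝ :=
  1 / (n : ℝ) * ∑ i, p.f i (p.gMean i x)

/-- The penalized objective `Φ(x) = F(x) + (β / m) ∑ k, [h_k(x)]_+`. -/
def Problem.Phi (p : Problem d n m Z Ξ) (β : ℝ) (x : Vec d) : ℝ :=
  p.F x + β / (m : ℝ) * ∑ k, hinge (p.hMean k x)

end ProblemDefs

/-- The numerical constants of the problem class. -/
structure Constants where
  /-- Lipschitz constant of `F` -/
  L_F : ℝ≥0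
  /-- Lipschitz constant of the `f_i` -/
  L_f : ℝ≥0
  /-- mean-square Lipschitz constant of the `g_i` -/
  L_g : ℝ≥0
  /-- Lipschitz and mean-square Lipschitz constant of the `h_k` -/
  L_h : ℝ≥0
  /-- smoothness constant of the `f_i` -/
  L_df : ℝ≥0
  /-- smoothness constant of the `g_i` -/
  L_dg : ℝ≥0
  /-- standard deviation bound for the `g_i` -/
  σ_g : ℝ≥0
  /-- standard deviation bound for the `h_k` -/
  σ_h : ℝ≥0
  /-- weak convexity constant of `F` -/
  ρ₀ : ℝ
  /-- weak convexity constant of the `h_k` -/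
  ρ₁ : ℝ
  ρ₀_pos : 0 < ρ₀
  ρ₁_pos : 0 < ρ₁

/-- The assumptions on the problem: weak convexity and Lipschitz continuity of `F` and `h_k`,
the stochastic oracles for `h_k` and `g_i`, and smooth `f_i` and `g_i`. -/
structure Problem.Assumptions {d n m : ℕ} {Z Ξ : Type*} [MeasurableSpace Z] [MeasurableSpace Ξ]
    (p : Problem d n m Z Ξ) (C : Constants) : Prop where
  probP : IsProbabilityMeasure p.P
  probQ : IsProbabilityMeasure p.Q
  meas_g : ∀ i, Measurable (Function.uncurry (p.g i))
  meas_dg : ∀ i, Measurable (Function.uncurry (p.dg i))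
  meas_h : ∀ k, Measurable (Function.uncurry (p.h k))
  meas_dh : ∀ k, Measurable (Function.uncurry (p.dh k))
  -- the objective and the constraint functions
  F_weaklyConvex : WeaklyConvex C.ρ₀ p.F
  F_lipschitz : LipschitzWith C.L_F p.F
  h_weaklyConvex : ∀ k, WeaklyConvex C.ρ₁ (p.hMean k)
  h_lipschitz : ∀ k, LipschitzWith C.L_h (p.hMean k)
  -- the oracle of the constraint functions
  h_integrable : ∀ k x, Integrable (p.h k x) p.Q
  dh_subgradient : ∀ k x, ∀ᵐ z ∂p.Q, p.dh k x z ∈ subdifferential (fun y => p.h k y z) x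
  dh_integrable : ∀ k x, Integrable (p.dh k x) p.Q
  dh_mean : ∀ k x, (∫ z, p.dh k x z ∂p.Q) ∈ subdifferential (p.hMean k) x
  h_meanSquareLipschitz : ∀ k x y,
    ∫⁻ z, ENNReal.ofReal ((p.h k x z - p.h k y z) ^ 2) ∂p.Q
      ≤ ENNReal.ofReal ((C.L_h : ℝ) ^ 2 * ‖x - y‖ ^ 2)
  h_variance : ∀ k x,
    ∫⁻ z, ENNReal.ofReal ((p.h k x z - p.hMean k x) ^ 2) ∂p.Q ≤ ENNReal.ofReal ((C.σ_h : ℝ) ^ 2)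
  -- the outer functions
  f_lipschitz : ∀ i, LipschitzWith C.L_f (p.f i)
  f_smooth : ∀ i, IsSmooth (C.L_df : ℝ) (p.f i)
  -- the inner functions and their oracle
  g_integrable : ∀ i x, Integrable (p.g i x) p.P
  dg_subgradient : ∀ i x, ∀ᵐ z ∂p.P, p.dg i x z ∈ subdifferential (fun y => p.g i y z) x
  g_meanSquareLipschitz : ∀ i x y,
    ∫⁻ z, ENNReal.ofReal ((p.g i x z - p.g i y z) ^ 2) ∂p.P
      ≤ ENNReal.ofReal ((C.L_g : ℝ) ^ 2 * ‖x - y‖ ^ 2)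
  g_variance : ∀ i x,
    ∫⁻ z, ENNReal.ofReal ((p.g i x z - p.gMean i x) ^ 2) ∂p.P ≤ ENNReal.ofReal ((C.σ_g : ℝ) ^ 2)
  g_smooth : ∀ i, IsSmooth (C.L_dg : ℝ) (p.gMean i)

/-! ### The algorithm -/

/-- All the randomness drawn in one iteration: the outer mini-batches `ℬ ⊆ {1, …, n}` and
`ℬ_c ⊆ {1, …, m}`, and, for every `i` and `k`, inner mini-batches `ℬ_{1,i}` of `b₁` samples of
`ζ` and `ℬ_{2,k}` of `b₂` samples of `ξ` (only those with `i ∈ ℬ` and `k ∈ ℬ_c` are used). -/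
abbrev Draw (n m b₁ b₂ : ℕ) (Z Ξ : Type*) : Type _ :=
  Finset (Fin n) × Finset (Fin m) × (Fin n → Fin b₁ → Z) × (Fin m → Fin b₂ → Ξ)

/-- The law of the randomness of one iteration: `ℬ` and `ℬ_c` are uniformly distributed among the
subsets of size `b` and `c`, the inner samples are i.i.d., everything is independent. -/
def Problem.drawLaw {d n m : ℕ} {Z Ξ : Type*} [MeasurableSpace Z] [MeasurableSpace Ξ]
    (p : Problem d n m Z Ξ) (b c b₁ b₂ : ℕ) : Measure (Draw n m b₁ b₂ Z Ξ) :=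
  (uniformOn {I : Finset (Fin n) | I.card = b}).prod
    ((uniformOn {J : Finset (Fin m) | J.card = c}).prod
      ((Measure.pi fun _ : Fin n => Measure.pi fun _ : Fin b₁ => p.P).prod
        (Measure.pi fun _ : Fin m => Measure.pi fun _ : Fin b₂ => p.Q)))

/-- The parameters of the algorithm: `b = |ℬ|`, `c = |ℬ_c|`, `b₁ = |ℬ_{1,i}|`, `b₂ = |ℬ_{2,k}|`,
penalty parameter `β`, estimator parameters `γ₁`, `γ₂`, step size `η`, and the choice
`s u ∈ ∂[u]_+` of a derivative of the hinge function. -/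
structure Params where
  b : ℕ
  c : ℕ
  b₁ : ℕ
  b₂ : ℕ
  β : ℝ
  γ₁ : ℝ
  γ₂ : ℝ
  η : ℝ
  s : ℝ → ℝ

/-- The state before an iteration: the iterates `x_t`, `x_{t-1}` and the estimators `u_{1,i}^t`,
`u_{2,k}^t`. -/
structure State (d n m : ℕ) where
  x : Vec d
  xPrev : Vec d
  u₁ : Fin n → ℝ
  u₂ : Fin m → ℝ

/-- The average of `a j` over a mini-batch of size `N`. -/
def batchMean {V : Type*} [AddCommGroup V] [Module ℝ V] {N : ℕ} (a : Fin N → V) : V :=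
  (1 / (N : ℝ)) • ∑ j, a j

/-- The factor `γ' = (N - B) / (B (1 - γ)) + 1 - γ`, for `B` out of `N` indices. -/
def correctionFactor (N B : ℕ) (γ : ℝ) : ℝ :=
  ((N : ℝ) - B) / ((B : ℝ) * (1 - γ)) + 1 - γ

section Algorithm

variable {d n m : ℕ} {Z Ξ : Type*} [MeasurableSpace Z] [MeasurableSpace Ξ]

/-- `G_1^t = (1 / |ℬ|) ∑ i ∈ ℬ, f_i'(u_{1,i}^t) ∂g_i(x_t; ℬ_{1,i})`. -/
def Problem.G₁ (p : Problem d n m Z Ξ) (a : Params) (S : State d n m)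
    (w : Draw n m a.b₁ a.b₂ Z Ξ) : Vec d :=
  (1 / (a.b : ℝ)) • ∑ i ∈ w.1,
    deriv (p.f i) (S.u₁ i) • batchMean fun j => p.dg i S.x (w.2.2.1 i j)

/-- `G_2^t = (β / |ℬ_c|) ∑ k ∈ ℬ_c, [u_{2,k}^t]'_+ ∂h_k(x_t; ℬ_{2,k})`. -/
def Problem.G₂ (p : Problem d n m Z Ξ) (a : Params) (S : State d n m)
    (w : Draw n m a.b₁ a.b₂ Z Ξ) : Vec d :=
  (a.β / (a.c : ℝ)) • ∑ k ∈ w.2.1,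
    a.s (S.u₂ k) • batchMean fun j => p.dh k S.x (w.2.2.2 k j)

/-- One iteration of the algorithm. -/
def Problem.step (p : Problem d n m Z Ξ) (a : Params) (S : State d n m)
    (w : Draw n m a.b₁ a.b₂ Z Ξ) : State d n m where
  x := S.x - a.η • (p.G₁ a S w + p.G₂ a S w)
  xPrev := S.x
  u₁ := fun i =>
    if i ∈ w.1 then
      (1 - a.γ₁) * S.u₁ i + a.γ₁ * (batchMean fun j => p.g i S.x (w.2.2.1 i j))
        + correctionFactor n a.b a.γ₁ * ((batchMean fun j => p.g i S.x (w.2.2.1 i j))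
          - batchMean fun j => p.g i S.xPrev (w.2.2.1 i j))
    else S.u₁ i
  u₂ := fun k =>
    if k ∈ w.2.1 then
      (1 - a.γ₂) * S.u₂ k + a.γ₂ * (batchMean fun j => p.h k S.x (w.2.2.2 k j))
        + correctionFactor m a.c a.γ₂ * ((batchMean fun j => p.h k S.x (w.2.2.2 k j))
          - batchMean fun j => p.h k S.xPrev (w.2.2.2 k j))
    else S.u₂ k

/-- The state after `t` iterations with draws `w 0, w 1, …`, started at `x₀` (with the convention
`x_{-1} = x₀`) and the estimators `u₁`, `u₂`. -/
def Problem.run (p : Problem d n m Z Ξ) (a : Params) (x₀ : Vec d) (u₁ : Fin n → ℝ)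
    (u₂ : Fin m → ℝ) (w : ℕ → Draw n m a.b₁ a.b₂ Z Ξ) : ℕ → State d n m
  | 0 => ⟨x₀, x₀, u₁, u₂⟩
  | t + 1 => p.step a (p.run a x₀ u₁ u₂ w t) (w t)

end Algorithm

end FCCO

end

/-! The Moreau envelope is a Lyapunov function. If `q` is the proximal point of `x_t`, the envelope
at `x_{t+1}` is at most the objective at `q` plus the scaled squared distance from `q` to `x_{t+1}`.
Expanding that square produces the inner product of the mean search direction with `q - x_t`. Were
the estimators exact, weak convexity and the minimality of `q` would bound it by a negative multiple
of the squared envelope gradient. Summation over time then controls the average squared gradient, up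
to the second moment of the directions and the errors of the estimators.

The two kinds of error enter differently. The derivative of each `f_i` is Lipschitz, so the error of
`u₁` enters as a mean square, which must be of order `ε²`. The derivative of the hinge jumps, and
convexity of the hinge only gives a loss linear in the error of `u₂`. With the weights `β` and `1 /
l`, which is of order `β`, this error must be of order `ε² / β²`. These two levels and the
increments of the iterates dictate the orders of `γ` and `η`.

The errors obey a contraction (`msvr_sq_add_sq_le`). The correction factor is such that, on average
over sampled and unsampled indices, the cross term between the old error and the drift of the inner
function vanishes. The drift hence enters only quadratically. Stationary levels follow by induction
along the run.

The initial error of `u₁` needs more care. It decays like `q ^ t` with `q = 1 - (b / n) γ`, and a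
direct treatment would cost `D² / ((b / n) γ ε)` in the sum of the gradient norms, too much for the
stated number of iterations. Instead, `g_i` is replaced at time `t` by `g_i + e_i^t` with `e^t = q ^
t • e^0` and `e^0` the initial error. Relative to this moving target the initial error is zero, and
the mean dynamics of the estimator preserve the shift up to a variance term of order `γ²`. The
time-dependent objective has the same curvature bound for every shift. Its values drift by at most
`L_f D` in total, because the changes of `q ^ t` telescope, and its envelope gradient differs from
the true one by a multiple of `q ^ t D`. The initial error therefore enters the sum of gradient
norms linearly, without the factor `1 / ε`.

The oracle of `g_i` consists of samplewise subgradients only. That their mean is the gradient of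
`g_i`, and that their second moments are at most `2 d L_g²`, follows from mean-square Lipschitz
continuity by limits of difference quotients (`lintegral_norm_sq_le`, `integral_eq_gradient`). -/

namespace FCCO

/-! ### Moreau envelopes of quadratically minorized functions -/

section Moreau

variable {E : Type*} [NormedAddCommGroup E] [InnerProductSpace ℝ E]

/-- At every point, `ψ` has a supporting concave parabola of curvature `ρ`. -/
def QuadMinorized (ρ : ℝ) (ψ : E → ℝ) : Prop :=
  ∀ z, ∃ v : E, ∀ y, ψ z + inner ℝ v (y - z) - ρ / 2 * ‖y - z‖ ^ 2 ≤ ψ y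

/-- `q` attains the minimum in the definition of the Moreau envelope. -/
def IsProx (ψ : E → ℝ) (θ : ℝ) (x q : E) : Prop :=
  ∀ y, ψ q + 1 / (2 * θ) * ‖q - x‖ ^ 2 ≤ ψ y + 1 / (2 * θ) * ‖y - x‖ ^ 2

theorem QuadMinorized.add {ρ ρ' : ℝ} {ψ ψ' : E → ℝ} (h : QuadMinorized ρ ψ)
    (h' : QuadMinorized ρ' ψ') : QuadMinorized (ρ + ρ') (fun x => ψ x + ψ' x) := by
  intro z
  obtain ⟨v, hv⟩ := h z
  obtain ⟨v', hv'⟩ := h' z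
  refine ⟨v + v', fun y => ?_⟩
  have := hv y
  have := hv' y
  rw [inner_add_left]
  linarith

theorem QuadMinorized.const_mul {ρ : ℝ} {ψ : E → ℝ} (h : QuadMinorized ρ ψ) {a : ℝ}
    (ha : 0 ≤ a) : QuadMinorized (a * ρ) (fun x => a * ψ x) := by
  intro z
  obtain ⟨v, hv⟩ := h z
  refine ⟨a • v, fun y => ?_⟩
  have := mul_le_mul_of_nonneg_left (hv y) ha
  rw [inner_smul_left]
  simp only [conj_trivial]
  linarith

theorem QuadMinorized.sum {ι : Type*} (s : Finset ι) {ρ : ℝ} {ψ : ι → E → ℝ}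
    (h : ∀ i, QuadMinorized ρ (ψ i)) :
    QuadMinorized (s.card * ρ) (fun x => ∑ i ∈ s, ψ i x) := by
  intro z
  choose v hv using fun i => h i z
  refine ⟨∑ i ∈ s, v i, fun y => ?_⟩
  have := Finset.sum_le_sum fun i (_ : i ∈ s) => hv i y
  rw [Finset.sum_sub_distrib, Finset.sum_add_distrib, Finset.sum_const, ← sum_inner,
    nsmul_eq_mul] at this
  linarith

theorem QuadMinorized.average {N : ℕ} (hN : 1 ≤ N) {ρ : ℝ} {ψ : Fin N → E → ℝ}
    (h : ∀ i, QuadMinorized ρ (ψ i)) :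
    QuadMinorized ρ (fun x => 1 / (N : ℝ) * ∑ i, ψ i x) := by
  have h1 := (QuadMinorized.sum Finset.univ h).const_mul (a := 1 / (N : ℝ)) (by positivity)
  have hN' : (N : ℝ) ≠ 0 := by positivity
  convert h1 using 1
  simp
  field_simp

/-- The supporting parabola at `x` itself makes the objective coercive: it is at least `ψ x + κ ‖y -
x‖² - ‖v‖ ‖y - x‖`, which is no smaller than its value at `x` as soon as `‖y - x‖ ≥ ‖v‖ / κ`. A
minimum over that closed ball is thus global. -/
theorem exists_isProx [ProperSpace E] {ψ : E → ℝ} {ρ θ : ℝ} (hψ : QuadMinorized ρ ψ)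
    (hc : Continuous ψ) (hθ : 0 < θ) (hρ : θ * ρ < 1) (x : E) : ∃ q, IsProx ψ θ x q := by
  obtain ⟨v, hv⟩ := hψ x
  set κ := (1 / θ - ρ) / 2 with hκ
  have hκ0 : 0 < κ := by
    rw [hκ]
    have : ρ < 1 / θ := by rw [lt_div_iff₀ hθ]; linarith
    linarith
  have hcont : Continuous fun y => ψ y + 1 / (2 * θ) * ‖y - x‖ ^ 2 := by fun_prop
  obtain ⟨q, hq, hmin⟩ := (isCompact_closedBall x (‖v‖ / κ)).exists_isMinOn
    ⟨x, Metric.mem_closedBall_self (by positivity)⟩ hcont.continuousOn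
  refine ⟨q, fun y => ?_⟩
  by_cases hy : y ∈ Metric.closedBall x (‖v‖ / κ)
  · exact hmin hy
  · have h0 := hmin (Metric.mem_closedBall_self (x := x) (ε := ‖v‖ / κ) (by positivity))
    simp only [Set.mem_ofPred_eq, sub_self, norm_zero] at h0
    rw [Metric.mem_closedBall, dist_eq_norm, not_le, div_lt_iff₀ hκ0] at hy
    have h1 := hv y
    have h2 := neg_le_of_abs_le (abs_real_inner_le_norm v (y - x))
    have h3 : 1 / (2 * θ) * ‖y - x‖ ^ 2 = κ * ‖y - x‖ ^ 2 + ρ / 2 * ‖y - x‖ ^ 2 := by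
      rw [hκ]; field_simp; ring
    have h4 : ‖v‖ * ‖y - x‖ ≤ κ * ‖y - x‖ ^ 2 := by
      nlinarith [norm_nonneg (y - x)]
    have h5 : ψ x ≤ ψ y + 1 / (2 * θ) * ‖y - x‖ ^ 2 := by linarith
    refine le_trans h0 ?_
    simpa using h5

omit [InnerProductSpace ℝ E] in
theorem IsProx.moreauEnvelope_eq {ψ : E → ℝ} {θ : ℝ} {x q : E} (h : IsProx ψ θ x q) :
    moreauEnvelope ψ θ x = ψ q + 1 / (2 * θ) * ‖q - x‖ ^ 2 :=
  le_antisymm (ciInf_le ⟨_, by rintro _ ⟨y, rfl⟩; exact h y⟩ q) (le_ciInf h)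

omit [InnerProductSpace ℝ E] in
theorem IsProx.moreauEnvelope_le {ψ : E → ℝ} {θ : ℝ} {x q : E} (h : IsProx ψ θ x q) (y : E) :
    moreauEnvelope ψ θ x ≤ ψ y + 1 / (2 * θ) * ‖y - x‖ ^ 2 :=
  h.moreauEnvelope_eq ▸ h y

/-- Quadratic growth at the proximal point. -/
theorem IsProx.growth {ψ : E → ℝ} {ρ θ : ℝ} (hψ : QuadMinorized ρ ψ) {x q : E}
    (h : IsProx ψ θ x q) (hθ : θ ≠ 0) (y : E) :
    ψ q + 1 / (2 * θ) * ‖q - x‖ ^ 2 + (1 / θ - ρ) / 2 * ‖y - q‖ ^ 2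
      ≤ ψ y + 1 / (2 * θ) * ‖y - x‖ ^ 2 := by
  set μ := 1 / θ - ρ with hμ
  -- The supporting parabola is taken at the intermediate point `z`, and its values at `q` and `y`
  -- are combined with weights `1 - t` and `t`, so that the unknown slope `v` cancels. Comparison
  -- with the minimality of `q` and division by `t` leave the factor `1 - t`, removed by letting `t`
  -- tend to zero.
  have key : ∀ t ∈ Set.Ioo (0 : ℝ) 1,
      ψ q + 1 / (2 * θ) * ‖q - x‖ ^ 2 + μ / 2 * (1 - t) * ‖y - q‖ ^ 2
        ≤ ψ y + 1 / (2 * θ) * ‖y - x‖ ^ 2 := by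
    rintro t ⟨ht0, ht1⟩
    set z := q + t • (y - q) with hz
    obtain ⟨v, hv⟩ := hψ z
    have hq := hv q
    have hy := hv y
    have hmin := h z
    have e1 : q - z = (-t) • (y - q) := by rw [hz]; module
    have e2 : y - z = (1 - t) • (y - q) := by rw [hz]; module
    have e3 : z - x = (q - x) + t • (y - q) := by rw [hz]; module
    have e4 : y - x = (q - x) + (y - q) := by module
    rw [e1, norm_smul, inner_smul_right, mul_pow, Real.norm_eq_abs, sq_abs] at hq
    rw [e2, norm_smul, inner_smul_right, mul_pow, Real.norm_eq_abs, sq_abs] at hy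
    rw [e3, norm_add_sq_real, norm_smul, inner_smul_right, mul_pow, Real.norm_eq_abs,
      sq_abs] at hmin
    rw [e4, norm_add_sq_real]
    have hρ : 1 / (2 * θ) = (μ + ρ) / 2 := by rw [hμ]; field_simp; ring
    rw [hρ] at hmin ⊢
    set A := inner ℝ v (y - q)
    set B := inner ℝ (q - x) (y - q)
    set N := ‖y - q‖ ^ 2
    set M := ‖q - x‖ ^ 2
    have h1 := mul_le_mul_of_nonneg_left hq (sub_nonneg.2 ht1.le)
    have h2 := mul_le_mul_of_nonneg_left hy ht0.le
    have : t * (ψ q + (μ + ρ) / 2 * M + μ / 2 * (1 - t) * N)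
        ≤ t * (ψ y + (μ + ρ) / 2 * (M + 2 * B + N)) := by
      nlinarith
    exact le_of_mul_le_mul_left this ht0
  have hlim : Filter.Tendsto (fun t : ℝ => ψ q + 1 / (2 * θ) * ‖q - x‖ ^ 2
      + μ / 2 * (1 - t) * ‖y - q‖ ^ 2) (nhdsWithin 0 (Set.Ioi 0))
      (nhds (ψ q + 1 / (2 * θ) * ‖q - x‖ ^ 2 + μ / 2 * (1 - 0) * ‖y - q‖ ^ 2)) := by
    apply tendsto_nhdsWithin_of_tendsto_nhds
    apply Continuous.tendsto
    fun_prop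
  rw [sub_zero, mul_one] at hlim
  refine le_of_tendsto hlim ?_
  filter_upwards [Ioo_mem_nhdsGT (zero_lt_one' ℝ)] with t ht using key t ht

theorem hasGradientAt_of_quadratic_bound [CompleteSpace E] {φ : E → ℝ} {g x : E} {K : ℝ}
    (h : ∀ y, |φ y - φ x - inner ℝ g (y - x)| ≤ K * ‖y - x‖ ^ 2) : HasGradientAt φ g x := by
  rw [hasGradientAt_iff_isLittleO]
  have h1 : (fun y => φ y - φ x - inner ℝ g (y - x)) =O[nhds x] fun y => ‖y - x‖ ^ 2 :=
    Asymptotics.IsBigO.of_bound K (Filter.Eventually.of_forall fun y => by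
      simpa using h y)
  refine h1.trans_isLittleO ?_
  have h2 : (fun y => ‖y - x‖ ^ 2) =o[nhds x] fun y => ‖y - x‖ := by
    have : (fun r : ℝ => r ^ 2) =o[nhds 0] fun r => r := by
      simpa using Asymptotics.isLittleO_pow_pow (𝕜 := ℝ) (m := 1) (n := 2) (by norm_num)
    refine this.comp_tendsto (k := fun y => ‖y - x‖) ?_
    have : Continuous fun y => ‖y - x‖ := by fun_prop
    simpa using this.tendsto x
  exact h2.norm_right.congr_right (fun y => by simp) |>.of_norm_right

/-- Two functions whose difference is Lipschitz have close proximal points. -/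
theorem IsProx.norm_sub_le_of_lipschitz {ψ ψ' : E → ℝ} {ρ θ K : ℝ} (hψ : QuadMinorized ρ ψ)
    (hψ' : QuadMinorized ρ ψ') (hK0 : 0 ≤ K)
    (hK : ∀ y z, |(ψ y - ψ' y) - (ψ z - ψ' z)| ≤ K * ‖y - z‖) {x q q' : E}
    (h : IsProx ψ θ x q) (h' : IsProx ψ' θ x q') (hθ : 0 < θ) :
    (1 / θ - ρ) * ‖q - q'‖ ≤ K := by
  rcases eq_or_lt_of_le (norm_nonneg (q - q')) with h0 | h0
  · rwa [← h0, mul_zero]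
  · have g1 := h.growth hψ hθ.ne' q'
    have g2 := h'.growth hψ' hθ.ne' q
    have := hK q' q
    rw [norm_sub_rev q' q] at g1 this
    have h3 := (abs_le.1 this).2
    have : (1 / θ - ρ) * ‖q - q'‖ * ‖q - q'‖ ≤ K * ‖q - q'‖ := by nlinarith
    exact le_of_mul_le_mul_right this h0

/-- Each growth inequality is tested at the other proximal point. In the sum all values of `ψ`
cancel, and the squared distances combine to `2 ⟪q - q', x - x'⟫`. -/
theorem IsProx.norm_sub_le {ψ : E → ℝ} {ρ θ : ℝ} (hψ : QuadMinorized ρ ψ)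
    {x x' q q' : E} (h : IsProx ψ θ x q) (h' : IsProx ψ θ x' q') (hθ : 0 < θ) :
    (1 - θ * ρ) * ‖q - q'‖ ≤ ‖x - x'‖ := by
  rcases eq_or_lt_of_le (norm_nonneg (q - q')) with h0 | h0
  · rw [← h0, mul_zero]; positivity
  · have g1 := h.growth hψ hθ.ne' q'
    have g2 := h'.growth hψ hθ.ne' q
    rw [norm_sub_rev q' q] at g1
    have e1 : ‖q' - x‖ ^ 2 - ‖q - x‖ ^ 2 + (‖q - x'‖ ^ 2 - ‖q' - x'‖ ^ 2)
        = 2 * inner ℝ (q - q') (x - x') := by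
      have a1 : q' - x = (q - x) - (q - q') := by module
      have a2 : q - x' = (q - x) + (x - x') := by module
      have a3 : q' - x' = ((q - x) - (q - q')) + (x - x') := by module
      rw [a3, norm_add_sq_real, a1, a2, norm_add_sq_real (q - x), norm_sub_sq_real,
        inner_sub_left (q - x) (q - q')]
      ring
    have h2 := real_inner_le_norm (q - q') (x - x')
    have h3 : (1 / θ - ρ) * ‖q - q'‖ ^ 2 ≤ 1 / (2 * θ) * (2 * inner ℝ (q - q') (x - x')) := by
      rw [← e1]; nlinarith
    have h4 := mul_le_mul_of_nonneg_left h3 hθ.le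
    have e2 : θ * ((1 / θ - ρ) * ‖q - q'‖ ^ 2) = (1 - θ * ρ) * ‖q - q'‖ ^ 2 := by field_simp
    have e3 : θ * (1 / (2 * θ) * (2 * inner ℝ (q - q') (x - x')))
        = inner ℝ (q - q') (x - x') := by field_simp
    rw [e2, e3] at h4
    refine le_of_mul_le_mul_right (a := ‖q - q'‖) ?_ h0
    nlinarith

/-- Exchanging proximal points gives both bounds: `q` is a competitor at `y`, and `q'` is a
competitor at `x`. The two estimates differ by `⟪q - q', y - x⟫ / θ`, which is quadratic in `‖y -
x‖` because proximal points depend on the centre in a Lipschitz way. -/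
theorem hasGradientAt_moreauEnvelope [ProperSpace E] {ψ : E → ℝ} {ρ θ : ℝ}
    (hψ : QuadMinorized ρ ψ) (hc : Continuous ψ) (hθ : 0 < θ) (hρ : θ * ρ < 1) {x q : E}
    (h : IsProx ψ θ x q) : HasGradientAt (moreauEnvelope ψ θ) ((1 / θ) • (x - q)) x := by
  have hK : 0 < 1 - θ * ρ := by linarith
  refine hasGradientAt_of_quadratic_bound (K := 1 / θ * (1 + 1 / (1 - θ * ρ))) fun y => ?_
  obtain ⟨q', h'⟩ := exists_isProx hψ hc hθ hρ y
  have u1 := h'.moreauEnvelope_le q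
  have u2 := h.moreauEnvelope_le q'
  have v1 := h.moreauEnvelope_eq
  have v2 := h'.moreauEnvelope_eq
  have l1 := h.norm_sub_le hψ h' hθ
  have l2 : ‖q - q'‖ ≤ 1 / (1 - θ * ρ) * ‖y - x‖ := by
    rw [norm_sub_rev y x, one_div, inv_mul_eq_div, le_div_iff₀ hK]; linarith
  have e1 : ‖q - y‖ ^ 2 = ‖q - x‖ ^ 2 + 2 * inner ℝ (x - q) (y - x) + ‖y - x‖ ^ 2 := by
    have : q - y = -((x - q) + (y - x)) := by module
    rw [this, norm_neg, norm_add_sq_real, norm_sub_rev x q]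
  have e2 : ‖q' - y‖ ^ 2 = ‖q' - x‖ ^ 2 + 2 * (inner ℝ (x - q) (y - x)
      + inner ℝ (q - q') (y - x)) + ‖y - x‖ ^ 2 := by
    have : q' - y = -(((x - q) + (q - q')) + (y - x)) := by module
    rw [this, norm_neg, norm_add_sq_real, inner_add_left,
      show (x - q) + (q - q') = -(q' - x) by module, norm_neg]
  have i1 := neg_le_of_abs_le (abs_real_inner_le_norm (q - q') (y - x))
  have i2 : ‖q - q'‖ * ‖y - x‖ ≤ 1 / (1 - θ * ρ) * ‖y - x‖ ^ 2 := by
    nlinarith [norm_nonneg (y - x)]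
  have ht : 1 / (2 * θ) = 1 / θ / 2 := by field_simp
  have hτ : 0 < 1 / θ := by positivity
  have hN : 0 ≤ 1 / (1 - θ * ρ) * ‖y - x‖ ^ 2 := by positivity
  rw [inner_smul_left, conj_trivial, abs_le]
  rw [ht] at u1 u2 v1 v2
  generalize 1 / θ = τ at *
  generalize 1 / (1 - θ * ρ) = κ at *
  have i3 := mul_le_mul_of_nonneg_left i2 hτ.le
  have i4 := mul_le_mul_of_nonneg_left i1 hτ.le
  rw [e1] at u1
  rw [e2] at v2
  have hN2 : 0 ≤ τ * (κ * ‖y - x‖ ^ 2) := by positivity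
  have hN3 : 0 ≤ τ * (‖y - x‖ ^ 2) := by positivity
  constructor
  · nlinarith
  · nlinarith

/-- A proximal point of `ψ` at `x`. -/
noncomputable def prox (ψ : E → ℝ) (θ : ℝ) (x : E) : E := Classical.epsilon (IsProx ψ θ x)

section Prox

variable [ProperSpace E] {ψ : E → ℝ} {ρ θ : ℝ} (hψ : QuadMinorized ρ ψ) (hc : Continuous ψ)
  (hθ : 0 < θ) (hρ : θ * ρ < 1)
include hψ hc hθ hρ

theorem isProx_prox (x : E) : IsProx ψ θ x (prox ψ θ x) :=
  Classical.epsilon_spec (exists_isProx hψ hc hθ hρ x)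

theorem gradient_moreauEnvelope (x : E) :
    gradient (moreauEnvelope ψ θ) x = (1 / θ) • (x - prox ψ θ x) :=
  (hasGradientAt_moreauEnvelope hψ hc hθ hρ (isProx_prox hψ hc hθ hρ x)).gradient

theorem differentiable_moreauEnvelope : Differentiable ℝ (moreauEnvelope ψ θ) := fun x =>
  (hasGradientAt_moreauEnvelope hψ hc hθ hρ (isProx_prox hψ hc hθ hρ x)).differentiableAt

theorem continuous_prox : Continuous (prox ψ θ) := by
  have hK : 0 < 1 - θ * ρ := by linarith
  refine LipschitzWith.continuous (K := Real.toNNReal (1 / (1 - θ * ρ))) ?_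
  refine LipschitzWith.of_dist_le_mul fun x y => ?_
  have := (isProx_prox hψ hc hθ hρ x).norm_sub_le hψ (isProx_prox hψ hc hθ hρ y) hθ
  rw [dist_eq_norm, dist_eq_norm, Real.coe_toNNReal _ (by positivity), one_div,
    inv_mul_eq_div, le_div_iff₀ hK]
  linarith

theorem continuous_gradient_moreauEnvelope : Continuous (gradient (moreauEnvelope ψ θ)) := by
  have := continuous_prox hψ hc hθ hρ
  rw [show gradient (moreauEnvelope ψ θ) = fun x => (1 / θ) • (x - prox ψ θ x) from
    funext (gradient_moreauEnvelope hψ hc hθ hρ)]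
  fun_prop

end Prox

/-- Transfers gradient bounds from the shifted objectives to the true one. Both envelope gradients
are displacements to proximal points, so closeness of the proximal points suffices. -/
theorem norm_gradient_moreauEnvelope_sub_le [ProperSpace E] {ψ ψ' : E → ℝ} {ρ θ K : ℝ}
    (hψ : QuadMinorized ρ ψ) (hc : Continuous ψ) (hψ' : QuadMinorized ρ ψ')
    (hc' : Continuous ψ') (hθ : 0 < θ) (hρ : θ * ρ < 1) (hK0 : 0 ≤ K)
    (hK : ∀ y z, |(ψ y - ψ' y) - (ψ z - ψ' z)| ≤ K * ‖y - z‖) (x : E) :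
    (1 - θ * ρ) * ‖gradient (moreauEnvelope ψ θ) x - gradient (moreauEnvelope ψ' θ) x‖ ≤ K := by
  have h := (isProx_prox hψ hc hθ hρ x).norm_sub_le_of_lipschitz hψ hψ' hK0 hK
    (isProx_prox hψ' hc' hθ hρ x) hθ
  rw [gradient_moreauEnvelope hψ hc hθ hρ, gradient_moreauEnvelope hψ' hc' hθ hρ, ← smul_sub,
    norm_smul, Real.norm_of_nonneg (by positivity)]
  rw [norm_sub_rev] at h
  convert h using 1
  rw [show x - prox ψ θ x - (x - prox ψ' θ x) = prox ψ' θ x - prox ψ θ x by module]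
  field_simp

omit [InnerProductSpace ℝ E] in
theorem moreauEnvelope_le_self {ψ : E → ℝ} {θ : ℝ} {x q : E} (h : IsProx ψ θ x q) :
    moreauEnvelope ψ θ x ≤ ψ x := by
  simpa using h.moreauEnvelope_le x

omit [InnerProductSpace ℝ E] in
theorem le_moreauEnvelope {ψ : E → ℝ} {θ B : ℝ} {x q : E} (h : IsProx ψ θ x q) (hθ : 0 < θ)
    (hB : ∀ y, B ≤ ψ y) : B ≤ moreauEnvelope ψ θ x := by
  rw [h.moreauEnvelope_eq]
  have : 0 ≤ 1 / (2 * θ) * ‖q - x‖ ^ 2 := by positivity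
  linarith [hB q]

end Moreau

/-! ### The hinge function -/

/-- The local inequality becomes global by convexity: it is applied at `u + t (v - u)` for small
`t`, divided by `t`, and the error weight `δ` is sent to zero. -/
theorem hinge_subgradient {u s : ℝ} (hs : s ∈ subdifferential hinge u) (v : ℝ) :
    hinge u + s * (v - u) ≤ hinge v := by
  have key : ∀ δ : ℝ, 0 < δ → hinge u + s * (v - u) - δ * |v - u| ≤ hinge v := by
    intro δ hδ
    have h1 := hs δ hδ
    have hlim : Filter.Tendsto (fun t : ℝ => u + t * (v - u)) (nhdsWithin 0 (Set.Ioi 0))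
        (nhds u) := by
      apply tendsto_nhdsWithin_of_tendsto_nhds
      have : Continuous fun t : ℝ => u + t * (v - u) := by fun_prop
      simpa using this.tendsto 0
    obtain ⟨t, ht, ht0, ht1⟩ := ((hlim.eventually h1).and
      (Ioo_mem_nhdsGT (zero_lt_one' ℝ))).exists
    simp only [add_sub_cancel_left, RCLike.inner_apply, conj_trivial, norm_mul,
      Real.norm_eq_abs, abs_of_pos ht0] at ht
    have hconv : hinge (u + t * (v - u)) ≤ (1 - t) * hinge u + t * hinge v := by
      unfold hinge
      have a1 := le_max_left 0 u
      have a2 := le_max_right 0 u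
      have b1 := le_max_left 0 v
      have b2 := le_max_right 0 v
      refine max_le (by nlinarith) (by nlinarith)
    have : t * (hinge u + s * (v - u) - δ * |v - u|) ≤ t * hinge v := by linarith
    exact le_of_mul_le_mul_left this ht0
  have hlim : Filter.Tendsto (fun δ : ℝ => hinge u + s * (v - u) - δ * |v - u|)
      (nhdsWithin 0 (Set.Ioi 0)) (nhds (hinge u + s * (v - u) - 0 * |v - u|)) := by
    apply tendsto_nhdsWithin_of_tendsto_nhds
    apply Continuous.tendsto
    fun_prop
  rw [zero_mul, sub_zero] at hlim
  refine le_of_tendsto hlim ?_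
  filter_upwards [self_mem_nhdsWithin] with δ hδ using key δ hδ

theorem hinge_sub_le (u v : ℝ) : hinge u - hinge v ≤ |u - v| := by
  unfold hinge
  rw [sub_le_iff_le_add]
  refine max_le (by positivity) ?_
  linarith [le_abs_self (u - v), le_max_right 0 v]

theorem hinge_subgradient_mem_Icc {u s : ℝ} (hs : s ∈ subdifferential hinge u) :
    0 ≤ s ∧ s ≤ 1 := by
  have h1 := hinge_subgradient hs (u + 1)
  have h2 := hinge_subgradient hs (u - 1)
  have h3 := hinge_sub_le (u + 1) u
  have h4 : hinge (u - 1) ≤ hinge u := max_le_max le_rfl (by linarith)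
  simp only [add_sub_cancel_left, abs_one] at h1 h3
  constructor <;> linarith

/-- Subgradients of a convex function on the line are monotone, so every selection is measurable. -/
theorem measurable_hinge_subgradient {s : ℝ → ℝ} (hs : ∀ u, s u ∈ subdifferential hinge u) :
    Measurable s := by
  refine Monotone.measurable fun u v huv => ?_
  rcases eq_or_lt_of_le huv with rfl | h
  · exact le_rfl
  · have h1 := hinge_subgradient (hs u) v
    have h2 := hinge_subgradient (hs v) u
    have : s u * (v - u) ≤ s v * (v - u) := by linarith
    exact le_of_mul_le_mul_right this (by linarith)

/-! ### Curvature of compositions with the hinge and with smooth outer functions -/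

section Composition

variable {E : Type*} [NormedAddCommGroup E] [InnerProductSpace ℝ E]

/-- Where `h ≤ 0` the zero slope supports the nonnegative hinge; where `h > 0` the hinge agrees with
`h` at the point and dominates it elsewhere. Nonemptiness of the subdifferentials is essential,
since `WeaklyConvex` says nothing at points without subgradients. -/
theorem WeaklyConvex.quadMinorized_hinge_comp {ρ : ℝ} (hρ : 0 ≤ ρ) {h : E → ℝ}
    (hw : WeaklyConvex ρ h) (hne : ∀ x, (subdifferential h x).Nonempty) :
    QuadMinorized ρ (fun x => hinge (h x)) := by
  intro z
  obtain ⟨v, hv⟩ := hne z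
  by_cases h0 : h z ≤ 0
  · refine ⟨0, fun y => ?_⟩
    have h1 : hinge (h z) = 0 := max_eq_left h0
    have h2 : 0 ≤ hinge (h y) := le_max_left _ _
    have h3 : 0 ≤ ρ / 2 * ‖y - z‖ ^ 2 := by positivity
    simp only [h1, inner_zero_left]
    linarith
  · refine ⟨v, fun y => ?_⟩
    have h1 : hinge (h z) = h z := max_eq_right (not_le.1 h0).le
    have h2 : h y ≤ hinge (h y) := le_max_right _ _
    have h3 := hw y z v hv
    simp only [h1]
    linarith

/-- The price of using the slope of the hinge at the estimate `u` instead of `h x`. Since `0 ≤ s ≤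
1`, the weak convexity inequality may be multiplied by `s`, and convexity of the hinge at `u` bounds
`s (h y - u)`. Passing from `u` to `h x` costs `|u - h x|` twice, once in the slope term and once in
the hinge value. -/
theorem WeaklyConvex.hinge_subgradient_mul_inner_le {ρ : ℝ} (hρ : 0 ≤ ρ) {h : E → ℝ}
    (hw : WeaklyConvex ρ h) {x y v : E} (hv : v ∈ subdifferential h x) {u s : ℝ}
    (hs : s ∈ subdifferential hinge u) :
    s * inner ℝ v (y - x) ≤ hinge (h y) - hinge (h x) + 2 * |u - h x| + ρ / 2 * ‖y - x‖ ^ 2 := by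
  obtain ⟨hs0, hs1⟩ := hinge_subgradient_mem_Icc hs
  have h1 := hw y x v hv
  have h2 := hinge_subgradient hs (h y)
  have h3 := hinge_sub_le (h x) u
  rw [abs_sub_comm] at h3
  have h4 : 0 ≤ ρ / 2 * ‖y - x‖ ^ 2 := by positivity
  have h5 := mul_le_mul_of_nonneg_left h1 hs0
  have h6 : s * (u - h x) ≤ |u - h x| := by
    nlinarith [le_abs_self (u - h x), abs_nonneg (u - h x)]
  nlinarith

theorem IsSmooth.abs_deriv_sub_le {L : ℝ} {f : ℝ → ℝ} (hf : IsSmooth L f) (a b : ℝ) :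
    |deriv f a - deriv f b| ≤ L * |a - b| := by
  rcases eq_or_ne a b with rfl | hab
  · simp
  have h1 := hf.2 a b
  have h2 := hf.2 b a
  simp only [gradient_eq_deriv', RCLike.inner_apply, conj_trivial, Real.norm_eq_abs, sq_abs]
    at h1 h2
  have hpos : 0 < |a - b| := abs_pos.2 (sub_ne_zero.2 hab)
  refine le_of_mul_le_mul_right (a := |a - b|) ?_ hpos
  rw [← abs_mul, mul_assoc, ← sq, sq_abs]
  rw [abs_le] at h1 h2 ⊢
  constructor <;> nlinarith

theorem IsSmooth.le_add_deriv_mul {L : ℝ} {f : ℝ → ℝ} (hf : IsSmooth L f) (a b : ℝ) :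
    f b + deriv f b * (a - b) - L / 2 * (a - b) ^ 2 ≤ f a := by
  have h1 := hf.2 a b
  simp only [gradient_eq_deriv', RCLike.inner_apply, conj_trivial, Real.norm_eq_abs, sq_abs]
    at h1
  linarith [(abs_le.1 h1).1, mul_comm (deriv f b) (a - b)]

theorem abs_deriv_le_of_lipschitz {K : ℝ≥0} {f : ℝ → ℝ} (hf : LipschitzWith K f) (a : ℝ) :
    |deriv f a| ≤ K := norm_deriv_le_of_lipschitz hf

/-- The curvature comes from linearizing `f` and then `g`. It does not involve the shift `e`, so all
shifted objectives share one curvature bound. -/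
theorem le_comp_add_deriv_mul_inner [CompleteSpace E] {K L M N : ℝ≥0} {f : ℝ → ℝ} {g : E → ℝ}
    (hf : LipschitzWith K f) (hf' : IsSmooth L f) (hg : LipschitzWith M g) (hg' : IsSmooth N g)
    (e : ℝ) (x z : E) :
    f (g z + e) + deriv f (g z + e) * inner ℝ (gradient g z) (x - z)
      - (K * N + L * M ^ 2 : ℝ) / 2 * ‖x - z‖ ^ 2 ≤ f (g x + e) := by
  have h1 := hf'.le_add_deriv_mul (g x + e) (g z + e)
  rw [add_sub_add_right_eq_sub] at h1
  have h2 := hg'.2 x z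
  have h3 := abs_deriv_le_of_lipschitz hf (g z + e)
  have h4 : |g x - g z| ≤ M * ‖x - z‖ := by
    simpa [dist_eq_norm] using hg.dist_le_mul x z
  have h5 : (g x - g z) ^ 2 ≤ (M * ‖x - z‖) ^ 2 := sq_le_sq' (abs_le.1 h4).1 (abs_le.1 h4).2
  have h6 : |deriv f (g z + e) * (g x - g z - inner ℝ (gradient g z) (x - z))|
      ≤ K * (N / 2 * ‖x - z‖ ^ 2) := by
    rw [abs_mul]
    exact mul_le_mul h3 h2 (abs_nonneg _) K.2
  have h7 := (abs_le.1 h6).1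
  have h8 := mul_le_mul_of_nonneg_left h5 L.2
  simp only [NNReal.val_eq_coe] at h8
  nlinarith

/-- The map `x ↦ f (x + e) - f x` has derivative at most `L * |e|` in absolute value. A shift
therefore perturbs the objective by a function whose Lipschitz constant is proportional to the
shift. -/
theorem abs_sub_sub_sub_le {L : ℝ} {f : ℝ → ℝ} (hf : IsSmooth L f) (a b e : ℝ) :
    |(f (a + e) - f a) - (f (b + e) - f b)| ≤ L * |e| * |a - b| := by
  have hd := hf.1
  have hder : ∀ x, HasDerivAt (fun x => f (x + e) - f x) (deriv f (x + e) - deriv f x) x :=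
    fun x => ((hd (x + e)).hasDerivAt.comp_add_const x e).sub (hd x).hasDerivAt
  have := Convex.norm_image_sub_le_of_norm_hasDerivWithin_le (C := L * |e|) (s := Set.univ)
    (f := fun x => f (x + e) - f x) (f' := fun x => deriv f (x + e) - deriv f x)
    (fun x _ => (hder x).hasDerivWithinAt)
    (fun x _ => by simpa using hf.abs_deriv_sub_le (x + e) x) convex_univ
    (Set.mem_univ b) (Set.mem_univ a)
  simpa using this

end Composition

/-! ### Second moments and means of stochastic subgradients -/

section StochasticSubgradient

variable {d : ℕ} {Z : Type*} [MeasurableSpace Z] {P : Measure Z}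

/-- The difference quotient of `H · z` at `x` in the direction `u` with step `1 / (k + 1)`. -/
noncomputable def diffQuot (H : Vec d → Z → ℝ) (x u : Vec d) (k : ℕ) (z : Z) : ℝ :=
  ((k : ℝ) + 1) * (H (x + (1 / ((k : ℝ) + 1)) • u) z - H x z)

theorem tendsto_add_one_div_smul (x u : Vec d) :
    Filter.Tendsto (fun k : ℕ => x + (1 / ((k : ℝ) + 1)) • u) Filter.atTop (nhds x) := by
  have h1 := (tendsto_one_div_add_atTop_nhds_zero_nat (𝕜 := ℝ)).smul_const u
  simpa using h1.const_add x

-- A subgradient bounds the difference quotients only from below, in the limit. Hence only the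
-- positive part of the deficit tends to zero; the quotients themselves need not converge.
omit [MeasurableSpace Z] in
theorem tendsto_max_inner_sub_diffQuot {H : Vec d → Z → ℝ} {x v : Vec d} {z : Z}
    (hv : v ∈ subdifferential (fun y => H y z) x) (u : Vec d) :
    Filter.Tendsto (fun k => max 0 (inner ℝ v u - diffQuot H x u k z)) Filter.atTop (nhds 0) := by
  rw [Metric.tendsto_atTop]
  intro δ hδ
  have h1 := (tendsto_add_one_div_smul x u).eventually
    (hv (δ / (2 * (‖u‖ + 1))) (by positivity))
  obtain ⟨N, hN⟩ := Filter.eventually_atTop.1 h1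
  refine ⟨N, fun k hk => ?_⟩
  have h2 := hN k hk
  have hk0 : (0 : ℝ) < (k : ℝ) + 1 := by positivity
  rw [add_sub_cancel_left, inner_smul_right, norm_smul, Real.norm_of_nonneg (by positivity)] at h2
  have h3 := mul_le_mul_of_nonneg_left h2 hk0.le
  have h4 : δ / (2 * (‖u‖ + 1)) * ‖u‖ ≤ δ / 2 := by
    rw [div_mul_eq_mul_div, div_le_div_iff₀ (by positivity) (by norm_num)]
    nlinarith [norm_nonneg u]
  have h5 : ((k : ℝ) + 1) * (H x z + 1 / ((k : ℝ) + 1) * inner ℝ v u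
      - δ / (2 * (‖u‖ + 1)) * (1 / ((k : ℝ) + 1) * ‖u‖))
      = ((k : ℝ) + 1) * H x z + inner ℝ v u - δ / (2 * (‖u‖ + 1)) * ‖u‖ := by
    field_simp
  rw [h5] at h3
  have h6 : inner ℝ v u - diffQuot H x u k z ≤ δ / 2 := by
    unfold diffQuot; linarith
  rw [dist_zero_right, Real.norm_of_nonneg (le_max_left _ _)]
  exact lt_of_le_of_lt (max_le (by positivity) h6) (by linarith)

variable {H : Vec d → Z → ℝ} {L : ℝ} {x : Vec d} {v : Z → Vec d}

theorem measurable_diffQuot (hH : ∀ y, Measurable (H y)) (x u : Vec d) (k : ℕ) :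
    Measurable (diffQuot H x u k) := by
  have := hH (x + (1 / ((k : ℝ) + 1)) • u)
  have := hH x
  unfold diffQuot
  fun_prop

theorem lintegral_diffQuot_sq_le
    (hL : ∀ x y, ∫⁻ z, ENNReal.ofReal ((H x z - H y z) ^ 2) ∂P
      ≤ ENNReal.ofReal (L ^ 2 * ‖x - y‖ ^ 2)) (x u : Vec d) (k : ℕ) :
    ∫⁻ z, ENNReal.ofReal (diffQuot H x u k z ^ 2) ∂P ≤ ENNReal.ofReal (L ^ 2 * ‖u‖ ^ 2) := by
  have hk0 : (0 : ℝ) < (k : ℝ) + 1 := by positivity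
  have h1 := hL (x + (1 / ((k : ℝ) + 1)) • u) x
  rw [add_sub_cancel_left, norm_smul, Real.norm_of_nonneg (by positivity)] at h1
  unfold diffQuot
  simp_rw [mul_pow, ENNReal.ofReal_mul (sq_nonneg ((k : ℝ) + 1))]
  rw [lintegral_const_mul' _ _ ENNReal.ofReal_ne_top]
  refine (mul_le_mul_right h1 _).trans ?_
  rw [← ENNReal.ofReal_mul (sq_nonneg _)]
  apply ENNReal.ofReal_le_ofReal
  apply le_of_eq
  field_simp

/-- Subtracting the deficit turns `⟪v, u⟫` into the minimum of `⟪v, u⟫` and the difference quotient.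
The square of its positive part is below the squared quotient and converges to the required
integrand, so Fatou's lemma applies. -/
theorem lintegral_max_inner_sq_le (hH : ∀ y, Measurable (H y)) (hv : Measurable v)
    (hsub : ∀ᵐ z ∂P, v z ∈ subdifferential (fun y => H y z) x)
    (hL : ∀ x y, ∫⁻ z, ENNReal.ofReal ((H x z - H y z) ^ 2) ∂P
      ≤ ENNReal.ofReal (L ^ 2 * ‖x - y‖ ^ 2)) (u : Vec d) :
    ∫⁻ z, ENNReal.ofReal (max 0 (inner ℝ (v z) u) ^ 2) ∂P
      ≤ ENNReal.ofReal (L ^ 2 * ‖u‖ ^ 2) := by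
  have hX := fun k => measurable_diffQuot hH x u k
  set a : ℕ → Z → ENNReal := fun k z => ENNReal.ofReal
    (max 0 (inner ℝ (v z) u - max 0 (inner ℝ (v z) u - diffQuot H x u k z)) ^ 2) with ha
  have hmeas : ∀ k, Measurable (a k) := fun k => by
    have := hX k
    fun_prop
  have hlim : ∀ᵐ z ∂P, Filter.liminf (fun k => a k z) Filter.atTop
      = ENNReal.ofReal (max 0 (inner ℝ (v z) u) ^ 2) := by
    filter_upwards [hsub] with z hz
    apply Filter.Tendsto.liminf_eq
    have h1 := tendsto_max_inner_sub_diffQuot hz u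
    have h2 := ((tendsto_const_nhds (x := (0 : ℝ))).max (h1.const_sub (inner ℝ (v z) u))).pow 2
    rw [sub_zero] at h2
    exact (ENNReal.continuous_ofReal.tendsto _).comp h2
  rw [← lintegral_congr_ae hlim]
  refine (lintegral_liminf_le hmeas).trans ?_
  refine Filter.liminf_le_of_le (by isBoundedDefault) fun b hb => ?_
  obtain ⟨k, hk⟩ := hb.exists
  refine hk.trans (le_trans (lintegral_mono fun z => ?_) (lintegral_diffQuot_sq_le hL x u k))
  apply ENNReal.ofReal_le_ofReal
  rw [← sq_abs (diffQuot H x u k z)]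
  refine pow_le_pow_left₀ (le_max_left _ _) (max_le (abs_nonneg _) ?_) 2
  refine le_trans ?_ (le_abs_self _)
  linarith [le_max_right 0 (inner ℝ (v z) u - diffQuot H x u k z)]

/-- The one-sided bounds in the directions `u` and `-u` control the squares of the positive and
negative parts, whence the factor 2. -/
theorem lintegral_inner_sq_le (hH : ∀ y, Measurable (H y)) (hv : Measurable v)
    (hsub : ∀ᵐ z ∂P, v z ∈ subdifferential (fun y => H y z) x)
    (hL : ∀ x y, ∫⁻ z, ENNReal.ofReal ((H x z - H y z) ^ 2) ∂P
      ≤ ENNReal.ofReal (L ^ 2 * ‖x - y‖ ^ 2)) (u : Vec d) :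
    ∫⁻ z, ENNReal.ofReal (inner ℝ (v z) u ^ 2) ∂P ≤ ENNReal.ofReal (2 * L ^ 2 * ‖u‖ ^ 2) := by
  have h1 := lintegral_max_inner_sq_le hH hv hsub hL u
  have h2 := lintegral_max_inner_sq_le hH hv hsub hL (-u)
  rw [norm_neg] at h2
  have h3 : ∀ z, ENNReal.ofReal (inner ℝ (v z) u ^ 2)
      = ENNReal.ofReal (max 0 (inner ℝ (v z) u) ^ 2)
        + ENNReal.ofReal (max 0 (inner ℝ (v z) (-u)) ^ 2) := fun z => by
    rw [← ENNReal.ofReal_add (sq_nonneg _) (sq_nonneg _), inner_neg_right]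
    congr 1
    rcases le_total 0 (inner ℝ (v z) u) with h | h
    · rw [max_eq_right h, max_eq_left (by linarith)]; ring
    · rw [max_eq_left h, max_eq_right (by linarith)]; ring
  simp_rw [h3]
  rw [lintegral_add_left (by fun_prop)]
  refine (add_le_add h1 h2).trans ?_
  rw [← ENNReal.ofReal_add (by positivity) (by positivity)]
  apply ENNReal.ofReal_le_ofReal
  linarith

theorem lintegral_norm_sq_le (hH : ∀ y, Measurable (H y)) (hv : Measurable v)
    (hsub : ∀ᵐ z ∂P, v z ∈ subdifferential (fun y => H y z) x)
    (hL : ∀ x y, ∫⁻ z, ENNReal.ofReal ((H x z - H y z) ^ 2) ∂P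
      ≤ ENNReal.ofReal (L ^ 2 * ‖x - y‖ ^ 2)) :
    ∫⁻ z, ENNReal.ofReal (‖v z‖ ^ 2) ∂P ≤ ENNReal.ofReal (2 * d * L ^ 2) := by
  have h1 : ∀ i : Fin d, ∫⁻ z, ENNReal.ofReal (v z i ^ 2) ∂P ≤ ENNReal.ofReal (2 * L ^ 2) := by
    intro i
    have := lintegral_inner_sq_le hH hv hsub hL (EuclideanSpace.single i 1)
    simpa [EuclideanSpace.inner_single_right] using this
  simp_rw [EuclideanSpace.real_norm_sq_eq, ENNReal.ofReal_sum_of_nonneg fun _ _ => sq_nonneg _]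
  rw [lintegral_finsetSum _ fun i _ => by fun_prop]
  refine (Finset.sum_le_sum fun i _ => h1 i).trans ?_
  rw [Finset.sum_const, Finset.card_univ, Fintype.card_fin, nsmul_eq_mul,
    ← ENNReal.ofReal_natCast, ← ENNReal.ofReal_mul (by positivity)]
  apply ENNReal.ofReal_le_ofReal
  linarith

theorem memLp_two_of_lintegral_norm_sq_le {V : Type*} [NormedAddCommGroup V]
    {f : Z → V} (hf : AEStronglyMeasurable f P) {K : ℝ}
    (h : ∫⁻ z, ENNReal.ofReal (‖f z‖ ^ 2) ∂P ≤ ENNReal.ofReal K) : MemLp f 2 P := by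
  rw [memLp_two_iff_integrable_sq_norm hf]
  refine ⟨hf.norm.pow 2, ?_⟩
  rw [hasFiniteIntegral_iff_ofReal (Filter.Eventually.of_forall fun _ => sq_nonneg _)]
  exact h.trans_lt ENNReal.ofReal_lt_top

theorem integral_le_of_lintegral_ofReal_le {f : Z → ℝ} (h0 : ∀ z, 0 ≤ f z)
    (hf : AEStronglyMeasurable f P) {K : ℝ} (hK : 0 ≤ K)
    (h : ∫⁻ z, ENNReal.ofReal (f z) ∂P ≤ ENNReal.ofReal K) : ∫ z, f z ∂P ≤ K := by
  rw [integral_eq_lintegral_of_nonneg_ae (Filter.Eventually.of_forall h0) hf]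
  exact ENNReal.toReal_le_of_le_ofReal hK h

/-- The mean of the difference quotients `X k` converges to the directional derivative of the mean,
so the mean deficit `Y k = max 0 (a - X k)` has to vanish in the limit. Truncated at level `K` it
does, by dominated convergence. The part above `K` is at most `(2 a² + 2 X²) / K`, whose mean is at
most `6 L² ‖u‖² / K` uniformly in `k`. Finally `K` tends to infinity. -/
theorem integral_inner_le_inner_gradient [IsProbabilityMeasure P] (hH : ∀ y, Measurable (H y))
    (hint : ∀ y, Integrable (H y) P) (hv : Measurable v)
    (hsub : ∀ᵐ z ∂P, v z ∈ subdifferential (fun y => H y z) x)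
    (hL : ∀ x y, ∫⁻ z, ENNReal.ofReal ((H x z - H y z) ^ 2) ∂P
      ≤ ENNReal.ofReal (L ^ 2 * ‖x - y‖ ^ 2))
    (hd : DifferentiableAt ℝ (fun y => ∫ z, H y z ∂P) x) (u : Vec d) :
    ∫ z, inner ℝ (v z) u ∂P ≤ inner ℝ (gradient (fun y => ∫ z, H y z ∂P) x) u := by
  set a : Z → ℝ := fun z => inner ℝ (v z) u with ha
  set X := diffQuot H x u with hX
  have mX : ∀ k, Measurable (X k) := fun k => measurable_diffQuot hH x u k
  have ma : Measurable a := by fun_prop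
  set Y : ℕ → Z → ℝ := fun k z => max 0 (a z - X k z) with hY
  have mY : ∀ k, Measurable (Y k) := fun k => by have := mX k; fun_prop
  have Y0 : ∀ k z, 0 ≤ Y k z := fun k z => le_max_left _ _
  have La : MemLp a 2 P := memLp_two_of_lintegral_norm_sq_le ma.aestronglyMeasurable (by
    simpa using lintegral_inner_sq_le hH hv hsub hL u)
  have LX : ∀ k, MemLp (X k) 2 P := fun k =>
    memLp_two_of_lintegral_norm_sq_le (mX k).aestronglyMeasurable (by
      simpa using lintegral_diffQuot_sq_le hL x u k)
  have Ea : ∫ z, a z ^ 2 ∂P ≤ 2 * L ^ 2 * ‖u‖ ^ 2 :=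
    integral_le_of_lintegral_ofReal_le (fun _ => sq_nonneg _) (by fun_prop) (by positivity)
      (lintegral_inner_sq_le hH hv hsub hL u)
  have EX : ∀ k, ∫ z, X k z ^ 2 ∂P ≤ L ^ 2 * ‖u‖ ^ 2 := fun k =>
    integral_le_of_lintegral_ofReal_le (fun _ => sq_nonneg _)
      ((mX k).pow_const 2).aestronglyMeasurable (by positivity)
      (lintegral_diffQuot_sq_le hL x u k)
  set G : Vec d → ℝ := fun y => ∫ z, H y z ∂P with hG
  have hmean : ∀ k, ∫ z, X k z ∂P
      = ((k : ℝ) + 1) * (G (x + (1 / ((k : ℝ) + 1)) • u) - G x) := fun k => by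
    rw [hX]
    unfold diffQuot
    rw [integral_const_mul, integral_sub (hint _) (hint _)]
  have hlimX : Filter.Tendsto (fun k => ∫ z, X k z ∂P) Filter.atTop
      (nhds (inner ℝ (gradient G x) u)) := by
    have h1 := hd.hasGradientAt.hasFDerivAt
    have h2 : Filter.Tendsto (fun k : ℕ => ‖(k : ℝ) + 1‖) Filter.atTop Filter.atTop := by
      have : Filter.Tendsto (fun k : ℕ => (k : ℝ) + 1) Filter.atTop Filter.atTop :=
        Filter.tendsto_atTop_add_const_right _ _ tendsto_natCast_atTop_atTop
      exact tendsto_norm_atTop_atTop.comp this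
    have h3 := h1.lim u h2
    simp only [smul_eq_mul, InnerProductSpace.toDual_apply_apply] at h3
    refine h3.congr fun k => ?_
    rw [hmean, one_div]
  have hKey : ∀ K : ℝ, 0 < K →
      ∫ z, a z ∂P - inner ℝ (gradient G x) u ≤ 6 * L ^ 2 * ‖u‖ ^ 2 / K := by
    intro K hK
    have hdom : Filter.Tendsto (fun k => ∫ z, min (Y k z) K ∂P) Filter.atTop
        (nhds (∫ _, (0 : ℝ) ∂P)) := by
      refine tendsto_integral_of_dominated_convergence (fun _ => K)
        (fun k => by have := mY k; fun_prop) (integrable_const K)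
        (fun k => Filter.Eventually.of_forall fun z => ?_) ?_
      · rw [Real.norm_of_nonneg (le_min (Y0 k z) hK.le)]
        exact min_le_right _ _
      · filter_upwards [hsub] with z hz
        have := (tendsto_max_inner_sub_diffQuot hz u).min (tendsto_const_nhds (x := K))
        rwa [min_eq_left hK.le] at this
    rw [integral_zero] at hdom
    have hbound : ∀ k, ∫ z, a z ∂P - ∫ z, X k z ∂P
        ≤ ∫ z, min (Y k z) K ∂P + 6 * L ^ 2 * ‖u‖ ^ 2 / K := by
      intro k
      have i1 : Integrable (fun z => min (Y k z) K) P := by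
        refine Integrable.mono' (integrable_const K) (by have := mY k; fun_prop)
          (Filter.Eventually.of_forall fun z => ?_)
        rw [Real.norm_of_nonneg (le_min (Y0 k z) hK.le)]
        exact min_le_right _ _
      have i2 : Integrable (fun z => (2 * a z ^ 2 + 2 * X k z ^ 2) / K) P :=
        ((La.integrable_sq.const_mul 2).add ((LX k).integrable_sq.const_mul 2)).div_const K
      have ia := La.integrable (by norm_num)
      have iX := (LX k).integrable (by norm_num)
      rw [← integral_sub ia iX]
      have h1 : ∫ z, (a z - X k z) ∂P
          ≤ ∫ z, (min (Y k z) K + (2 * a z ^ 2 + 2 * X k z ^ 2) / K) ∂P := by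
        refine integral_mono (ia.sub iX) (i1.add i2) fun z => ?_
        have q0 : a z - X k z ≤ Y k z := le_max_right _ _
        have q1 : 0 ≤ (2 * a z ^ 2 + 2 * X k z ^ 2) / K := by positivity
        rcases le_total (Y k z) K with h | h
        · simp only [min_eq_left h]; linarith
        · simp only [min_eq_right h]
          have q2 : 0 < Y k z := hK.trans_le h
          have q3 : Y k z = a z - X k z := by
            rcases le_total (a z - X k z) 0 with h' | h'
            · exact absurd (max_eq_left h') q2.ne'
            · exact max_eq_right h'
          have q4 : a z - X k z ≤ (2 * a z ^ 2 + 2 * X k z ^ 2) / K := by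
            rw [le_div_iff₀ hK]
            nlinarith [sq_nonneg (a z + X k z)]
          linarith
      rw [integral_add i1 i2, integral_div, integral_add (La.integrable_sq.const_mul 2)
        ((LX k).integrable_sq.const_mul 2), integral_const_mul, integral_const_mul] at h1
      have h2 : (2 * ∫ z, a z ^ 2 ∂P + 2 * ∫ z, X k z ^ 2 ∂P) / K
          ≤ 6 * L ^ 2 * ‖u‖ ^ 2 / K := by
        apply div_le_div_of_nonneg_right _ hK.le
        linarith [EX k]
      linarith
    have := le_of_tendsto_of_tendsto' (hlimX.const_sub (∫ z, a z ∂P))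
      (hdom.add_const (6 * L ^ 2 * ‖u‖ ^ 2 / K)) hbound
    linarith
  have hlim : Filter.Tendsto (fun K : ℝ => 6 * L ^ 2 * ‖u‖ ^ 2 / K) Filter.atTop (nhds 0) :=
    Filter.Tendsto.const_div_atTop Filter.tendsto_id _
  have := ge_of_tendsto hlim (by
    filter_upwards [Filter.eventually_gt_atTop 0] with K hK using hKey K hK)
  linarith

/-- Stochastic subgradients of a function with differentiable mean are unbiased. -/
theorem integral_eq_gradient [IsProbabilityMeasure P] (hH : ∀ y, Measurable (H y))
    (hint : ∀ y, Integrable (H y) P) (hv : Measurable v)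
    (hsub : ∀ᵐ z ∂P, v z ∈ subdifferential (fun y => H y z) x)
    (hL : ∀ x y, ∫⁻ z, ENNReal.ofReal ((H x z - H y z) ^ 2) ∂P
      ≤ ENNReal.ofReal (L ^ 2 * ‖x - y‖ ^ 2))
    (hd : DifferentiableAt ℝ (fun y => ∫ z, H y z ∂P) x) :
    ∫ z, v z ∂P = gradient (fun y => ∫ z, H y z ∂P) x := by
  have hvi : Integrable v P := (memLp_two_of_lintegral_norm_sq_le hv.aestronglyMeasurable
    (lintegral_norm_sq_le hH hv hsub hL)).integrable (by norm_num)
  refine ext_inner_left ℝ fun u => ?_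
  have h1 := integral_inner_le_inner_gradient hH hint hv hsub hL hd u
  -- The one-sided inequality in direction `-u` is the reverse inequality in direction `u`, because
  -- the gradient is linear in the direction.
  have h2 := integral_inner_le_inner_gradient hH hint hv hsub hL hd (-u)
  simp only [inner_neg_right, integral_neg, neg_le_neg_iff] at h2
  rw [← integral_inner hvi, real_inner_comm]
  simp_rw [real_inner_comm _ u]
  exact le_antisymm h1 h2

end StochasticSubgradient

/-! ### Uniformly random subsets and mini-batches -/

theorem setOf_card_eq_coe (N b : ℕ) : {I : Finset (Fin N) | I.card = b}
    = ((Finset.powersetCard b Finset.univ : Finset (Finset (Fin N))) : Set (Finset (Fin N))) := by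
  ext I; simp

theorem isProbabilityMeasure_uniformOn_card {N b : ℕ} (hb : b ≤ N) :
    IsProbabilityMeasure (uniformOn {I : Finset (Fin N) | I.card = b}) := by
  refine isProbabilityMeasure_uniformOn (Set.toFinite _) ?_
  rw [setOf_card_eq_coe]
  exact Finset.powersetCard_nonempty.2 (by simpa using hb)

theorem ae_uniformOn_card (N b : ℕ) :
    ∀ᵐ I ∂uniformOn {I : Finset (Fin N) | I.card = b}, I.card = b :=
  ae_cond_mem (Set.toFinite _).measurableSet

/-- Subsets containing `i` correspond to the remaining `b - 1` of `N - 1` elements, and the ratio of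
the binomial coefficients is `b / N`. -/
theorem uniformOn_card_real_mem {N b : ℕ} (hb1 : 1 ≤ b) (hb : b ≤ N) (i : Fin N) :
    (uniformOn {I : Finset (Fin N) | I.card = b}).real {I | i ∈ I} = b / N := by
  have h1 : {I : Finset (Fin N) | i ∈ I}
      = ((Finset.univ.filter fun I : Finset (Fin N) => i ∈ I : Finset (Finset (Fin N))) :
        Set (Finset (Fin N))) := by ext I; simp
  have h2 : (Finset.powersetCard b Finset.univ ∩
      (Finset.univ.filter fun I : Finset (Fin N) => i ∈ I)).card = (N - 1).choose (b - 1) := by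
    have := Finset.card_filter_powersetCard_subset (α := Fin N) {i} Finset.univ b
      (Finset.subset_univ _)
    simp only [Finset.card_univ, Fintype.card_fin, Finset.card_singleton,
      Finset.singleton_subset_iff] at this
    rw [← this hb1]
    congr 1
    ext I
    simp
  rw [measureReal_def, setOf_card_eq_coe, h1, uniformOn_apply_finset, h2,
    Finset.card_powersetCard, Finset.card_univ, Fintype.card_fin, ENNReal.toReal_div,
    ENNReal.toReal_natCast, ENNReal.toReal_natCast]
  obtain ⟨N, rfl⟩ := Nat.exists_eq_add_of_le' (hb1.trans hb)
  obtain ⟨b, rfl⟩ := Nat.exists_eq_add_of_le' hb1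
  have h3 := Nat.add_one_mul_choose_eq N b
  have h4 : 0 < (N + 1).choose (b + 1) := Nat.choose_pos hb
  rw [div_eq_div_iff (by exact_mod_cast h4.ne') (by positivity)]
  simp only [Nat.add_sub_cancel]
  rw [mul_comm]
  exact_mod_cast h3.trans (mul_comm _ _)

/-! ### Means and second moments of i.i.d. mini-batches -/

section BatchMean

variable {Z : Type*} [MeasurableSpace Z] {P : Measure Z} [IsProbabilityMeasure P] {B : ℕ}

theorem measurePreserving_eval_sample (j : Fin B) :
    MeasurePreserving (fun z : Fin B → Z => z j) (Measure.pi fun _ => P) P :=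
  measurePreserving_eval (fun _ : Fin B => P) j

theorem integral_eval_sample {V : Type*} [NormedAddCommGroup V] [NormedSpace ℝ V]
    {f : Z → V} (hf : AEStronglyMeasurable f P) (j : Fin B) :
    ∫ z : Fin B → Z, f (z j) ∂Measure.pi (fun _ => P) = ∫ z, f z ∂P := by
  have h := measurePreserving_eval_sample (P := P) j
  have h1 := integral_map h.measurable.aemeasurable (f := f) (by rwa [h.map_eq])
  rw [h.map_eq] at h1
  exact h1.symm

theorem memLp_batchMean {V : Type*} [NormedAddCommGroup V] [NormedSpace ℝ V] {f : Z → V}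
    {r : ENNReal} (hf : MemLp f r P) :
    MemLp (fun z : Fin B → Z => batchMean fun j => f (z j)) r (Measure.pi fun _ => P) := by
  have h : MemLp (fun z : Fin B → Z => ∑ j, f (z j)) r (Measure.pi fun _ => P) :=
    memLp_finsetSum _ fun j _ => hf.comp_measurePreserving (measurePreserving_eval_sample j)
  exact h.const_smul (1 / (B : ℝ))

theorem integral_batchMean {V : Type*} [NormedAddCommGroup V] [NormedSpace ℝ V] {f : Z → V}
    (hB : 1 ≤ B) (hf : Integrable f P) :
    ∫ z : Fin B → Z, batchMean (fun j => f (z j)) ∂Measure.pi (fun _ => P) = ∫ z, f z ∂P := by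
  unfold batchMean
  rw [integral_smul, integral_finsetSum]
  · simp_rw [integral_eval_sample hf.aestronglyMeasurable]
    rw [Finset.sum_const, Finset.card_univ, Fintype.card_fin, ← Nat.cast_smul_eq_nsmul ℝ,
      smul_smul, one_div, inv_mul_cancel₀ (by positivity), one_smul]
  · exact fun j _ => (measurePreserving_eval_sample j).integrable_comp_of_integrable hf

theorem norm_sum_sq_le {ι V : Type*} [NormedAddCommGroup V] (s : Finset ι) (a : ι → V) :
    ‖∑ i ∈ s, a i‖ ^ 2 ≤ s.card * ∑ i ∈ s, ‖a i‖ ^ 2 :=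
  (pow_le_pow_left₀ (norm_nonneg _) (norm_sum_le s a) 2).trans sq_sum_le_card_mul_sum_sq

theorem integral_norm_batchMean_sq_le {V : Type*} [NormedAddCommGroup V] [NormedSpace ℝ V]
    {f : Z → V} (hB : 1 ≤ B) (hf : MemLp f 2 P) :
    ∫ z : Fin B → Z, ‖batchMean (fun j => f (z j))‖ ^ 2 ∂Measure.pi (fun _ => P)
      ≤ ∫ z, ‖f z‖ ^ 2 ∂P := by
  have hint : Integrable (fun z => ‖f z‖ ^ 2) P := hf.norm.integrable_sq
  have hI := integral_batchMean hB hint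
  rw [← hI]
  refine integral_mono (memLp_batchMean hf).norm.integrable_sq
    (memLp_one_iff_integrable.1 (memLp_batchMean (memLp_one_iff_integrable.2 hint)))
    fun z => ?_
  unfold batchMean
  have hB' : (0 : ℝ) < B := by exact_mod_cast hB
  have := norm_sum_sq_le Finset.univ fun j => f (z j)
  simp only [norm_smul, mul_pow, smul_eq_mul, Finset.card_univ, Fintype.card_fin] at this ⊢
  rw [Real.norm_of_nonneg (by positivity)]
  calc (1 / (B : ℝ)) ^ 2 * ‖∑ j, f (z j)‖ ^ 2
      ≤ (1 / (B : ℝ)) ^ 2 * (B * ∑ j, ‖f (z j)‖ ^ 2) := by gcongr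
    _ = _ := by field_simp

/-- Second moment equals squared mean plus variance, and independence within the batch divides the
variance by `B`. -/
theorem integral_add_batchMean_sq {f : Z → ℝ} (hB : 1 ≤ B) (hf : MemLp f 2 P) (a : ℝ) :
    ∫ z : Fin B → Z, (a + batchMean (fun j => f (z j))) ^ 2 ∂Measure.pi (fun _ => P)
      = (a + ∫ z, f z ∂P) ^ 2 + Var[f; P] / B := by
  have hB' : (B : ℝ) ≠ 0 := by positivity
  have hm := memLp_batchMean (B := B) hf
  have hm' : MemLp (fun z : Fin B → Z => a + batchMean fun j => f (z j)) 2
      (Measure.pi fun _ => P) := (memLp_const a).add hm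
  have h1 := variance_eq_sub hm'
  have h2 : Var[fun z : Fin B → Z => batchMean (fun j => f (z j)); Measure.pi fun _ => P]
      = Var[f; P] / B := by
    have h3 := variance_sum_pi (μ := fun _ : Fin B => P) (X := fun _ => f) fun _ => hf
    unfold batchMean
    simp only [smul_eq_mul]
    rw [variance_const_mul]
    rw [show (fun z : Fin B → Z => ∑ j, f (z j)) = ∑ j, fun z : Fin B → Z => f (z j) by
      ext z; simp, h3, Finset.sum_const, Finset.card_univ, Fintype.card_fin, nsmul_eq_mul]
    field_simp
  have h4 := variance_const_add hm.aestronglyMeasurable a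
  have h5 : ∫ z : Fin B → Z, (a + batchMean (fun j => f (z j))) ∂Measure.pi (fun _ => P)
      = a + ∫ z, f z ∂P := by
    rw [integral_add (integrable_const _) (hm.integrable (by norm_num)), integral_const,
      integral_batchMean hB (hf.integrable (by norm_num))]
    simp
  rw [h4, h2, h5] at h1
  simp only [Pi.pow_apply] at h1
  linarith

end BatchMean

theorem integrable_ite_mem {N : ℕ} {Y V : Type*} [MeasurableSpace Y] [NormedAddCommGroup V]
    {U : Measure (Finset (Fin N))} {Q : Measure Y} [IsFiniteMeasure U] [IsFiniteMeasure Q]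
    {A : Y → V} (hA : Integrable A Q) (a : V) (i : Fin N) :
    Integrable (fun y : Finset (Fin N) × Y => if i ∈ y.1 then A y.2 else a) (U.prod Q) := by
  classical
  have hs : MeasurableSet {y : Finset (Fin N) × Y | i ∈ y.1} :=
    (measurableSet_mem_finset i).preimage measurable_fst
  have h := Integrable.piecewise hs (hA.comp_snd U).integrableOn
    (integrable_const (μ := U.prod Q) a).integrableOn
  refine h.congr (Filter.Eventually.of_forall fun y => ?_)
  simp [Set.piecewise]

/-- Under `ν`, the random set `I` is uniform among the subsets of size `b`, and every `z · i`
is an i.i.d. mini-batch with law `P`, independent of `I`. -/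
structure IsSampler {W Z : Type*} [MeasurableSpace W] [MeasurableSpace Z] {N B : ℕ}
    (ν : Measure W) (b : ℕ) (P : Measure Z) (I : W → Finset (Fin N))
    (z : W → Fin N → Fin B → Z) : Prop where
  law : ∀ i, MeasurePreserving (fun w => (I w, z w i)) ν
    ((uniformOn {I : Finset (Fin N) | I.card = b}).prod (Measure.pi fun _ : Fin B => P))
  law_set : MeasurePreserving I ν (uniformOn {I : Finset (Fin N) | I.card = b})

section Sampler

variable {W Z : Type*} [MeasurableSpace W] [MeasurableSpace Z] {N B b : ℕ} {ν : Measure W}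
  {P : Measure Z} [IsProbabilityMeasure P] {I : W → Finset (Fin N)} {z : W → Fin N → Fin B → Z}

omit [IsProbabilityMeasure P] in
theorem IsSampler.ae_card (h : IsSampler ν b P I z) : ∀ᵐ w ∂ν, (I w).card = b :=
  h.law_set.quasiMeasurePreserving.ae (ae_uniformOn_card N b)

theorem IsSampler.integrable_ite (h : IsSampler ν b P I z) (hb : b ≤ N) {V : Type*}
    [NormedAddCommGroup V] [NormedSpace ℝ V] {A : (Fin B → Z) → V}
    (hA : Integrable A (Measure.pi fun _ => P)) (a : V) (i : Fin N) :
    Integrable (fun w => if i ∈ I w then A (z w i) else a) ν := by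
  have := isProbabilityMeasure_uniformOn_card hb
  exact (h.law i).integrable_comp_of_integrable (integrable_ite_mem hA a i)

theorem IsSampler.integral_ite (h : IsSampler ν b P I z) (hb1 : 1 ≤ b) (hb : b ≤ N) {V : Type*}
    [NormedAddCommGroup V] [NormedSpace ℝ V] [CompleteSpace V] {A : (Fin B → Z) → V}
    (hA : Integrable A (Measure.pi fun _ => P)) (a : V) (i : Fin N) :
    ∫ w, (if i ∈ I w then A (z w i) else a) ∂ν
      = ((b : ℝ) / N) • ∫ y, A y ∂Measure.pi (fun _ => P) + (1 - (b : ℝ) / N) • a := by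
  have := isProbabilityMeasure_uniformOn_card hb
  set U := uniformOn {I : Finset (Fin N) | I.card = b} with hU
  have h1 : Integrable (fun y : Finset (Fin N) × (Fin B → Z) => if i ∈ y.1 then A y.2 else a)
      (U.prod (Measure.pi fun _ : Fin B => P)) := integrable_ite_mem hA a i
  have h2 := integral_map (h.law i).measurable.aemeasurable
    (f := fun y : Finset (Fin N) × (Fin B → Z) => if i ∈ y.1 then A y.2 else a)
    (by rw [(h.law i).map_eq]; exact h1.aestronglyMeasurable)
  rw [(h.law i).map_eq] at h2
  rw [← h2, integral_prod _ h1]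
  have h3 : ∀ J : Finset (Fin N), ∫ y, (if i ∈ J then A y else a) ∂Measure.pi (fun _ => P)
      = a + Set.indicator {J : Finset (Fin N) | i ∈ J}
        (fun _ => (∫ y, A y ∂Measure.pi (fun _ => P)) - a) J := fun J => by
    by_cases hJ : i ∈ J
    · simp [hJ]
    · simp [hJ]
  simp_rw [h3]
  rw [integral_add (integrable_const _) ((integrable_const _).indicator
    (measurableSet_mem_finset i)), integral_indicator_const _ (measurableSet_mem_finset i),
    uniformOn_card_real_mem hb1 hb, integral_const]
  simp only [probReal_univ]
  module

/-- The mini-batch estimator `(1 / b) ∑ i ∈ I, a i • batchMean (v i)`. -/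
noncomputable def sampledMean {V : Type*} [AddCommGroup V] [Module ℝ V] (b : ℕ) (a : Fin N → ℝ)
    (v : Fin N → Z → V) (I : Finset (Fin N)) (z : Fin N → Fin B → Z) : V :=
  (1 / (b : ℝ)) • ∑ i ∈ I, a i • batchMean fun j => v i (z i j)

variable {V : Type*} [NormedAddCommGroup V] [NormedSpace ℝ V]
  {a : Fin N → ℝ} {v : Fin N → Z → V}

omit [MeasurableSpace Z] in
theorem sampledMean_eq_sum_univ (I : Finset (Fin N)) (z : Fin N → Fin B → Z) :
    sampledMean b a v I z = (1 / (b : ℝ)) •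
      ∑ i, if i ∈ I then a i • batchMean (fun j => v i (z i j)) else 0 := by
  unfold sampledMean
  congr 1
  rw [Finset.sum_ite_mem, Finset.univ_inter]

theorem IsSampler.integral_sampledMean [CompleteSpace V] (h : IsSampler ν b P I z)
    (hb1 : 1 ≤ b) (hb : b ≤ N) (hB : 1 ≤ B) (hv : ∀ i, Integrable (v i) P) :
    ∫ w, sampledMean b a v (I w) (z w) ∂ν = (1 / (N : ℝ)) • ∑ i, a i • ∫ y, v i y ∂P := by
  have hi : ∀ i, Integrable (fun y : Fin B → Z => a i • batchMean fun j => v i (y j))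
      (Measure.pi fun _ => P) := fun i =>
    (memLp_one_iff_integrable.1 (memLp_batchMean (memLp_one_iff_integrable.2 (hv i)))).smul _
  simp_rw [sampledMean_eq_sum_univ]
  rw [integral_smul, integral_finsetSum _ fun i _ => h.integrable_ite hb (hi i) 0 i]
  simp_rw [h.integral_ite hb1 hb (hi _) 0, integral_smul, integral_batchMean hB (hv _), smul_zero,
    add_zero, ← Finset.smul_sum, smul_smul]
  congr 1
  have : (b : ℝ) ≠ 0 := by positivity
  field_simp

theorem IsSampler.memLp_sampledMean (h : IsSampler ν b P I z) (hb : b ≤ N)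
    (hv : ∀ i, MemLp (v i) 2 P) : MemLp (fun w => sampledMean b a v (I w) (z w)) 2 ν := by
  have := isProbabilityMeasure_uniformOn_card hb
  have key : ∀ i, MemLp (fun w => if i ∈ I w then a i • batchMean (fun j => v i (z w i j))
      else 0) 2 ν := fun i => by
    have hs : MeasurableSet {y : Finset (Fin N) × (Fin B → Z) | i ∈ y.1} :=
      (measurableSet_mem_finset i).preimage measurable_fst
    have h1 : MemLp ({y : Finset (Fin N) × (Fin B → Z) | i ∈ y.1}.indicator
        fun y => a i • batchMean (fun j => v i (y.2 j))) 2
        ((uniformOn {I : Finset (Fin N) | I.card = b}).prod (Measure.pi fun _ : Fin B => P)) :=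
      MemLp.indicator hs (((memLp_batchMean (hv i)).const_smul (a i)).comp_snd _)
    refine (h1.comp_measurePreserving (h.law i)).ae_eq (Filter.Eventually.of_forall fun w => ?_)
    by_cases hw : i ∈ I w <;> simp [hw]
  have h2 := (memLp_finsetSum Finset.univ fun i _ => key i).const_smul (1 / (b : ℝ))
  refine h2.ae_eq (Filter.Eventually.of_forall fun w => ?_)
  simp only [Pi.smul_apply]
  rw [sampledMean_eq_sum_univ]

/-- By Cauchy–Schwarz the squared norm is at most the average over the sampled indices, whose number
is almost surely `b`. Each index occurs with probability `b / N`, so no independence between indices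
is needed. -/
theorem IsSampler.integral_norm_sampledMean_sq_le (h : IsSampler ν b P I z) (hb1 : 1 ≤ b)
    (hb : b ≤ N) (hB : 1 ≤ B) (hv : ∀ i, MemLp (v i) 2 P) {A K : ℝ} (ha : ∀ i, |a i| ≤ A)
    (hK : ∀ i, ∫ y, ‖v i y‖ ^ 2 ∂P ≤ K) :
    ∫ w, ‖sampledMean b a v (I w) (z w)‖ ^ 2 ∂ν ≤ A ^ 2 * K := by
  have hb0 : (0 : ℝ) < b := by exact_mod_cast hb1
  have hN0 : (0 : ℝ) < N := by exact_mod_cast hb1.trans hb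
  have hi : ∀ i, Integrable (fun y : Fin B → Z => ‖a i • batchMean fun j => v i (y j)‖ ^ 2)
      (Measure.pi fun _ => P) := fun i =>
    ((memLp_batchMean (hv i)).const_smul (a i)).norm.integrable_sq
  have hle : ∫ w, ‖sampledMean b a v (I w) (z w)‖ ^ 2 ∂ν ≤ ∫ w, (1 / (b : ℝ)) *
      ∑ i, (if i ∈ I w then ‖a i • batchMean (fun j => v i (z w i j))‖ ^ 2 else 0) ∂ν := by
    refine integral_mono_ae (h.memLp_sampledMean hb hv).norm.integrable_sq
      ((integrable_finsetSum _ fun i _ => h.integrable_ite hb (hi i) 0 i).const_mul _) ?_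
    filter_upwards [h.ae_card] with w hw
    unfold sampledMean
    have h1 := norm_sum_sq_le (I w) fun i => a i • batchMean fun j => v i (z w i j)
    rw [hw] at h1
    rw [norm_smul, mul_pow, Real.norm_of_nonneg (by positivity), Finset.sum_ite_mem,
      Finset.univ_inter]
    calc (1 / (b : ℝ)) ^ 2 * ‖∑ i ∈ I w, a i • batchMean fun j => v i (z w i j)‖ ^ 2
        ≤ (1 / (b : ℝ)) ^ 2 * (b * ∑ i ∈ I w, ‖a i • batchMean fun j => v i (z w i j)‖ ^ 2) := by
          gcongr
      _ = _ := by field_simp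
  refine hle.trans ?_
  rw [integral_const_mul, integral_finsetSum _ fun i _ => h.integrable_ite hb (hi i) 0 i]
  simp_rw [h.integral_ite hb1 hb (hi _) (0 : ℝ), smul_zero, add_zero, smul_eq_mul]
  have hterm : ∀ i, ∫ y : Fin B → Z, ‖a i • batchMean fun j => v i (y j)‖ ^ 2
      ∂Measure.pi (fun _ => P) ≤ A ^ 2 * K := fun i => by
    simp_rw [norm_smul, mul_pow]
    rw [integral_const_mul]
    have h1 := (integral_norm_batchMean_sq_le hB (hv i)).trans (hK i)
    have h2 : ‖a i‖ ^ 2 ≤ A ^ 2 := pow_le_pow_left₀ (norm_nonneg _) (ha i) 2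
    exact mul_le_mul h2 h1 (integral_nonneg fun _ => sq_nonneg _) (sq_nonneg _)
  calc (1 / (b : ℝ)) * ∑ i, (b : ℝ) / N * ∫ y : Fin B → Z,
        ‖a i • batchMean fun j => v i (y j)‖ ^ 2 ∂Measure.pi (fun _ => P)
      ≤ (1 / (b : ℝ)) * ∑ _i : Fin N, (b : ℝ) / N * (A ^ 2 * K) := by
        gcongr with i
        exact hterm i
    _ = A ^ 2 * K := by
        rw [Finset.sum_const, Finset.card_univ, Fintype.card_fin, nsmul_eq_mul]
        field_simp

end Sampler

/-! ### The variance reduced estimators -/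

/-- `H` is a stochastic oracle of bounded variance which is mean-square Lipschitz. -/
structure IsOracle {d : ℕ} {Z : Type*} [MeasurableSpace Z] (P : Measure Z)
    (H : Vec d → Z → ℝ) (L σ : ℝ) : Prop where
  meas : ∀ x, Measurable (H x)
  int : ∀ x, Integrable (H x) P
  lip : ∀ x y, ∫⁻ z, ENNReal.ofReal ((H x z - H y z) ^ 2) ∂P
    ≤ ENNReal.ofReal (L ^ 2 * ‖x - y‖ ^ 2)
  var : ∀ x, ∫⁻ z, ENNReal.ofReal ((H x z - ∫ y, H x y ∂P) ^ 2) ∂P ≤ ENNReal.ofReal (σ ^ 2)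

namespace IsOracle

variable {d : ℕ} {Z : Type*} [MeasurableSpace Z] {P : Measure Z} [IsProbabilityMeasure P]
  {H : Vec d → Z → ℝ} {L σ : ℝ}

theorem memLp (h : IsOracle P H L σ) (x : Vec d) : MemLp (H x) 2 P := by
  have h1 : MemLp (fun z => H x z - ∫ y, H x y ∂P) 2 P :=
    memLp_two_of_lintegral_norm_sq_le ((h.meas x).sub_const _).aestronglyMeasurable
      (by simpa using h.var x)
  have h2 := h1.add (memLp_const (∫ y, H x y ∂P))
  refine h2.ae_eq (Filter.Eventually.of_forall fun z => ?_)
  simp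

omit [IsProbabilityMeasure P] in
theorem integral_sub_sq_le (h : IsOracle P H L σ) (x y : Vec d) :
    ∫ z, (H x z - H y z) ^ 2 ∂P ≤ L ^ 2 * ‖x - y‖ ^ 2 :=
  integral_le_of_lintegral_ofReal_le (fun _ => sq_nonneg _)
    (((h.meas x).sub (h.meas y)).pow_const 2).aestronglyMeasurable (by positivity) (h.lip x y)

omit [IsProbabilityMeasure P] in
theorem variance_le (h : IsOracle P H L σ) (x : Vec d) : Var[H x; P] ≤ σ ^ 2 := by
  rw [variance_eq_integral (h.meas x).aemeasurable]
  exact integral_le_of_lintegral_ofReal_le (fun _ => sq_nonneg _)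
    (((h.meas x).sub_const _).pow_const 2).aestronglyMeasurable (by positivity) (h.var x)

theorem variance_sub_le (h : IsOracle P H L σ) (x y : Vec d) :
    Var[fun z => H x z - H y z; P] ≤ L ^ 2 * ‖x - y‖ ^ 2 :=
  (variance_le_expectation_sq ((h.meas x).sub (h.meas y)).aestronglyMeasurable).trans
    (h.integral_sub_sq_le x y)

theorem mean_sub_sq_le (h : IsOracle P H L σ) (x y : Vec d) :
    (∫ z, H x z ∂P - ∫ z, H y z ∂P) ^ 2 ≤ L ^ 2 * ‖x - y‖ ^ 2 := by
  have h1 := variance_eq_sub ((h.memLp x).sub (h.memLp y))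
  have h2 := variance_nonneg (H x - H y) P
  have h3 : ∫ z, ((H x - H y) ^ 2) z ∂P ≤ L ^ 2 * ‖x - y‖ ^ 2 := h.integral_sub_sq_le x y
  have h4 : ∫ z, (H x - H y) z ∂P = ∫ z, H x z ∂P - ∫ z, H y z ∂P :=
    integral_sub (h.int x) (h.int y)
  rw [h4] at h1
  linarith

theorem abs_mean_sub_le (h : IsOracle P H L σ) (hL : 0 ≤ L) (x y : Vec d) :
    |∫ z, H x z ∂P - ∫ z, H y z ∂P| ≤ L * ‖x - y‖ := by
  refine abs_le_of_sq_le_sq ?_ (by positivity)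
  rw [mul_pow]
  exact h.mean_sub_sq_le x y

theorem variance_combination_le (h : IsOracle P H L σ) (x y : Vec d) (γ c : ℝ) :
    Var[fun z => γ * H x z + c * (H x z - H y z); P]
      ≤ 2 * γ ^ 2 * σ ^ 2 + 2 * c ^ 2 * (L ^ 2 * ‖x - y‖ ^ 2) := by
  have m1 := h.memLp x
  have m2 : MemLp (fun z => H x z - H y z) 2 P := (h.memLp x).sub (h.memLp y)
  have mx := h.meas x
  have my := h.meas y
  have i1 := h.int x
  have i2 : Integrable (fun z => H x z - H y z) P := (h.int x).sub (h.int y)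
  have v1 := h.variance_le x
  have v2 := h.variance_sub_le x y
  rw [variance_eq_integral (by fun_prop)] at v1 v2 ⊢
  have e1 : ∫ z, (γ * H x z + c * (H x z - H y z)) ∂P
      = γ * ∫ z, H x z ∂P + c * ∫ z, (H x z - H y z) ∂P := by
    rw [integral_add (i1.const_mul _) (i2.const_mul _), integral_const_mul, integral_const_mul]
  rw [e1]
  set a := ∫ z, H x z ∂P
  set b := ∫ z, (H x z - H y z) ∂P
  have n1 : Integrable (fun z => (H x z - a) ^ 2) P :=
    (m1.sub (memLp_const a)).integrable_sq
  have n2 : Integrable (fun z => (H x z - H y z - b) ^ 2) P :=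
    (m2.sub (memLp_const b)).integrable_sq
  have n3 : Integrable (fun z => (γ * H x z + c * (H x z - H y z) - (γ * a + c * b)) ^ 2) P :=
    (((m1.const_mul γ).add (m2.const_mul c)).sub (memLp_const (γ * a + c * b))).integrable_sq
  calc ∫ z, (γ * H x z + c * (H x z - H y z) - (γ * a + c * b)) ^ 2 ∂P
      ≤ ∫ z, (2 * γ ^ 2 * (H x z - a) ^ 2 + 2 * c ^ 2 * (H x z - H y z - b) ^ 2) ∂P := by
        refine integral_mono n3 ((n1.const_mul _).add (n2.const_mul _)) fun z => ?_
        simp only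
        nlinarith [sq_nonneg (γ * (H x z - a) - c * (H x z - H y z - b))]
    _ = 2 * γ ^ 2 * ∫ z, (H x z - a) ^ 2 ∂P + 2 * c ^ 2 * ∫ z, (H x z - H y z - b) ^ 2 ∂P := by
        rw [integral_add (n1.const_mul _) (n2.const_mul _), integral_const_mul,
          integral_const_mul]
    _ ≤ _ := by gcongr

end IsOracle

/-- Here `q` is the sampling probability, `r` the old error relative to the shift `a`, and `δ` the
drift of the inner function. The relation `hκ` is exactly the vanishing of the cross term in `r *
δ`. Since the shift shrinks at the mean rate `1 - q γ`, the terms of first order in `γ` cancel in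
the coefficient of `r * a` as well, leaving order `γ²`. The squared factors alone contract twice as
fast as claimed to first order in `γ`; the surplus absorbs that remainder when `γ ≤ 1 / 2`. -/
theorem msvr_sq_add_sq_le {q γ κ r δ a : ℝ} (hq0 : 0 < q) (hq1 : q ≤ 1) (hγ0 : 0 ≤ γ)
    (hγ1 : γ ≤ 1 / 2) (hκ : q * κ * (1 - γ) = 1 - q) :
    q * ((1 - γ) * r + κ * δ - γ * (1 - q) * a) ^ 2 + (1 - q) * (r - δ + q * γ * a) ^ 2
      ≤ (1 - q * γ) * r ^ 2 + 14 / q * δ ^ 2 + 3 * q * γ ^ 2 * a ^ 2 := by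
  have hk0 : 0 ≤ q * κ := by
    by_contra h
    push Not at h
    nlinarith
  have hk2 : q * κ ≤ 2 * (1 - q) := by nlinarith
  have hkk : q * κ ^ 2 ≤ 4 / q := by
    rw [le_div_iff₀ hq0]; nlinarith
  have e : q * ((1 - γ) * r + κ * δ - γ * (1 - q) * a) ^ 2 + (1 - q) * (r - δ + q * γ * a) ^ 2
      = (q * (1 - γ) ^ 2 + (1 - q)) * r ^ 2 + (q * κ ^ 2 + (1 - q)) * δ ^ 2
        + (q * (1 - q)) * γ ^ 2 * a ^ 2 + 2 * (q * κ * (1 - γ) - (1 - q)) * r * δ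
        + 2 * (q * (1 - q) * γ ^ 2) * (r * a)
        - 2 * γ * (1 - q) * (q * κ + q) * (δ * a) := by ring
  rw [e, hκ]
  have f1 : 2 * (q * (1 - q) * γ ^ 2) * (r * a) ≤ q * γ ^ 2 * (r ^ 2 + a ^ 2) := by
    have h1 : 2 * (1 - q) * (r * a) ≤ r ^ 2 + a ^ 2 := by
      nlinarith [sq_nonneg (r - a), sq_nonneg (r + a)]
    have h2 : 0 ≤ q * γ ^ 2 := by positivity
    nlinarith [mul_le_mul_of_nonneg_left h1 h2]
  have f2 : -(2 * γ * (1 - q) * (q * κ + q) * (δ * a)) ≤ 9 / q * δ ^ 2 + q * γ ^ 2 * a ^ 2 := by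
    have c0 : 0 ≤ (1 - q) * (q * κ + q) := mul_nonneg (by linarith) (by linarith)
    have c1 : (1 - q) * (q * κ + q) ≤ 3 := by nlinarith
    have h1 : 9 / q * δ ^ 2 + q * γ ^ 2 * a ^ 2 = (9 * δ ^ 2 + (q * γ * a) ^ 2) / q := by
      field_simp
    have h2 : -(2 * γ * (1 - q) * (q * κ + q) * (δ * a))
        = -(2 * ((1 - q) * (q * κ + q)) * (δ * (q * γ * a))) / q := by
      field_simp
    rw [h1, h2]
    apply div_le_div_of_nonneg_right _ hq0.le
    generalize (1 - q) * (q * κ + q) = C at c0 c1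
    generalize q * γ * a = A
    nlinarith [sq_nonneg (3 * δ - A), sq_nonneg (3 * δ + A)]
  have f3 : (q * (1 - γ) ^ 2 + (1 - q)) * r ^ 2 + q * γ ^ 2 * r ^ 2 ≤ (1 - q * γ) * r ^ 2 := by
    have : q * (1 - γ) ^ 2 + (1 - q) + q * γ ^ 2 ≤ 1 - q * γ := by nlinarith [mul_nonneg hq0.le hγ0]
    nlinarith [sq_nonneg r]
  have f4 : (q * κ ^ 2 + (1 - q)) * δ ^ 2 ≤ 5 / q * δ ^ 2 := by
    have : q * κ ^ 2 + (1 - q) ≤ 5 / q := by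
      have h1 : 1 - q ≤ 1 / q := by rw [le_div_iff₀ hq0]; nlinarith
      have h2 : 5 / q = 4 / q + 1 / q := by ring
      linarith
    gcongr
  have f5 : q * (1 - q) * γ ^ 2 * a ^ 2 ≤ q * γ ^ 2 * a ^ 2 := by
    have : 0 ≤ q * γ ^ 2 * a ^ 2 := by positivity
    nlinarith
  have f6 : 14 / q * δ ^ 2 = 5 / q * δ ^ 2 + 9 / q * δ ^ 2 := by ring
  rw [f6]
  linarith

section Msvr

variable {d : ℕ} {W Z : Type*} [MeasurableSpace W] [MeasurableSpace Z] {N B b : ℕ}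
  {ν : Measure W} {P : Measure Z} [IsProbabilityMeasure P] {I : W → Finset (Fin N)}
  {z : W → Fin N → Fin B → Z} {L σ : ℝ}

/-- The update of a single estimator `u` of the mean of `H`, whose index is sampled if `s`. -/
noncomputable def msvrUpdate (N b : ℕ) (γ : ℝ) (H : Vec d → Z → ℝ) (x y : Vec d) (u : ℝ)
    (s : Prop) [Decidable s] (z : Fin B → Z) : ℝ :=
  if s then
    (1 - γ) * u + γ * (batchMean fun j => H x (z j))
      + correctionFactor N b γ * ((batchMean fun j => H x (z j)) - batchMean fun j => H y (z j))
  else u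

/-- Conditioning on whether `i` is sampled splits the expectation into two squares of means, treated
by `msvr_sq_add_sq_le`, and the batch variance of the sampled case. -/
theorem IsSampler.integral_msvrUpdate_sq_le (h : IsSampler ν b P I z) (hb1 : 1 ≤ b) (hb : b ≤ N)
    (hB : 1 ≤ B) {H : Vec d → Z → ℝ} (hH : IsOracle P H L σ) {γ : ℝ} (hγ0 : 0 ≤ γ)
    (hγ1 : γ ≤ 1 / 2) (x y : Vec d) (u a : ℝ) (i : Fin N) :
    Integrable (fun w => (msvrUpdate N b γ H x y u (i ∈ I w) (z w i)
        - ∫ ζ, H x ζ ∂P - (1 - (b : ℝ) / N * γ) * a) ^ 2) ν ∧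
    ∫ w, (msvrUpdate N b γ H x y u (i ∈ I w) (z w i)
        - ∫ ζ, H x ζ ∂P - (1 - (b : ℝ) / N * γ) * a) ^ 2 ∂ν
      ≤ (1 - (b : ℝ) / N * γ) * (u - ∫ ζ, H y ζ ∂P - a) ^ 2
        + 32 / ((b : ℝ) / N) * (L ^ 2 * ‖x - y‖ ^ 2) + 2 * ((b : ℝ) / N) * γ ^ 2 * σ ^ 2 / B
        + 3 * ((b : ℝ) / N) * γ ^ 2 * a ^ 2 := by
  have hb0 : (0 : ℝ) < b := by exact_mod_cast hb1
  have hN0 : (0 : ℝ) < N := by exact_mod_cast hb1.trans hb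
  have hB0 : (1 : ℝ) ≤ B := by exact_mod_cast hB
  set q : ℝ := (b : ℝ) / N with hq
  have hq0 : 0 < q := by positivity
  have hq1 : q ≤ 1 := by rw [hq, div_le_one hN0]; exact_mod_cast hb
  -- The correction factor is `κ + (1 - γ)`: the part `1 - γ` moves the old error from `y` to `x`,
  -- and `κ` compensates the drift of the unsampled indices.
  set κ : ℝ := (1 - q) / (q * (1 - γ)) with hκdef
  have hγ2 : 0 < 1 - γ := by linarith
  have hκ : q * κ * (1 - γ) = 1 - q := by rw [hκdef]; field_simp
  have hcf : correctionFactor N b γ = κ + (1 - γ) := by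
    unfold correctionFactor
    rw [hκdef, hq]
    field_simp
    ring
  set c := correctionFactor N b γ with hc
  have hκ0 : 0 ≤ κ := div_nonneg (by linarith) (by positivity)
  have hκ2 : κ ≤ 2 * (1 - q) / q := by
    rw [hκdef, div_le_div_iff₀ (by positivity) hq0]
    nlinarith [mul_nonneg (sub_nonneg.2 hq1) hq0.le]
  have hc2 : c ≤ 2 / q := by
    rw [hcf]
    have : 2 * (1 - q) / q = 2 / q - 2 := by field_simp
    linarith
  have hc0 : 0 ≤ c := by rw [hcf]; positivity
  set f : Z → ℝ := fun ζ => γ * H x ζ + c * (H x ζ - H y ζ) with hf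
  have hfm : MemLp f 2 P :=
    ((hH.memLp x).const_mul γ).add (((hH.memLp x).sub (hH.memLp y)).const_mul c)
  set mx := ∫ ζ, H x ζ ∂P with hmx
  set my := ∫ ζ, H y ζ ∂P with hmy
  have hfi : ∫ ζ, f ζ ∂P = γ * mx + c * (mx - my) := by
    have i2 : Integrable (fun ζ => H x ζ - H y ζ) P := (hH.int x).sub (hH.int y)
    simp only [hf]
    rw [integral_add ((hH.int x).const_mul γ) (i2.const_mul c), integral_const_mul,
      integral_const_mul, integral_sub (hH.int x) (hH.int y)]
  set e := (1 - γ) * u - mx - (1 - q * γ) * a with he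
  have hrew : ∀ w, (msvrUpdate N b γ H x y u (i ∈ I w) (z w i) - mx - (1 - q * γ) * a) ^ 2
      = if i ∈ I w then (e + batchMean fun j => f (z w i j)) ^ 2
        else (u - mx - (1 - q * γ) * a) ^ 2 := by
    intro w
    unfold msvrUpdate
    split_ifs
    · congr 1
      rw [he, hf]
      unfold batchMean
      simp only [smul_eq_mul, Finset.sum_add_distrib, ← Finset.mul_sum, Finset.sum_sub_distrib]
      ring
    · rfl
  have hAi : Integrable (fun y : Fin B → Z => (e + batchMean fun j => f (y j)) ^ 2)
      (Measure.pi fun _ => P) := ((memLp_const e).add (memLp_batchMean hfm)).integrable_sq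
  simp_rw [hrew]
  refine ⟨h.integrable_ite hb hAi _ i, ?_⟩
  rw [h.integral_ite hb1 hb hAi, integral_add_batchMean_sq hB hfm, hfi]
  have hvar := hH.variance_combination_le x y γ c
  have hδ := hH.mean_sub_sq_le x y
  rw [← hmx, ← hmy] at hδ
  have key := msvr_sq_add_sq_le (r := u - my - a) (δ := mx - my) (a := a) hq0 hq1 hγ0 hγ1 hκ
  have e1 : e + (γ * mx + c * (mx - my))
      = (1 - γ) * (u - my - a) + κ * (mx - my) - γ * (1 - q) * a := by
    rw [hcf, he]; ring
  have e2 : u - mx - (1 - q * γ) * a = (u - my - a) - (mx - my) + q * γ * a := by ring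
  rw [e1, e2]
  set D := L ^ 2 * ‖x - y‖ ^ 2 with hD
  have hD0 : 0 ≤ D := by positivity
  have hv2 : q * (Var[f; P] / B) ≤ 2 * q * γ ^ 2 * σ ^ 2 / B + 8 / q * D := by
    have h1 : q * (Var[f; P] / B) ≤ q * ((2 * γ ^ 2 * σ ^ 2 + 2 * c ^ 2 * D) / B) := by gcongr
    have h2 : q * ((2 * γ ^ 2 * σ ^ 2 + 2 * c ^ 2 * D) / B)
        = 2 * q * γ ^ 2 * σ ^ 2 / B + 2 * q * c ^ 2 * D / B := by ring
    have h3 : 2 * q * c ^ 2 * D / B ≤ 2 * q * c ^ 2 * D :=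
      div_le_self (by positivity) hB0
    have h4 : 2 * q * c ^ 2 * D ≤ 2 * q * (2 / q) ^ 2 * D := by gcongr
    have h5 : 2 * q * (2 / q) ^ 2 * D = 8 / q * D := by field_simp; ring
    linarith
  have hv3 : 14 / q * (mx - my) ^ 2 ≤ 14 / q * D := by gcongr
  -- 14 stems from the drift of the means and 8 from the batch variance; the rest is slack.
  have hv4 : 32 / q * D = 14 / q * D + 8 / q * D + 10 / q * D := by ring
  have hv5 : 0 ≤ 10 / q * D := by positivity
  rw [smul_eq_mul, smul_eq_mul]
  linarith

/-- One step of the estimators, measured in the mean over all indices. -/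
theorem IsSampler.integral_average_msvrUpdate_sq_le (h : IsSampler ν b P I z) (hb1 : 1 ≤ b)
    (hb : b ≤ N) (hB : 1 ≤ B) {H : Fin N → Vec d → Z → ℝ} (hH : ∀ i, IsOracle P (H i) L σ)
    {γ : ℝ} (hγ0 : 0 ≤ γ) (hγ1 : γ ≤ 1 / 2) (x y : Vec d) (u a : Fin N → ℝ) :
    Integrable (fun w => 1 / (N : ℝ) * ∑ i, (msvrUpdate N b γ (H i) x y (u i) (i ∈ I w) (z w i)
        - ∫ ζ, H i x ζ ∂P - (1 - (b : ℝ) / N * γ) * a i) ^ 2) ν ∧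
    ∫ w, 1 / (N : ℝ) * ∑ i, (msvrUpdate N b γ (H i) x y (u i) (i ∈ I w) (z w i)
        - ∫ ζ, H i x ζ ∂P - (1 - (b : ℝ) / N * γ) * a i) ^ 2 ∂ν
      ≤ (1 - (b : ℝ) / N * γ) * (1 / (N : ℝ) * ∑ i, (u i - ∫ ζ, H i y ζ ∂P - a i) ^ 2)
        + 32 / ((b : ℝ) / N) * (L ^ 2 * ‖x - y‖ ^ 2) + 2 * ((b : ℝ) / N) * γ ^ 2 * σ ^ 2 / B
        + 3 * ((b : ℝ) / N) * γ ^ 2 * (1 / (N : ℝ) * ∑ i, a i ^ 2) := by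
  have hN0 : (0 : ℝ) < N := by exact_mod_cast hb1.trans hb
  have hi := fun i => h.integral_msvrUpdate_sq_le hb1 hb hB (hH i) hγ0 hγ1 x y (u i) (a i) i
  refine ⟨(integrable_finsetSum _ fun i _ => (hi i).1).const_mul _, ?_⟩
  rw [integral_const_mul, integral_finsetSum _ fun i _ => (hi i).1]
  refine (mul_le_mul_of_nonneg_left (Finset.sum_le_sum fun i _ => (hi i).2)
    (by positivity)).trans (le_of_eq ?_)
  simp only [Finset.sum_add_distrib, ← Finset.mul_sum, Finset.sum_const, Finset.card_univ,
    Fintype.card_fin, nsmul_eq_mul]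
  have hN1 : 1 / (N : ℝ) * N = 1 := by field_simp
  linear_combination (32 / ((b : ℝ) / N) * (L ^ 2 * ‖x - y‖ ^ 2)
    + 2 * ((b : ℝ) / N) * γ ^ 2 * σ ^ 2 / B) * hN1

end Msvr

/-! ### One iteration of the algorithm -/

section DrawLaw

variable {d n m : ℕ} {Z Ξ : Type*} [MeasurableSpace Z] [MeasurableSpace Ξ]
  {p : Problem d n m Z Ξ} {b c b₁ b₂ : ℕ}

theorem Problem.isProbabilityMeasure_drawLaw [IsProbabilityMeasure p.P]
    [IsProbabilityMeasure p.Q] (hb : b ≤ n) (hc : c ≤ m) :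
    IsProbabilityMeasure (p.drawLaw b c b₁ b₂) := by
  have := isProbabilityMeasure_uniformOn_card hb
  have := isProbabilityMeasure_uniformOn_card hc
  unfold Problem.drawLaw
  infer_instance

theorem Problem.isSampler_fst [IsProbabilityMeasure p.P] [IsProbabilityMeasure p.Q]
    (hb : b ≤ n) (hc : c ≤ m) :
    IsSampler (p.drawLaw b c b₁ b₂) b p.P (fun w => w.1) (fun w => w.2.2.1) := by
  have := isProbabilityMeasure_uniformOn_card hb
  have := isProbabilityMeasure_uniformOn_card hc
  constructor
  · intro i
    have h1 := (measurePreserving_eval (fun _ : Fin n => Measure.pi fun _ : Fin b₁ => p.P) i).comp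
      ((measurePreserving_fst (μ := Measure.pi fun _ : Fin n => Measure.pi fun _ : Fin b₁ => p.P)
        (ν := Measure.pi fun _ : Fin m => Measure.pi fun _ : Fin b₂ => p.Q)).comp
        (measurePreserving_snd (μ := uniformOn {J : Finset (Fin m) | J.card = c})))
    exact (MeasurePreserving.id _).prod h1
  · exact measurePreserving_fst

theorem Problem.isSampler_snd [IsProbabilityMeasure p.P] [IsProbabilityMeasure p.Q]
    (hb : b ≤ n) (hc : c ≤ m) :
    IsSampler (p.drawLaw b c b₁ b₂) c p.Q (fun w => w.2.1) (fun w => w.2.2.2) := by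
  have := isProbabilityMeasure_uniformOn_card hb
  have := isProbabilityMeasure_uniformOn_card hc
  constructor
  · intro k
    have h1 := (measurePreserving_eval (fun _ : Fin m => Measure.pi fun _ : Fin b₂ => p.Q) k).comp
      (measurePreserving_snd (μ := Measure.pi fun _ : Fin n => Measure.pi fun _ : Fin b₁ => p.P)
        (ν := Measure.pi fun _ : Fin m => Measure.pi fun _ : Fin b₂ => p.Q))
    exact ((MeasurePreserving.id (uniformOn {J : Finset (Fin m) | J.card = c})).prod h1).comp
      measurePreserving_snd
  · exact measurePreserving_fst.comp measurePreserving_snd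

end DrawLaw

/-- The weak convexity constant of `F`, with shifted inner functions, which results from the
smoothness of the `f_i` and `g_i`. -/
noncomputable def Constants.rhoComp (C : Constants) : ℝ :=
  C.L_f * C.L_dg + C.L_df * C.L_g ^ 2

/-- The bound of the second moments of the stochastic gradients. -/
noncomputable def Constants.gradSq (C : Constants) (d : ℕ) (β : ℝ) : ℝ :=
  2 * ((C.L_f : ℝ) ^ 2 * (2 * d * (C.L_g : ℝ) ^ 2)) + 2 * (β ^ 2 * (2 * d * (C.L_h : ℝ) ^ 2))

/-- The penalized objective in which the inner functions `g_i` are shifted by `e_i`. -/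
noncomputable def Problem.shiftedPhi {d n m : ℕ} {Z Ξ : Type*} [MeasurableSpace Z]
    [MeasurableSpace Ξ] (p : Problem d n m Z Ξ) (β : ℝ) (e : Fin n → ℝ) (x : Vec d) : ℝ :=
  1 / (n : ℝ) * ∑ i, p.f i (p.gMean i x + e i) + β * (1 / (m : ℝ) * ∑ k, hinge (p.hMean k x))

/-! ### Regularity of the shifted objectives and moments of the oracles -/

section Assumptions

variable {d n m : ℕ} {Z Ξ : Type*} [MeasurableSpace Z] [MeasurableSpace Ξ]
  {p : Problem d n m Z Ξ} {C : Constants} {β : ℝ}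

theorem Problem.shiftedPhi_zero (p : Problem d n m Z Ξ) (β : ℝ) :
    p.shiftedPhi β 0 = p.Phi β := by
  ext x
  simp only [shiftedPhi, Phi, F, Pi.zero_apply, add_zero]
  ring

namespace Problem.Assumptions

theorem isOracle_g (hp : p.Assumptions C) (i : Fin n) : IsOracle p.P (p.g i) C.L_g C.σ_g where
  meas _ := (hp.meas_g i).of_uncurry_left
  int := hp.g_integrable i
  lip := hp.g_meanSquareLipschitz i
  var := hp.g_variance i

theorem isOracle_h (hp : p.Assumptions C) (k : Fin m) : IsOracle p.Q (p.h k) C.L_h C.σ_h where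
  meas _ := (hp.meas_h k).of_uncurry_left
  int := hp.h_integrable k
  lip := hp.h_meanSquareLipschitz k
  var := hp.h_variance k

theorem g_lipschitz (hp : p.Assumptions C) (i : Fin n) : LipschitzWith C.L_g (p.gMean i) := by
  have := hp.probP
  refine LipschitzWith.of_dist_le_mul fun x y => ?_
  rw [dist_eq_norm, dist_eq_norm]
  exact (hp.isOracle_g i).abs_mean_sub_le C.L_g.2 x y

theorem memLp_dg (hp : p.Assumptions C) (i : Fin n) (x : Vec d) : MemLp (p.dg i x) 2 p.P :=
  memLp_two_of_lintegral_norm_sq_le (hp.meas_dg i).of_uncurry_left.aestronglyMeasurable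
    (lintegral_norm_sq_le (hp.isOracle_g i).meas (hp.meas_dg i).of_uncurry_left
      (hp.dg_subgradient i x) (hp.isOracle_g i).lip)

theorem memLp_dh (hp : p.Assumptions C) (k : Fin m) (x : Vec d) : MemLp (p.dh k x) 2 p.Q :=
  memLp_two_of_lintegral_norm_sq_le (hp.meas_dh k).of_uncurry_left.aestronglyMeasurable
    (lintegral_norm_sq_le (hp.isOracle_h k).meas (hp.meas_dh k).of_uncurry_left
      (hp.dh_subgradient k x) (hp.isOracle_h k).lip)

theorem integral_norm_dg_sq_le (hp : p.Assumptions C) (i : Fin n) (x : Vec d) :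
    ∫ z, ‖p.dg i x z‖ ^ 2 ∂p.P ≤ 2 * d * (C.L_g : ℝ) ^ 2 :=
  integral_le_of_lintegral_ofReal_le (fun _ => sq_nonneg _)
    ((hp.meas_dg i).of_uncurry_left.norm.pow_const 2).aestronglyMeasurable (by positivity)
    (lintegral_norm_sq_le (hp.isOracle_g i).meas (hp.meas_dg i).of_uncurry_left
      (hp.dg_subgradient i x) (hp.isOracle_g i).lip)

theorem integral_norm_dh_sq_le (hp : p.Assumptions C) (k : Fin m) (x : Vec d) :
    ∫ z, ‖p.dh k x z‖ ^ 2 ∂p.Q ≤ 2 * d * (C.L_h : ℝ) ^ 2 :=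
  integral_le_of_lintegral_ofReal_le (fun _ => sq_nonneg _)
    ((hp.meas_dh k).of_uncurry_left.norm.pow_const 2).aestronglyMeasurable (by positivity)
    (lintegral_norm_sq_le (hp.isOracle_h k).meas (hp.meas_dh k).of_uncurry_left
      (hp.dh_subgradient k x) (hp.isOracle_h k).lip)

theorem integral_dg (hp : p.Assumptions C) (i : Fin n) (x : Vec d) :
    ∫ z, p.dg i x z ∂p.P = gradient (p.gMean i) x := by
  have := hp.probP
  exact integral_eq_gradient (hp.isOracle_g i).meas (hp.isOracle_g i).int
    (hp.meas_dg i).of_uncurry_left (hp.dg_subgradient i x) (hp.isOracle_g i).lip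
    ((hp.g_smooth i).1 x)

/-- The unbiased oracle of `h_k` supplies a subgradient at every point, which makes the hinge terms
supported by parabolas everywhere. -/
theorem quadMinorized_shiftedPhi (hp : p.Assumptions C) (hn : 1 ≤ n) (hm : 1 ≤ m) (hβ : 0 ≤ β)
    (e : Fin n → ℝ) : QuadMinorized (C.rhoComp + β * C.ρ₁) (p.shiftedPhi β e) := by
  refine QuadMinorized.add (QuadMinorized.average hn fun i => ?_)
    (QuadMinorized.const_mul (QuadMinorized.average hm fun k => ?_) hβ)
  · intro z
    refine ⟨deriv (p.f i) (p.gMean i z + e i) • gradient (p.gMean i) z, fun y => ?_⟩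
    rw [inner_smul_left, conj_trivial]
    exact le_comp_add_deriv_mul_inner (hp.f_lipschitz i) (hp.f_smooth i) (hp.g_lipschitz i)
      (hp.g_smooth i) (e i) y z
  · exact (hp.h_weaklyConvex k).quadMinorized_hinge_comp C.ρ₁_pos.le
      fun x => ⟨_, hp.dh_mean k x⟩

theorem continuous_shiftedPhi (hp : p.Assumptions C) (e : Fin n → ℝ) :
    Continuous (p.shiftedPhi β e) := by
  have h1 := fun i => (hp.g_lipschitz i).continuous
  have h2 := fun i => (hp.f_lipschitz i).continuous
  have h3 := fun k => (hp.h_lipschitz k).continuous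
  unfold Problem.shiftedPhi hinge
  fun_prop

theorem abs_shiftedPhi_sub_le (hp : p.Assumptions C) (e e' : Fin n → ℝ) (x : Vec d) :
    |p.shiftedPhi β e x - p.shiftedPhi β e' x| ≤ C.L_f * (1 / (n : ℝ) * ∑ i, |e i - e' i|) := by
  unfold Problem.shiftedPhi
  rw [add_sub_add_right_eq_sub, ← mul_sub, ← Finset.sum_sub_distrib, abs_mul,
    abs_of_nonneg (by positivity), mul_left_comm, Finset.mul_sum _ _ (C.L_f : ℝ)]
  gcongr
  refine (Finset.abs_sum_le_sum_abs _ _).trans (Finset.sum_le_sum fun i _ => ?_)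
  have := (hp.f_lipschitz i).dist_le_mul (p.gMean i x + e i) (p.gMean i x + e' i)
  simpa [Real.dist_eq] using this

theorem abs_shiftedPhi_sub_sub_le (hp : p.Assumptions C) (e : Fin n → ℝ) (x y : Vec d) :
    |(p.shiftedPhi β e x - p.Phi β x) - (p.shiftedPhi β e y - p.Phi β y)|
      ≤ C.L_df * C.L_g * (1 / (n : ℝ) * ∑ i, |e i|) * ‖x - y‖ := by
  have h1 : (p.shiftedPhi β e x - p.Phi β x) - (p.shiftedPhi β e y - p.Phi β y)
      = 1 / (n : ℝ) * ∑ i, ((p.f i (p.gMean i x + e i) - p.f i (p.gMean i x))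
        - (p.f i (p.gMean i y + e i) - p.f i (p.gMean i y))) := by
    rw [← p.shiftedPhi_zero]
    unfold Problem.shiftedPhi
    simp only [Pi.zero_apply, add_zero, Finset.sum_sub_distrib]
    ring
  have h2 : C.L_df * C.L_g * (1 / (n : ℝ) * ∑ i, |e i|) * ‖x - y‖
      = 1 / (n : ℝ) * ∑ i, C.L_df * |e i| * (C.L_g * ‖x - y‖) := by
    rw [← Finset.sum_mul, ← Finset.mul_sum]; ring
  rw [h1, h2, abs_mul, abs_of_nonneg (by positivity)]
  gcongr
  refine (Finset.abs_sum_le_sum_abs _ _).trans (Finset.sum_le_sum fun i _ => ?_)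
  refine (abs_sub_sub_sub_le (hp.f_smooth i) _ _ _).trans ?_
  have := (hp.g_lipschitz i).dist_le_mul x y
  rw [Real.dist_eq, dist_eq_norm] at this
  gcongr

end Problem.Assumptions

theorem abs_inner_gradient_le {g : Vec d → ℝ} {K : ℝ≥0} (hg : LipschitzWith K g) (x v : Vec d) :
    |inner ℝ (gradient g x) v| ≤ K * ‖v‖ := by
  have h1 : ‖gradient g x‖ ≤ K := by
    unfold gradient
    rw [LinearIsometryEquiv.norm_map]
    exact norm_fderiv_le_of_lipschitz ℝ hg
  exact (abs_real_inner_le_norm _ _).trans (by gcongr)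

end Assumptions

section OneStep

variable {d n m : ℕ} {Z Ξ : Type*} [MeasurableSpace Z] [MeasurableSpace Ξ]
  {p : Problem d n m Z Ξ} {C : Constants} {a : Params}

theorem Problem.G₁_eq_sampledMean (S : State d n m) (w : Draw n m a.b₁ a.b₂ Z Ξ) :
    p.G₁ a S w = sampledMean a.b (fun i => deriv (p.f i) (S.u₁ i)) (fun i => p.dg i S.x)
      w.1 w.2.2.1 := rfl

theorem Problem.G₂_eq_sampledMean (S : State d n m) (w : Draw n m a.b₁ a.b₂ Z Ξ) :
    p.G₂ a S w = a.β • sampledMean a.c (fun k => a.s (S.u₂ k)) (fun k => p.dh k S.x)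
      w.2.1 w.2.2.2 := by
  unfold Problem.G₂ sampledMean
  rw [smul_smul, mul_one_div]

/-- Admissible parameters: sizes of the mini-batches and a choice of subgradients. -/
structure Params.Valid (a : Params) (n m : ℕ) : Prop where
  one_le_b : 1 ≤ a.b
  b_le : a.b ≤ n
  one_le_c : 1 ≤ a.c
  c_le : a.c ≤ m
  one_le_b₁ : 1 ≤ a.b₁
  one_le_b₂ : 1 ≤ a.b₂
  β_nonneg : 0 ≤ a.β
  s_mem : ∀ u, a.s u ∈ subdifferential hinge u

variable (hp : p.Assumptions C) (ha : a.Valid n m) (S : State d n m)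
include hp ha

theorem Problem.Assumptions.memLp_G₁ :
    MemLp (fun w => p.G₁ a S w) 2 (p.drawLaw a.b a.c a.b₁ a.b₂) := by
  have := hp.probP
  have := hp.probQ
  exact (p.isSampler_fst ha.b_le ha.c_le).memLp_sampledMean ha.b_le fun i => hp.memLp_dg i S.x

theorem Problem.Assumptions.memLp_G₂ :
    MemLp (fun w => p.G₂ a S w) 2 (p.drawLaw a.b a.c a.b₁ a.b₂) := by
  have := hp.probP
  have := hp.probQ
  simp_rw [Problem.G₂_eq_sampledMean]
  exact ((p.isSampler_snd ha.b_le ha.c_le).memLp_sampledMean ha.c_le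
    fun k => hp.memLp_dh k S.x).const_smul a.β

theorem Problem.Assumptions.memLp_G :
    MemLp (fun w => p.G₁ a S w + p.G₂ a S w) 2 (p.drawLaw a.b a.c a.b₁ a.b₂) :=
  (hp.memLp_G₁ ha S).add (hp.memLp_G₂ ha S)

theorem Problem.Assumptions.integral_norm_G_sq_le :
    ∫ w, ‖p.G₁ a S w + p.G₂ a S w‖ ^ 2 ∂p.drawLaw a.b a.c a.b₁ a.b₂ ≤ C.gradSq d a.β := by
  have := hp.probP
  have := hp.probQ
  have i1 := (hp.memLp_G₁ ha S).norm.integrable_sq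
  have i2 := (hp.memLp_G₂ ha S).norm.integrable_sq
  have h1 : ∫ w, ‖p.G₁ a S w‖ ^ 2 ∂p.drawLaw a.b a.c a.b₁ a.b₂
      ≤ (C.L_f : ℝ) ^ 2 * (2 * d * (C.L_g : ℝ) ^ 2) :=
    (p.isSampler_fst ha.b_le ha.c_le).integral_norm_sampledMean_sq_le ha.one_le_b ha.b_le
      ha.one_le_b₁ (fun i => hp.memLp_dg i S.x)
      (fun i => abs_deriv_le_of_lipschitz (hp.f_lipschitz i) _)
      (fun i => hp.integral_norm_dg_sq_le i S.x)
  have h2 : ∫ w, ‖p.G₂ a S w‖ ^ 2 ∂p.drawLaw a.b a.c a.b₁ a.b₂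
      ≤ a.β ^ 2 * (2 * d * (C.L_h : ℝ) ^ 2) := by
    simp_rw [Problem.G₂_eq_sampledMean, norm_smul, mul_pow, Real.norm_eq_abs, sq_abs]
    rw [integral_const_mul]
    have := (p.isSampler_snd (b₁ := a.b₁) (b₂ := a.b₂) ha.b_le
      ha.c_le).integral_norm_sampledMean_sq_le ha.one_le_c ha.c_le ha.one_le_b₂
      (fun k => hp.memLp_dh k S.x) (a := fun k => a.s (S.u₂ k)) (A := 1)
      (fun k => by
        have := hinge_subgradient_mem_Icc (ha.s_mem (S.u₂ k))
        rw [abs_of_nonneg this.1]; exact this.2)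
      (fun k => hp.integral_norm_dh_sq_le k S.x)
    rw [one_pow, one_mul] at this
    gcongr
  calc ∫ w, ‖p.G₁ a S w + p.G₂ a S w‖ ^ 2 ∂p.drawLaw a.b a.c a.b₁ a.b₂
      ≤ ∫ w, (2 * ‖p.G₁ a S w‖ ^ 2 + 2 * ‖p.G₂ a S w‖ ^ 2) ∂p.drawLaw a.b a.c a.b₁ a.b₂ := by
        refine integral_mono (hp.memLp_G ha S).norm.integrable_sq
          ((i1.const_mul 2).add (i2.const_mul 2)) fun w => ?_
        have h3 := pow_le_pow_left₀ (norm_nonneg _) (norm_add_le (p.G₁ a S w) (p.G₂ a S w)) 2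
        simp only
        nlinarith [sq_nonneg (‖p.G₁ a S w‖ - ‖p.G₂ a S w‖)]
    _ ≤ _ := by
        rw [integral_add (i1.const_mul 2) (i2.const_mul 2), integral_const_mul,
          integral_const_mul]
        unfold Constants.gradSq
        linarith

theorem Problem.Assumptions.lintegral_norm_step_sub_sq_le :
    ∫⁻ w, ENNReal.ofReal (‖(p.step a S w).x - (p.step a S w).xPrev‖ ^ 2)
      ∂p.drawLaw a.b a.c a.b₁ a.b₂ ≤ ENNReal.ofReal (a.η ^ 2 * C.gradSq d a.β) := by
  have h1 : ∀ w, ‖(p.step a S w).x - (p.step a S w).xPrev‖ ^ 2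
      = a.η ^ 2 * ‖p.G₁ a S w + p.G₂ a S w‖ ^ 2 := fun w => by
    simp only [Problem.step]
    rw [sub_sub_cancel_left, norm_neg, norm_smul, mul_pow, Real.norm_eq_abs, sq_abs]
  simp_rw [h1]
  rw [← ofReal_integral_eq_lintegral_ofReal ((hp.memLp_G ha S).norm.integrable_sq.const_mul _)
    (Filter.Eventually.of_forall fun _ => by positivity), integral_const_mul]
  have := hp.integral_norm_G_sq_le ha S
  gcongr

theorem Problem.Assumptions.integral_G :
    ∫ w, (p.G₁ a S w + p.G₂ a S w) ∂p.drawLaw a.b a.c a.b₁ a.b₂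
      = (1 / (n : ℝ)) • ∑ i, deriv (p.f i) (S.u₁ i) • gradient (p.gMean i) S.x
        + a.β • (1 / (m : ℝ)) • ∑ k, a.s (S.u₂ k) • ∫ z, p.dh k S.x z ∂p.Q := by
  have := hp.probP
  have := hp.probQ
  have := p.isProbabilityMeasure_drawLaw (b₁ := a.b₁) (b₂ := a.b₂) ha.b_le ha.c_le
  rw [integral_add ((hp.memLp_G₁ ha S).integrable (by norm_num))
    ((hp.memLp_G₂ ha S).integrable (by norm_num))]
  simp_rw [Problem.G₁_eq_sampledMean, Problem.G₂_eq_sampledMean]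
  rw [integral_smul, (p.isSampler_fst ha.b_le ha.c_le).integral_sampledMean ha.one_le_b ha.b_le
    ha.one_le_b₁ fun i => (hp.memLp_dg i S.x).integrable (by norm_num),
    (p.isSampler_snd ha.b_le ha.c_le).integral_sampledMean ha.one_le_c ha.c_le
    ha.one_le_b₂ fun k => (hp.memLp_dh k S.x).integrable (by norm_num)]
  simp_rw [hp.integral_dg]

/-- For the smooth part, replacing the derivative at `u₁` by that at the shifted value costs a
product of the estimation error and `‖y - x‖`. Young's inequality with a weight proportional to `l`
turns it into a squared error and `‖y - x‖² / (8 l)`, small enough to be absorbed by the proximal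
term later. The hinge part cannot be treated this way and keeps its linear error. -/
theorem Problem.Assumptions.inner_integral_G_le {l : ℝ} (hl : 0 < l) (e : Fin n → ℝ)
    (y : Vec d) :
    inner ℝ (∫ w, (p.G₁ a S w + p.G₂ a S w) ∂p.drawLaw a.b a.c a.b₁ a.b₂) (y - S.x)
      ≤ p.shiftedPhi a.β e y - p.shiftedPhi a.β e S.x
        + (C.rhoComp + a.β * C.ρ₁) / 2 * ‖y - S.x‖ ^ 2 + 1 / (8 * l) * ‖y - S.x‖ ^ 2
        + 2 * l * (C.L_df * C.L_g) ^ 2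
          * (1 / (n : ℝ) * ∑ i, (S.u₁ i - p.gMean i S.x - e i) ^ 2)
        + 2 * a.β * (1 / (m : ℝ) * ∑ k, |S.u₂ k - p.hMean k S.x|) := by
  have hn : (0 : ℝ) < n := by exact_mod_cast ha.one_le_b.trans ha.b_le
  have hm : (0 : ℝ) < m := by exact_mod_cast ha.one_le_c.trans ha.c_le
  rw [hp.integral_G ha S, inner_add_left]
  simp only [inner_smul_left, sum_inner, conj_trivial]
  set D := ‖y - S.x‖ ^ 2 with hD
  have t1 : ∀ i, deriv (p.f i) (S.u₁ i) * inner ℝ (gradient (p.gMean i) S.x) (y - S.x)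
      ≤ p.f i (p.gMean i y + e i) - p.f i (p.gMean i S.x + e i) + (C.rhoComp / 2 * D
        + 1 / (8 * l) * D) + 2 * l * (C.L_df * C.L_g) ^ 2
          * (S.u₁ i - p.gMean i S.x - e i) ^ 2 := by
    intro i
    have h1 := le_comp_add_deriv_mul_inner (hp.f_lipschitz i) (hp.f_smooth i) (hp.g_lipschitz i)
      (hp.g_smooth i) (e i) y S.x
    have h2 := (hp.f_smooth i).abs_deriv_sub_le (S.u₁ i) (p.gMean i S.x + e i)
    rw [← sub_sub] at h2
    have h3 := abs_inner_gradient_le (hp.g_lipschitz i) S.x (y - S.x)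
    set r := S.u₁ i - p.gMean i S.x - e i
    set J := inner ℝ (gradient (p.gMean i) S.x) (y - S.x)
    have h4 : (deriv (p.f i) (S.u₁ i) - deriv (p.f i) (p.gMean i S.x + e i)) * J
        ≤ (C.L_df * |r|) * (C.L_g * ‖y - S.x‖) := by
      refine (le_abs_self _).trans ?_
      rw [abs_mul]
      exact mul_le_mul h2 h3 (abs_nonneg _) (by positivity)
    have h5 : (C.L_df * |r|) * (C.L_g * ‖y - S.x‖)
        ≤ 1 / (8 * l) * D + 2 * l * (C.L_df * C.L_g) ^ 2 * r ^ 2 := by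
      have e1 : 1 / (8 * l) * D + 2 * l * (C.L_df * C.L_g) ^ 2 * r ^ 2
          = (D + (4 * l * (C.L_df * C.L_g * |r|)) ^ 2) / (8 * l) := by
        rw [show (4 * l * (C.L_df * C.L_g * |r|)) ^ 2 = 16 * l ^ 2 * (C.L_df * C.L_g) ^ 2 * |r| ^ 2
          by ring, sq_abs]
        field_simp
        ring
      rw [e1, le_div_iff₀ (by positivity), hD]
      nlinarith [sq_nonneg (‖y - S.x‖ - 4 * l * (C.L_df * C.L_g * |r|))]
    unfold Constants.rhoComp
    linarith
  have t2 : ∀ k, a.s (S.u₂ k) * inner ℝ (∫ z, p.dh k S.x z ∂p.Q) (y - S.x)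
      ≤ hinge (p.hMean k y) - hinge (p.hMean k S.x) + 2 * |S.u₂ k - p.hMean k S.x|
        + C.ρ₁ / 2 * D := fun k =>
    (hp.h_weaklyConvex k).hinge_subgradient_mul_inner_le C.ρ₁_pos.le (hp.dh_mean k S.x)
      (ha.s_mem _)
  have s1 := mul_le_mul_of_nonneg_left (Finset.sum_le_sum fun i (_ : i ∈ Finset.univ) => t1 i)
    (by positivity : 0 ≤ 1 / (n : ℝ))
  have s2 := mul_le_mul_of_nonneg_left (mul_le_mul_of_nonneg_left
    (Finset.sum_le_sum fun k (_ : k ∈ Finset.univ) => t2 k)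
    (by positivity : 0 ≤ 1 / (m : ℝ))) ha.β_nonneg
  simp only [Finset.sum_add_distrib, Finset.sum_sub_distrib, ← Finset.mul_sum, Finset.sum_const,
    Finset.card_univ, Fintype.card_fin, nsmul_eq_mul] at s1 s2
  refine (add_le_add s1 s2).trans (le_of_eq ?_)
  unfold Problem.shiftedPhi
  field_simp
  ring

/-- The expected decrease of the Moreau envelope in one iteration. -/
theorem Problem.Assumptions.lintegral_moreauEnvelope_step_le {l : ℝ} (hl : 0 < l)
    (hρ : l * (C.rhoComp + a.β * C.ρ₁) ≤ 1 / 4) (hη : 0 ≤ a.η) (e e' : Fin n → ℝ) {B : ℝ}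
    (hB : ∀ y, B ≤ p.shiftedPhi a.β e' y) :
    ∫⁻ w, ENNReal.ofReal (moreauEnvelope (p.shiftedPhi a.β e') l (p.step a S w).x - B)
        ∂p.drawLaw a.b a.c a.b₁ a.b₂
      + ENNReal.ofReal (a.η / 4 * ‖gradient (moreauEnvelope (p.shiftedPhi a.β e) l) S.x‖ ^ 2)
      ≤ ENNReal.ofReal (moreauEnvelope (p.shiftedPhi a.β e) l S.x - B
        + C.L_f * (1 / (n : ℝ) * ∑ i, |e' i - e i|)
        + 2 * a.β * a.η / l * (1 / (m : ℝ) * ∑ k, |S.u₂ k - p.hMean k S.x|)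
        + 2 * a.η * (C.L_df * C.L_g) ^ 2
          * (1 / (n : ℝ) * ∑ i, (S.u₁ i - p.gMean i S.x - e i) ^ 2)
        + a.η ^ 2 * C.gradSq d a.β / (2 * l)) := by
  have := hp.probP
  have := hp.probQ
  have := p.isProbabilityMeasure_drawLaw (b₁ := a.b₁) (b₂ := a.b₂) ha.b_le ha.c_le
  have hn := ha.one_le_b.trans ha.b_le
  have hm := ha.one_le_c.trans ha.c_le
  have hQ := hp.quadMinorized_shiftedPhi hn hm ha.β_nonneg e
  have hQ' := hp.quadMinorized_shiftedPhi hn hm ha.β_nonneg e'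
  have hc := hp.continuous_shiftedPhi (β := a.β) e
  have hc' := hp.continuous_shiftedPhi (β := a.β) e'
  have hρ1 : l * (C.rhoComp + a.β * C.ρ₁) < 1 := by linarith
  set ψ := p.shiftedPhi a.β e with hψ
  set ψ' := p.shiftedPhi a.β e' with hψ'
  set q := prox ψ l S.x with hq
  have hpx : IsProx ψ l S.x q := isProx_prox hQ hc hl hρ1 S.x
  set κ := C.L_f * (1 / (n : ℝ) * ∑ i, |e' i - e i|) with hκ
  have hκ' : ∀ y, ψ' y ≤ ψ y + κ := fun y => by
    have := (abs_le.1 (hp.abs_shiftedPhi_sub_le (β := a.β) e' e y)).2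
    linarith
  set G := fun w => p.G₁ a S w + p.G₂ a S w with hG
  -- An integrable majorant of the next envelope value, obtained with the old proximal point `q` as
  -- competitor; `κ` pays for changing the shift from `e` to `e'`.
  set R := fun w => (ψ q + 1 / (2 * l) * ‖q - S.x‖ ^ 2 + κ - B)
    + (a.η / l * inner ℝ (q - S.x) (G w) + a.η ^ 2 / (2 * l) * ‖G w‖ ^ 2) with hR
  have hGm : MemLp G 2 (p.drawLaw a.b a.c a.b₁ a.b₂) := hp.memLp_G ha S
  have hGi : Integrable G (p.drawLaw a.b a.c a.b₁ a.b₂) := hGm.integrable (by norm_num)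
  have hGs := hGm.norm.integrable_sq
  have hVR : ∀ w, moreauEnvelope ψ' l (p.step a S w).x - B ≤ R w := fun w => by
    have h1 := (isProx_prox hQ' hc' hl hρ1 (p.step a S w).x).moreauEnvelope_le q
    have h2 : ‖q - (p.step a S w).x‖ ^ 2 = ‖q - S.x‖ ^ 2 + 2 * a.η * inner ℝ (q - S.x) (G w)
        + a.η ^ 2 * ‖G w‖ ^ 2 := by
      have : q - (p.step a S w).x = (q - S.x) + a.η • G w := by
        simp only [Problem.step, hG]; module
      rw [this, norm_add_sq_real, inner_smul_right, norm_smul, mul_pow, Real.norm_eq_abs, sq_abs]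
      ring
    have h3 : 1 / (2 * l) * (‖q - S.x‖ ^ 2 + 2 * a.η * inner ℝ (q - S.x) (G w)
        + a.η ^ 2 * ‖G w‖ ^ 2) = 1 / (2 * l) * ‖q - S.x‖ ^ 2
        + (a.η / l * inner ℝ (q - S.x) (G w) + a.η ^ 2 / (2 * l) * ‖G w‖ ^ 2) := by
      field_simp
      ring
    rw [h2, h3] at h1
    simp only [hR]
    linarith [hκ' q]
  have hR0 : ∀ w, 0 ≤ R w := fun w => by
    have := le_moreauEnvelope (isProx_prox hQ' hc' hl hρ1 (p.step a S w).x) hl hB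
    linarith [hVR w]
  have hinn : Integrable (fun w => inner ℝ (q - S.x) (G w)) (p.drawLaw a.b a.c a.b₁ a.b₂) :=
    hGi.const_inner _
  have hsum : Integrable (fun w => a.η / l * inner ℝ (q - S.x) (G w)
      + a.η ^ 2 / (2 * l) * ‖G w‖ ^ 2) (p.drawLaw a.b a.c a.b₁ a.b₂) :=
    (hinn.const_mul (a.η / l)).add (hGs.const_mul (a.η ^ 2 / (2 * l)))
  have hRi : Integrable R (p.drawLaw a.b a.c a.b₁ a.b₂) := (integrable_const _).add hsum
  have hRint : ∫ w, R w ∂p.drawLaw a.b a.c a.b₁ a.b₂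
      = (ψ q + 1 / (2 * l) * ‖q - S.x‖ ^ 2 + κ - B)
        + (a.η / l * inner ℝ (∫ w, G w ∂p.drawLaw a.b a.c a.b₁ a.b₂) (q - S.x)
        + a.η ^ 2 / (2 * l) * ∫ w, ‖G w‖ ^ 2 ∂p.drawLaw a.b a.c a.b₁ a.b₂) := by
    simp only [hR]
    rw [integral_add (integrable_const _) hsum, integral_add (hinn.const_mul _) (hGs.const_mul _),
      integral_const_mul, integral_const_mul, integral_inner hGi, real_inner_comm]
    simp
  have hin := hp.inner_integral_G_le ha S hl e q
  rw [← hψ] at hin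
  have hgs := hp.integral_norm_G_sq_le ha S
  have hmin := hpx S.x
  rw [sub_self, norm_zero] at hmin
  have hgrad : ‖gradient (moreauEnvelope ψ l) S.x‖ ^ 2 = (1 / l) ^ 2 * ‖q - S.x‖ ^ 2 := by
    rw [gradient_moreauEnvelope hQ hc hl hρ1, norm_smul, mul_pow, norm_sub_rev,
      Real.norm_of_nonneg (by positivity)]
  have h1 : ∫⁻ w, ENNReal.ofReal (moreauEnvelope ψ' l (p.step a S w).x - B)
      ∂p.drawLaw a.b a.c a.b₁ a.b₂ ≤ ENNReal.ofReal (∫ w, R w ∂p.drawLaw a.b a.c a.b₁ a.b₂) := by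
    rw [ofReal_integral_eq_lintegral_ofReal hRi (Filter.Eventually.of_forall hR0)]
    exact lintegral_mono fun w => ENNReal.ofReal_le_ofReal (hVR w)
  refine (add_le_add_left h1 _).trans ?_
  rw [← ENNReal.ofReal_add (integral_nonneg hR0) (by positivity), hgrad]
  apply ENNReal.ofReal_le_ofReal
  rw [hRint, hpx.moreauEnvelope_eq]
  set D := ‖q - S.x‖ ^ 2 with hD
  set J := inner ℝ (∫ w, G w ∂p.drawLaw a.b a.c a.b₁ a.b₂) (q - S.x) with hJ
  set r₁ := 1 / (n : ℝ) * ∑ i, (S.u₁ i - p.gMean i S.x - e i) ^ 2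
  set r₂ := 1 / (m : ℝ) * ∑ k, |S.u₂ k - p.hMean k S.x|
  have hD0 : 0 ≤ D := by positivity
  have hρl : (C.rhoComp + a.β * C.ρ₁) / 2 * D ≤ 1 / (8 * l) * D := by
    have : (C.rhoComp + a.β * C.ρ₁) / 2 ≤ 1 / (8 * l) := by
      rw [div_le_div_iff₀ (by norm_num) (by positivity)]; linarith
    gcongr
  -- Minimality of `q` yields `-D / (2 l)`. The curvature and the Young term each consume `D / (8
  -- l)`, leaving `-D / (4 l)`.
  have hJ' : J ≤ -(1 / (4 * l)) * D + 2 * l * (C.L_df * C.L_g) ^ 2 * r₁ + 2 * a.β * r₂ := by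
    have : 1 / (2 * l) * D = 1 / (4 * l) * D + 1 / (8 * l) * D + 1 / (8 * l) * D := by
      field_simp; ring
    linarith
  have hJ2 := mul_le_mul_of_nonneg_left hJ' (by positivity : 0 ≤ a.η / l)
  have hG2 := mul_le_mul_of_nonneg_left hgs (by positivity : 0 ≤ a.η ^ 2 / (2 * l))
  have e1 : a.η / l * (-(1 / (4 * l)) * D + 2 * l * (C.L_df * C.L_g) ^ 2 * r₁ + 2 * a.β * r₂)
      = -(a.η / 4 * ((1 / l) ^ 2 * D)) + 2 * a.η * (C.L_df * C.L_g) ^ 2 * r₁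
        + 2 * a.β * a.η / l * r₂ := by
    field_simp
  have e3 : a.η ^ 2 / (2 * l) * C.gradSq d a.β = a.η ^ 2 * C.gradSq d a.β / (2 * l) := by ring
  rw [e1] at hJ2
  rw [e3] at hG2
  linarith

end OneStep

/-! ### The iterates as a Markov chain -/

section Measurability

variable {d n m : ℕ} {Z Ξ : Type*} [MeasurableSpace Z] [MeasurableSpace Ξ]
  {p : Problem d n m Z Ξ} {C : Constants} {a : Params}

instance State.instMeasurableSpace : MeasurableSpace (State d n m) :=
  MeasurableSpace.comap (fun S => (S.x, S.xPrev, S.u₁, S.u₂)) inferInstance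

theorem State.measurable_toProd :
    Measurable fun S : State d n m => (S.x, S.xPrev, S.u₁, S.u₂) := comap_measurable _

theorem State.measurable_x : Measurable fun S : State d n m => S.x :=
  State.measurable_toProd.fst

theorem State.measurable_xPrev : Measurable fun S : State d n m => S.xPrev :=
  State.measurable_toProd.snd.fst

theorem State.measurable_u₁ (i : Fin n) : Measurable fun S : State d n m => S.u₁ i :=
  (measurable_pi_apply i).comp State.measurable_toProd.snd.snd.fst

theorem State.measurable_u₂ (k : Fin m) : Measurable fun S : State d n m => S.u₂ k :=
  (measurable_pi_apply k).comp State.measurable_toProd.snd.snd.snd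

theorem measurable_batchMean {Y V : Type*} [MeasurableSpace Y] [NormedAddCommGroup V]
    [NormedSpace ℝ V] [MeasurableSpace V] [BorelSpace V] [SecondCountableTopology V] {N : ℕ}
    {f : Y → Fin N → V} (hf : ∀ j, Measurable fun y => f y j) :
    Measurable fun y => batchMean (f y) := by
  unfold batchMean
  fun_prop

theorem measurable_ite_mem {Y V : Type*} [MeasurableSpace Y] [MeasurableSpace V] {N : ℕ}
    {I : Y → Finset (Fin N)} (hI : Measurable I) {f g : Y → V} (hf : Measurable f)
    (hg : Measurable g) (i : Fin N) : Measurable fun y => if i ∈ I y then f y else g y :=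
  Measurable.ite ((measurableSet_mem_finset i).preimage hI) hf hg

theorem Problem.Assumptions.measurable_step (hp : p.Assumptions C) (hs : Measurable a.s) :
    Measurable fun y : State d n m × Draw n m a.b₁ a.b₂ Z Ξ => p.step a y.1 y.2 := by
  have mx : Measurable fun y : State d n m × Draw n m a.b₁ a.b₂ Z Ξ => y.1.x :=
    State.measurable_x.comp measurable_fst
  have my : Measurable fun y : State d n m × Draw n m a.b₁ a.b₂ Z Ξ => y.1.xPrev :=
    State.measurable_xPrev.comp measurable_fst
  have mu₁ : ∀ i, Measurable fun y : State d n m × Draw n m a.b₁ a.b₂ Z Ξ => y.1.u₁ i :=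
    fun i => (State.measurable_u₁ i).comp measurable_fst
  have mu₂ : ∀ k, Measurable fun y : State d n m × Draw n m a.b₁ a.b₂ Z Ξ => y.1.u₂ k :=
    fun k => (State.measurable_u₂ k).comp measurable_fst
  have mI : Measurable fun y : State d n m × Draw n m a.b₁ a.b₂ Z Ξ => y.2.1 := by fun_prop
  have mJ : Measurable fun y : State d n m × Draw n m a.b₁ a.b₂ Z Ξ => y.2.2.1 := by fun_prop
  have mζ : ∀ i j, Measurable fun y : State d n m × Draw n m a.b₁ a.b₂ Z Ξ => y.2.2.2.1 i j :=
    fun i j => by fun_prop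
  have mξ : ∀ k j, Measurable fun y : State d n m × Draw n m a.b₁ a.b₂ Z Ξ => y.2.2.2.2 k j :=
    fun k j => by fun_prop
  have hg := fun i j => (hp.meas_g i).comp (mx.prodMk (mζ i j))
  have hg' := fun i j => (hp.meas_g i).comp (my.prodMk (mζ i j))
  have hh := fun k j => (hp.meas_h k).comp (mx.prodMk (mξ k j))
  have hh' := fun k j => (hp.meas_h k).comp (my.prodMk (mξ k j))
  have hdg := fun i j => (hp.meas_dg i).comp (mx.prodMk (mζ i j))
  have hdh := fun k j => (hp.meas_dh k).comp (mx.prodMk (mξ k j))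
  have bg := fun i => measurable_batchMean (hg i)
  have bg' := fun i => measurable_batchMean (hg' i)
  have bh := fun k => measurable_batchMean (hh k)
  have bh' := fun k => measurable_batchMean (hh' k)
  have bdg := fun i => measurable_batchMean (hdg i)
  have bdh := fun k => measurable_batchMean (hdh k)
  have hG₁ : Measurable fun y : State d n m × Draw n m a.b₁ a.b₂ Z Ξ => p.G₁ a y.1 y.2 := by
    simp_rw [Problem.G₁_eq_sampledMean, sampledMean_eq_sum_univ]
    have key : ∀ i, Measurable fun y : State d n m × Draw n m a.b₁ a.b₂ Z Ξ =>
        if i ∈ y.2.1 then deriv (p.f i) (y.1.u₁ i) • batchMean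
          (fun j => p.dg i y.1.x (y.2.2.2.1 i j)) else 0 := fun i =>
      measurable_ite_mem mI (((measurable_deriv (p.f i)).comp (mu₁ i)).smul (bdg i))
        measurable_const i
    fun_prop
  have hG₂ : Measurable fun y : State d n m × Draw n m a.b₁ a.b₂ Z Ξ => p.G₂ a y.1 y.2 := by
    simp_rw [Problem.G₂_eq_sampledMean, sampledMean_eq_sum_univ]
    have key : ∀ k, Measurable fun y : State d n m × Draw n m a.b₁ a.b₂ Z Ξ =>
        if k ∈ y.2.2.1 then a.s (y.1.u₂ k) • batchMean
          (fun j => p.dh k y.1.x (y.2.2.2.2 k j)) else 0 := fun k =>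
      measurable_ite_mem mJ ((hs.comp (mu₂ k)).smul (bdh k)) measurable_const k
    fun_prop
  have hx : Measurable fun y : State d n m × Draw n m a.b₁ a.b₂ Z Ξ =>
      y.1.x - a.η • (p.G₁ a y.1 y.2 + p.G₂ a y.1 y.2) := by
    clear hdg hdh bdg bdh bg bg' bh bh' hg hg' hh hh'
    fun_prop
  refine measurable_comap_iff.2 (Measurable.prodMk ?_ (mx.prodMk (Measurable.prodMk ?_ ?_)))
  · exact hx
  · refine measurable_pi_iff.2 fun i => measurable_ite_mem mI ?_ (mu₁ i) i
    exact (((mu₁ i).const_mul _).add ((bg i).const_mul _)).add (((bg i).sub (bg' i)).const_mul _)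
  · refine measurable_pi_iff.2 fun k => measurable_ite_mem mJ ?_ (mu₂ k) k
    exact (((mu₂ k).const_mul _).add ((bh k).const_mul _)).add (((bh k).sub (bh' k)).const_mul _)

variable {x₀ : Vec d} {u₁ : Fin n → ℝ} {u₂ : Fin m → ℝ}

/-- The state at time `t` depends measurably on the draws before `t` only, which makes it
independent of draw `t`. -/
theorem Problem.Assumptions.exists_run_eq (hp : p.Assumptions C) (hs : Measurable a.s) (t : ℕ) :
    ∃ φ : ((i : Finset.range t) → Draw n m a.b₁ a.b₂ Z Ξ) → State d n m, Measurable φ ∧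
      ∀ w, p.run a x₀ u₁ u₂ w t = φ fun i => w i := by
  induction t with
  | zero => exact ⟨fun _ => ⟨x₀, x₀, u₁, u₂⟩, measurable_const, fun w => rfl⟩
  | succ t ih =>
    obtain ⟨φ, hφ, h⟩ := ih
    refine ⟨fun v => p.step a (φ fun i => v ⟨i, Finset.mem_range.2
      ((Finset.mem_range.1 i.2).trans t.lt_succ_self)⟩) (v ⟨t, Finset.self_mem_range_succ t⟩),
      ?_, fun w => ?_⟩
    · refine (hp.measurable_step hs).comp (Measurable.prodMk (hφ.comp ?_) (measurable_pi_apply _))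
      exact measurable_pi_iff.2 fun i => measurable_pi_apply _
    · rw [Problem.run, h]

theorem Problem.Assumptions.measurable_run (hp : p.Assumptions C) (hs : Measurable a.s) (t : ℕ) :
    Measurable fun w => p.run a x₀ u₁ u₂ w t := by
  obtain ⟨φ, hφ, h⟩ := hp.exists_run_eq (x₀ := x₀) (u₁ := u₁) (u₂ := u₂) hs t
  simp_rw [h]
  exact hφ.comp (measurable_pi_iff.2 fun i => measurable_pi_apply _)

variable {Ω : Type*} [MeasurableSpace Ω] {μ : Measure Ω} [IsProbabilityMeasure μ]
  {w : ℕ → Ω → Draw n m a.b₁ a.b₂ Z Ξ}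

/-- The Markov property of the iterates. -/
theorem Problem.Assumptions.lintegral_run_succ (hp : p.Assumptions C) (hs : Measurable a.s)
    (hw : ∀ t, Measurable (w t)) (hlaw : ∀ t, μ.map (w t) = p.drawLaw a.b a.c a.b₁ a.b₂)
    (hind : iIndepFun w μ) {ψ : State d n m → ENNReal} (hψ : Measurable ψ) (t : ℕ) :
    ∫⁻ ω, ψ (p.run a x₀ u₁ u₂ (fun t => w t ω) (t + 1)) ∂μ
      = ∫⁻ ω, ∫⁻ v, ψ (p.step a (p.run a x₀ u₁ u₂ (fun t => w t ω) t) v)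
        ∂p.drawLaw a.b a.c a.b₁ a.b₂ ∂μ := by
  obtain ⟨φ, hφ, h⟩ := hp.exists_run_eq (x₀ := x₀) (u₁ := u₁) (u₂ := u₂) hs t
  have hprob : IsProbabilityMeasure (p.drawLaw a.b a.c a.b₁ a.b₂) := by
    rw [← hlaw 0]; exact Measure.isProbabilityMeasure_map (hw 0).aemeasurable
  have h1 := hind.indepFun_finset (Finset.range t) {t} (by simp) hw
  have hX : Measurable fun ω => φ fun i : Finset.range t => w i ω :=
    hφ.comp (measurable_pi_iff.2 fun i => hw i)
  have h2 : IndepFun (fun ω => φ fun i : Finset.range t => w i ω) (w t) μ :=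
    h1.comp hφ (measurable_pi_apply (⟨t, Finset.mem_singleton_self t⟩ : ({t} : Finset ℕ)))
  rw [indepFun_iff_map_prod_eq_prod_map_map hX.aemeasurable (hw t).aemeasurable, hlaw] at h2
  have hm : Measurable fun y : State d n m × Draw n m a.b₁ a.b₂ Z Ξ => ψ (p.step a y.1 y.2) :=
    hψ.comp (hp.measurable_step hs)
  calc ∫⁻ ω, ψ (p.run a x₀ u₁ u₂ (fun t => w t ω) (t + 1)) ∂μ
      = ∫⁻ ω, ψ (p.step a (φ fun i : Finset.range t => w i ω) (w t ω)) ∂μ := by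
        simp_rw [Problem.run, h]
    _ = ∫⁻ y, ψ (p.step a y.1 y.2) ∂(μ.map fun ω => φ fun i : Finset.range t => w i ω).prod
          (p.drawLaw a.b a.c a.b₁ a.b₂) := by
        rw [← h2, lintegral_map hm (hX.prodMk (hw t))]
    _ = _ := by
        rw [lintegral_prod _ hm.aemeasurable, lintegral_map hm.lintegral_prod_right' hX]
        simp_rw [h]

theorem lintegral_uniformOn_Icc (T : ℕ) (f : ℕ → ENNReal) :
    ∫⁻ t, f t ∂uniformOn (Set.Icc 1 T) = (T : ENNReal)⁻¹ * ∑ t ∈ Finset.Icc 1 T, f t := by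
  unfold uniformOn ProbabilityTheory.cond
  rw [lintegral_smul_measure, ← Finset.coe_Icc, Measure.count_apply_finset, lintegral_finset]
  simp

/-- Expectations at a random time which is uniform and independent of the draws. -/
theorem lintegral_uniform_time {Y : Type*} [MeasurableSpace Y] {τ : Ω → ℕ} {X : Ω → Y} {T : ℕ}
    (hτ : Measurable τ) (hX : Measurable X)
    (hτlaw : μ.map τ = uniformOn (Set.Icc 1 T)) (hind : IndepFun τ X μ)
    {f : ℕ → Y → ENNReal} (hf : ∀ t, Measurable (f t)) :
    ∫⁻ ω, f (τ ω) (X ω) ∂μ = (T : ENNReal)⁻¹ * ∑ t ∈ Finset.Icc 1 T, ∫⁻ ω, f t (X ω) ∂μ := by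
  have hm : Measurable fun y : ℕ × Y => f y.1 y.2 := measurable_from_prod_countable_right hf
  have h1 := (indepFun_iff_map_prod_eq_prod_map_map hτ.aemeasurable hX.aemeasurable).1 hind
  have : IsProbabilityMeasure (μ.map X) := Measure.isProbabilityMeasure_map hX.aemeasurable
  have h2 : ∫⁻ ω, f (τ ω) (X ω) ∂μ = ∫⁻ y, f y.1 y.2 ∂μ.map fun ω => (τ ω, X ω) :=
    (lintegral_map hm (hτ.prodMk hX)).symm
  rw [h2, h1, lintegral_prod _ hm.aemeasurable, hτlaw, lintegral_uniformOn_Icc T]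
  simp_rw [lintegral_map (hf _) hX]

end Measurability

/-! ### Bounds along the run -/

section Errors

variable {d n m : ℕ} {Z Ξ : Type*} [MeasurableSpace Z] [MeasurableSpace Ξ]
  {p : Problem d n m Z Ξ} {C : Constants} {a : Params}

/-- The mean-square error of the estimators of the `g_i`, relative to the shifts `e_i`. -/
noncomputable def Problem.errG (p : Problem d n m Z Ξ) (e : Fin n → ℝ) (S : State d n m) : ℝ :=
  1 / (n : ℝ) * ∑ i, (S.u₁ i - p.gMean i S.xPrev - e i) ^ 2

/-- The mean-square error of the estimators of the `h_k`. -/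
noncomputable def Problem.errH (p : Problem d n m Z Ξ) (S : State d n m) : ℝ :=
  1 / (m : ℝ) * ∑ k, (S.u₂ k - p.hMean k S.xPrev) ^ 2

theorem Problem.Assumptions.measurable_errG (hp : p.Assumptions C) (e : Fin n → ℝ) :
    Measurable (p.errG e) := by
  have h1 := fun i => State.measurable_u₁ (d := d) (m := m) (i : Fin n)
  have h2 := fun i => (hp.g_lipschitz i).continuous.measurable.comp
    (State.measurable_xPrev (n := n) (m := m))
  simp only [Function.comp_def] at h2
  unfold Problem.errG
  fun_prop

theorem Problem.Assumptions.measurable_errH (hp : p.Assumptions C) : Measurable p.errH := by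
  have h1 := fun k => State.measurable_u₂ (d := d) (n := n) (k : Fin m)
  have h2 := fun k => (hp.h_lipschitz k).continuous.measurable.comp
    (State.measurable_xPrev (n := n) (m := m))
  simp only [Function.comp_def] at h2
  unfold Problem.errH
  fun_prop

theorem State.measurable_norm_sub_sq : Measurable fun S : State d n m => ‖S.x - S.xPrev‖ ^ 2 :=
  (State.measurable_x.sub State.measurable_xPrev).norm.pow_const 2

section Step

variable (hp : p.Assumptions C) (ha : a.Valid n m) (S : State d n m)
include hp ha

theorem Problem.Assumptions.lintegral_errG_step_le (hγ0 : 0 ≤ a.γ₁) (hγ1 : a.γ₁ ≤ 1 / 2)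
    (e : Fin n → ℝ) :
    ∫⁻ w, ENNReal.ofReal (p.errG ((1 - (a.b : ℝ) / n * a.γ₁) • e) (p.step a S w))
        ∂p.drawLaw a.b a.c a.b₁ a.b₂
      ≤ ENNReal.ofReal ((1 - (a.b : ℝ) / n * a.γ₁) * p.errG e S
        + 32 / ((a.b : ℝ) / n) * (C.L_g ^ 2 * ‖S.x - S.xPrev‖ ^ 2)
        + 2 * ((a.b : ℝ) / n) * a.γ₁ ^ 2 * C.σ_g ^ 2 / a.b₁
        + 3 * ((a.b : ℝ) / n) * a.γ₁ ^ 2 * (1 / (n : ℝ) * ∑ i, e i ^ 2)) := by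
  have := hp.probP
  have := hp.probQ
  obtain ⟨h1, h2⟩ := (p.isSampler_fst (b₁ := a.b₁) (b₂ := a.b₂) ha.b_le
    ha.c_le).integral_average_msvrUpdate_sq_le ha.one_le_b ha.b_le ha.one_le_b₁ hp.isOracle_g
    hγ0 hγ1 S.x S.xPrev S.u₁ e
  refine le_trans (le_of_eq ?_) (ENNReal.ofReal_le_ofReal h2)
  rw [ofReal_integral_eq_lintegral_ofReal h1 (Filter.Eventually.of_forall fun w => by positivity)]
  rfl

theorem Problem.Assumptions.lintegral_errH_step_le (hγ0 : 0 ≤ a.γ₂) (hγ1 : a.γ₂ ≤ 1 / 2) :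
    ∫⁻ w, ENNReal.ofReal (p.errH (p.step a S w)) ∂p.drawLaw a.b a.c a.b₁ a.b₂
      ≤ ENNReal.ofReal ((1 - (a.c : ℝ) / m * a.γ₂) * p.errH S
        + 32 / ((a.c : ℝ) / m) * (C.L_h ^ 2 * ‖S.x - S.xPrev‖ ^ 2)
        + 2 * ((a.c : ℝ) / m) * a.γ₂ ^ 2 * C.σ_h ^ 2 / a.b₂) := by
  have := hp.probP
  have := hp.probQ
  obtain ⟨h1, h2⟩ := (p.isSampler_snd (b₁ := a.b₁) (b₂ := a.b₂) ha.b_le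
    ha.c_le).integral_average_msvrUpdate_sq_le ha.one_le_c ha.c_le ha.one_le_b₂ hp.isOracle_h
    hγ0 hγ1 S.x S.xPrev S.u₂ 0
  simp only [Pi.zero_apply, mul_zero, sub_zero, ne_eq, OfNat.ofNat_ne_zero, not_false_eq_true,
    zero_pow, Finset.sum_const_zero, add_zero] at h1 h2
  refine le_trans (le_of_eq ?_) (ENNReal.ofReal_le_ofReal h2)
  rw [ofReal_integral_eq_lintegral_ofReal h1 (Filter.Eventually.of_forall fun w => by positivity)]
  rfl

-- After `t` iterations the estimators track the inner functions at `x_{t-1}`, whereas the direction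
-- is computed at `x_t`; the mismatch is paid by one increment.
omit ha in
theorem Problem.Assumptions.average_sub_sq_le (e : Fin n → ℝ) :
    1 / (n : ℝ) * ∑ i, (S.u₁ i - p.gMean i S.x - e i) ^ 2
      ≤ 2 * p.errG e S + 2 * C.L_g ^ 2 * ‖S.x - S.xPrev‖ ^ 2 := by
  have h1 : ∀ i, (S.u₁ i - p.gMean i S.x - e i) ^ 2
      ≤ 2 * (S.u₁ i - p.gMean i S.xPrev - e i) ^ 2 + 2 * C.L_g ^ 2 * ‖S.x - S.xPrev‖ ^ 2 := by
    intro i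
    have := hp.probP
    have h2 := (hp.isOracle_g i).mean_sub_sq_le S.x S.xPrev
    change (p.gMean i S.x - p.gMean i S.xPrev) ^ 2 ≤ _ at h2
    nlinarith [sq_nonneg ((S.u₁ i - p.gMean i S.xPrev - e i)
      + (p.gMean i S.x - p.gMean i S.xPrev))]
  refine (mul_le_mul_of_nonneg_left (Finset.sum_le_sum fun i _ => h1 i)
    (by positivity)).trans ?_
  rw [Finset.sum_add_distrib, ← Finset.mul_sum, Finset.sum_const, Finset.card_univ,
    Fintype.card_fin, nsmul_eq_mul, mul_add, ← mul_assoc _ (n : ℝ), Problem.errG]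
  have h3 : 1 / (n : ℝ) * n ≤ 1 := by
    rw [one_div]; exact inv_mul_le_one
  have h4 : 0 ≤ 2 * (C.L_g : ℝ) ^ 2 * ‖S.x - S.xPrev‖ ^ 2 := by positivity
  nlinarith

-- Young's inequality in place of a square root: if the mean square is at most `θ ^ 2`, then `r² /
-- (2 θ) + θ / 2` has mean at most `θ`. The level `θ` may thus be chosen separately at every time.
omit ha in
theorem Problem.Assumptions.average_abs_sub_le {θ τ : ℝ} (hθ : 0 < θ) (hτ : 0 < τ) :
    1 / (m : ℝ) * ∑ k, |S.u₂ k - p.hMean k S.x|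
      ≤ 1 / (2 * θ) * p.errH S + C.L_h / (2 * τ) * ‖S.x - S.xPrev‖ ^ 2
        + (θ / 2 + C.L_h * τ / 2) := by
  have young : ∀ {r s : ℝ}, 0 < s → |r| ≤ 1 / (2 * s) * r ^ 2 + s / 2 := by
    intro r s hs
    have : 1 / (2 * s) * r ^ 2 + s / 2 = (|r| ^ 2 + s ^ 2) / (2 * s) := by
      rw [sq_abs]; field_simp
    rw [this, le_div_iff₀ (by positivity)]
    nlinarith [sq_nonneg (|r| - s)]
  have h1 : ∀ k, |S.u₂ k - p.hMean k S.x| ≤ 1 / (2 * θ) * (S.u₂ k - p.hMean k S.xPrev) ^ 2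
      + (C.L_h / (2 * τ) * ‖S.x - S.xPrev‖ ^ 2 + (θ / 2 + C.L_h * τ / 2)) := by
    intro k
    have h2 := (hp.h_lipschitz k).dist_le_mul S.x S.xPrev
    rw [Real.dist_eq, dist_eq_norm] at h2
    have h3 := young (r := S.u₂ k - p.hMean k S.xPrev) hθ
    have h4 := mul_le_mul_of_nonneg_left (young (r := ‖S.x - S.xPrev‖) hτ) C.L_h.2
    rw [abs_of_nonneg (norm_nonneg _)] at h4
    have h5 : |S.u₂ k - p.hMean k S.x| ≤ |S.u₂ k - p.hMean k S.xPrev|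
        + |p.hMean k S.x - p.hMean k S.xPrev| := by
      rw [abs_sub_comm (p.hMean k S.x)]
      exact abs_sub_le _ _ _
    have h6 : C.L_h * (1 / (2 * τ) * ‖S.x - S.xPrev‖ ^ 2 + τ / 2)
        = C.L_h / (2 * τ) * ‖S.x - S.xPrev‖ ^ 2 + C.L_h * τ / 2 := by ring
    simp only [NNReal.val_eq_coe] at h4
    linarith
  refine (mul_le_mul_of_nonneg_left (Finset.sum_le_sum fun k _ => h1 k)
    (by positivity)).trans ?_
  rw [Finset.sum_add_distrib, ← Finset.mul_sum, Finset.sum_const, Finset.card_univ,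
    Fintype.card_fin, nsmul_eq_mul, mul_add, ← mul_assoc _ (m : ℝ), Problem.errH]
  have h3 : 1 / (m : ℝ) * m ≤ 1 := by
    rw [one_div]; exact inv_mul_le_one
  have h4 : 0 ≤ C.L_h / (2 * τ) * ‖S.x - S.xPrev‖ ^ 2 + (θ / 2 + C.L_h * τ / 2) := by positivity
  nlinarith

end Step

/-- Expectations along the run are taken as integrals of nonnegative extended reals, so that no
integrability has to be propagated through the iterations. -/
theorem lintegral_ofReal_linear_le {Ω : Type*} [MeasurableSpace Ω] {μ : Measure Ω}
    [IsProbabilityMeasure μ] {f g : Ω → ℝ} (hg : Measurable g)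
    {α β c F G : ℝ} (hα : 0 ≤ α) (hβ : 0 ≤ β) (hc : 0 ≤ c) (hF : 0 ≤ F) (hG : 0 ≤ G)
    (h1 : ∫⁻ ω, ENNReal.ofReal (f ω) ∂μ ≤ ENNReal.ofReal F)
    (h2 : ∫⁻ ω, ENNReal.ofReal (g ω) ∂μ ≤ ENNReal.ofReal G) :
    ∫⁻ ω, ENNReal.ofReal (α * f ω + β * g ω + c) ∂μ ≤ ENNReal.ofReal (α * F + β * G + c) := by
  calc ∫⁻ ω, ENNReal.ofReal (α * f ω + β * g ω + c) ∂μ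
      ≤ ∫⁻ ω, (ENNReal.ofReal α * ENNReal.ofReal (f ω) + ENNReal.ofReal β * ENNReal.ofReal (g ω)
          + ENNReal.ofReal c) ∂μ := by
        refine lintegral_mono fun ω => ?_
        rw [← ENNReal.ofReal_mul hα, ← ENNReal.ofReal_mul hβ]
        exact ENNReal.ofReal_add_le.trans (add_le_add_left ENNReal.ofReal_add_le _)
    _ = ENNReal.ofReal α * ∫⁻ ω, ENNReal.ofReal (f ω) ∂μ
          + ENNReal.ofReal β * ∫⁻ ω, ENNReal.ofReal (g ω) ∂μ + ENNReal.ofReal c := by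
        rw [lintegral_add_right _ measurable_const, lintegral_add_right _ (by fun_prop),
          lintegral_const_mul' _ _ ENNReal.ofReal_ne_top,
          lintegral_const_mul' _ _ ENNReal.ofReal_ne_top]
        simp
    _ ≤ ENNReal.ofReal α * ENNReal.ofReal F + ENNReal.ofReal β * ENNReal.ofReal G
          + ENNReal.ofReal c := by gcongr
    _ = _ := by
        rw [ENNReal.ofReal_add (by positivity) hc, ENNReal.ofReal_add (by positivity)
          (by positivity), ENNReal.ofReal_mul hα, ENNReal.ofReal_mul hβ]

end Errors

/-! ### Error recursions along the iterates -/

section Run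

variable {d n m : ℕ} {Z Ξ : Type*} [MeasurableSpace Z] [MeasurableSpace Ξ]
  {p : Problem d n m Z Ξ} {C : Constants} {a : Params} {x₀ : Vec d} {u₁ : Fin n → ℝ}
  {u₂ : Fin m → ℝ} {Ω : Type*} [MeasurableSpace Ω] {μ : Measure Ω}
  {w : ℕ → Ω → Draw n m a.b₁ a.b₂ Z Ξ}

/-- The draws are independent and have the law prescribed by the problem. -/
structure IsDrawSequence (p : Problem d n m Z Ξ) (a : Params) (μ : Measure Ω)
    (w : ℕ → Ω → Draw n m a.b₁ a.b₂ Z Ξ) : Prop where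
  meas : ∀ t, Measurable (w t)
  law : ∀ t, μ.map (w t) = p.drawLaw a.b a.c a.b₁ a.b₂
  indep : iIndepFun w μ

/-- The state of the run after `t` iterations. -/
noncomputable def Problem.iterate (p : Problem d n m Z Ξ) (a : Params) (x₀ : Vec d) (u₁ : Fin n → ℝ)
    (u₂ : Fin m → ℝ) (w : ℕ → Ω → Draw n m a.b₁ a.b₂ Z Ξ) (t : ℕ) (ω : Ω) : State d n m :=
  p.run a x₀ u₁ u₂ (fun t => w t ω) t

variable [IsProbabilityMeasure μ] (hp : p.Assumptions C) (ha : a.Valid n m)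
  (hw : IsDrawSequence p a μ w)
include hp ha hw

omit [IsProbabilityMeasure μ] in
theorem Problem.Assumptions.measurable_iterate (t : ℕ) :
    Measurable (p.iterate a x₀ u₁ u₂ w t) :=
  (hp.measurable_run (measurable_hinge_subgradient ha.s_mem) t).comp
    (measurable_pi_iff.2 hw.meas)

theorem Problem.Assumptions.lintegral_iterate_succ_add_le {ψ κ c : State d n m → ENNReal}
    (hψ : Measurable ψ) (hc : Measurable c)
    (h : ∀ S, ∫⁻ v, ψ (p.step a S v) ∂p.drawLaw a.b a.c a.b₁ a.b₂ + c S ≤ κ S) (t : ℕ) :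
    ∫⁻ ω, ψ (p.iterate a x₀ u₁ u₂ w (t + 1) ω) ∂μ + ∫⁻ ω, c (p.iterate a x₀ u₁ u₂ w t ω) ∂μ
      ≤ ∫⁻ ω, κ (p.iterate a x₀ u₁ u₂ w t ω) ∂μ := by
  have h1 := hp.lintegral_run_succ (x₀ := x₀) (u₁ := u₁) (u₂ := u₂)
    (measurable_hinge_subgradient ha.s_mem) hw.meas hw.law hw.indep hψ t
  have h2 : Measurable fun ω => c (p.iterate a x₀ u₁ u₂ w t ω) :=
    hc.comp (hp.measurable_iterate ha hw t)
  unfold Problem.iterate at h2 ⊢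
  rw [h1, ← lintegral_add_right _ h2]
  exact lintegral_mono fun ω => h _

theorem Problem.Assumptions.lintegral_iterate_succ_le {ψ κ : State d n m → ENNReal}
    (hψ : Measurable ψ)
    (h : ∀ S, ∫⁻ v, ψ (p.step a S v) ∂p.drawLaw a.b a.c a.b₁ a.b₂ ≤ κ S) (t : ℕ) :
    ∫⁻ ω, ψ (p.iterate a x₀ u₁ u₂ w (t + 1) ω) ∂μ
      ≤ ∫⁻ ω, κ (p.iterate a x₀ u₁ u₂ w t ω) ∂μ := by
  simpa using hp.lintegral_iterate_succ_add_le (x₀ := x₀) (u₁ := u₁) (u₂ := u₂) ha hw hψ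
    (c := fun _ => 0) measurable_const (κ := κ) (by simpa using h) t

theorem Problem.Assumptions.lintegral_increment_le (t : ℕ) :
    ∫⁻ ω, ENNReal.ofReal (‖(p.iterate a x₀ u₁ u₂ w t ω).x
      - (p.iterate a x₀ u₁ u₂ w t ω).xPrev‖ ^ 2) ∂μ
      ≤ ENNReal.ofReal (a.η ^ 2 * C.gradSq d a.β) := by
  cases t with
  | zero => simp [Problem.iterate, Problem.run]
  | succ t =>
    have h1 := hp.lintegral_iterate_succ_le (x₀ := x₀) (u₁ := u₁) (u₂ := u₂) ha hw
      (ψ := fun S => ENNReal.ofReal (‖S.x - S.xPrev‖ ^ 2))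
      (State.measurable_norm_sub_sq.ennreal_ofReal)
      (κ := fun _ => ENNReal.ofReal (a.η ^ 2 * C.gradSq d a.β))
      (fun S => hp.lintegral_norm_step_sub_sq_le ha S) t
    simpa using h1

omit [IsProbabilityMeasure μ] hp ha hw in
theorem Constants.gradSq_nonneg (C : Constants) (d : ℕ) (β : ℝ) : 0 ≤ C.gradSq d β := by
  unfold Constants.gradSq; positivity

/-- The constant part is the fixed point of the affine one-step recursion, and the initial error
decays geometrically. -/
theorem Problem.Assumptions.lintegral_errH_iterate_le (hγ0 : 0 < a.γ₂) (hγ1 : a.γ₂ ≤ 1 / 2)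
    {D : ℝ} (hD : 1 / (m : ℝ) * ∑ k, (u₂ k - p.hMean k x₀) ^ 2 ≤ D ^ 2) (t : ℕ) :
    ∫⁻ ω, ENNReal.ofReal (p.errH (p.iterate a x₀ u₁ u₂ w t ω)) ∂μ
      ≤ ENNReal.ofReal ((1 - (a.c : ℝ) / m * a.γ₂) ^ t * D ^ 2
        + (32 * C.L_h ^ 2 * (a.η ^ 2 * C.gradSq d a.β) / (((a.c : ℝ) / m) ^ 2 * a.γ₂)
          + 2 * a.γ₂ * C.σ_h ^ 2 / a.b₂)) := by
  have hc0 : (0 : ℝ) < a.c := by exact_mod_cast ha.one_le_c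
  have hm0 : (0 : ℝ) < m := by exact_mod_cast ha.one_le_c.trans ha.c_le
  have hb0 : (0 : ℝ) < a.b₂ := by exact_mod_cast ha.one_le_b₂
  have hq1 : (a.c : ℝ) / m ≤ 1 := by rw [div_le_one hm0]; exact_mod_cast ha.c_le
  have hstep := hp.lintegral_errH_step_le ha
  set M := a.η ^ 2 * C.gradSq d a.β with hM
  have hM0 : 0 ≤ M := mul_nonneg (sq_nonneg _) (C.gradSq_nonneg d a.β)
  set q := (a.c : ℝ) / m with hq
  have hq0 : 0 < q := by positivity
  have hqγ : 0 ≤ 1 - q * a.γ₂ := by nlinarith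
  set s := 32 * C.L_h ^ 2 * M / (q ^ 2 * a.γ₂) + 2 * a.γ₂ * C.σ_h ^ 2 / a.b₂ with hs
  have hs0 : 0 ≤ s := by positivity
  induction t with
  | zero =>
    simp only [Problem.iterate, Problem.run, Problem.errH, lintegral_const, measure_univ, mul_one,
      pow_zero, one_mul]
    exact ENNReal.ofReal_le_ofReal (by linarith)
  | succ t ih =>
    have h1 := hp.lintegral_iterate_succ_le (x₀ := x₀) (u₁ := u₁) (u₂ := u₂) ha hw
      (ψ := fun S => ENNReal.ofReal (p.errH S)) hp.measurable_errH.ennreal_ofReal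
      (fun S => hstep S hγ0.le hγ1) t
    refine h1.trans ?_
    have h2 := lintegral_ofReal_linear_le (μ := μ)
      (f := fun ω => p.errH (p.iterate a x₀ u₁ u₂ w t ω))
      (g := fun ω => ‖(p.iterate a x₀ u₁ u₂ w t ω).x - (p.iterate a x₀ u₁ u₂ w t ω).xPrev‖ ^ 2)
      (State.measurable_norm_sub_sq.comp (hp.measurable_iterate ha hw t))
      (α := 1 - q * a.γ₂) (β := 32 / q * C.L_h ^ 2) (c := 2 * q * a.γ₂ ^ 2 * C.σ_h ^ 2 / a.b₂)
      hqγ (by positivity) (by positivity) (by positivity) hM0 ih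
      (hp.lintegral_increment_le ha hw t)
    simp only [← mul_assoc] at h2 ⊢
    refine h2.trans (ENNReal.ofReal_le_ofReal (le_of_eq ?_))
    rw [hs]
    field_simp
    ring

/-- The shift of the inner functions at time `t`. -/
noncomputable def shiftAt (q : ℝ) (e : Fin n → ℝ) (t : ℕ) : Fin n → ℝ := q ^ t • e

/-- Relative to the shift the error starts at zero. The shift feeds in `3 r γ² q^{2t} D²` per step,
with `r` the sampling fraction. The profile `q^t (1 - q^t)` solves the recursion with input `q^{2t}
q (1 - q)`, and `1 - q = r γ` together with `q ≥ 1 / 2` gives the prefactor `6 γ D²`. Summed over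
time this part is at most `6 D² / r`, without a factor `1 / γ`. -/
theorem Problem.Assumptions.lintegral_errG_iterate_le (hγ0 : 0 < a.γ₁) (hγ1 : a.γ₁ ≤ 1 / 2)
    {D : ℝ} (hD : 1 / (n : ℝ) * ∑ i, (u₁ i - p.gMean i x₀) ^ 2 ≤ D ^ 2) (t : ℕ) :
    ∫⁻ ω, ENNReal.ofReal (p.errG (shiftAt (1 - (a.b : ℝ) / n * a.γ₁)
        (fun i => u₁ i - p.gMean i x₀) t) (p.iterate a x₀ u₁ u₂ w t ω)) ∂μ
      ≤ ENNReal.ofReal (6 * a.γ₁ * D ^ 2 * ((1 - (a.b : ℝ) / n * a.γ₁) ^ t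
          * (1 - (1 - (a.b : ℝ) / n * a.γ₁) ^ t))
        + (32 * C.L_g ^ 2 * (a.η ^ 2 * C.gradSq d a.β) / (((a.b : ℝ) / n) ^ 2 * a.γ₁)
          + 2 * a.γ₁ * C.σ_g ^ 2 / a.b₁)) := by
  have hc0 : (0 : ℝ) < a.b := by exact_mod_cast ha.one_le_b
  have hm0 : (0 : ℝ) < n := by exact_mod_cast ha.one_le_b.trans ha.b_le
  have hb0 : (0 : ℝ) < a.b₁ := by exact_mod_cast ha.one_le_b₁
  have hq1 : (a.b : ℝ) / n ≤ 1 := by rw [div_le_one hm0]; exact_mod_cast ha.b_le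
  have hstep := hp.lintegral_errG_step_le ha
  set M := a.η ^ 2 * C.gradSq d a.β with hM
  have hM0 : 0 ≤ M := mul_nonneg (sq_nonneg _) (C.gradSq_nonneg d a.β)
  set r := (a.b : ℝ) / n with hr
  have hr0 : 0 < r := by positivity
  have hrγ : r * a.γ₁ ≤ 1 / 2 := by nlinarith
  set q := 1 - r * a.γ₁ with hq
  have hq0 : 1 / 2 ≤ q := by linarith
  have hq1' : q ≤ 1 := by rw [hq]; nlinarith
  set s := 32 * C.L_g ^ 2 * M / (r ^ 2 * a.γ₁) + 2 * a.γ₁ * C.σ_g ^ 2 / a.b₁ with hs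
  have hs0 : 0 ≤ s := by positivity
  set e₀ : Fin n → ℝ := fun i => u₁ i - p.gMean i x₀ with he₀
  induction t with
  | zero =>
    have : p.errG (shiftAt q e₀ 0) ⟨x₀, x₀, u₁, u₂⟩ = 0 := by
      simp [Problem.errG, shiftAt, he₀]
    simp [Problem.iterate, Problem.run, this]
  | succ t ih =>
    have hsh : shiftAt q e₀ (t + 1) = q • shiftAt q e₀ t := by
      unfold shiftAt; rw [smul_smul, pow_succ']
    rw [hsh]
    have h1 := hp.lintegral_iterate_succ_le (x₀ := x₀) (u₁ := u₁) (u₂ := u₂) ha hw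
      (ψ := fun S => ENNReal.ofReal (p.errG (q • shiftAt q e₀ t) S))
      (hp.measurable_errG _).ennreal_ofReal
      (fun S => hstep S hγ0.le hγ1 (shiftAt q e₀ t)) t
    refine h1.trans ?_
    have hqt : q ^ t ≤ 1 := pow_le_one₀ (by linarith) hq1'
    have hqt0 : 0 < q ^ t := pow_pos (by linarith) t
    have h2 := lintegral_ofReal_linear_le (μ := μ)
      (f := fun ω => p.errG (shiftAt q e₀ t) (p.iterate a x₀ u₁ u₂ w t ω))
      (g := fun ω => ‖(p.iterate a x₀ u₁ u₂ w t ω).x - (p.iterate a x₀ u₁ u₂ w t ω).xPrev‖ ^ 2)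
      (State.measurable_norm_sub_sq.comp (hp.measurable_iterate ha hw t))
      (α := q) (β := 32 / r * C.L_g ^ 2) (c := 2 * r * a.γ₁ ^ 2 * C.σ_g ^ 2 / a.b₁
        + 3 * r * a.γ₁ ^ 2 * (1 / (n : ℝ) * ∑ i, shiftAt q e₀ t i ^ 2))
      (by linarith) (by positivity) (by positivity)
      (add_nonneg (mul_nonneg (by positivity) (mul_nonneg hqt0.le (by linarith))) hs0) hM0 ih
      (hp.lintegral_increment_le ha hw t)
    have h3 : ∀ S : State d n m, q * p.errG (shiftAt q e₀ t) S
        + 32 / r * (C.L_g ^ 2 * ‖S.x - S.xPrev‖ ^ 2) + 2 * r * a.γ₁ ^ 2 * C.σ_g ^ 2 / a.b₁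
        + 3 * r * a.γ₁ ^ 2 * (1 / (n : ℝ) * ∑ i, shiftAt q e₀ t i ^ 2)
        = q * p.errG (shiftAt q e₀ t) S + 32 / r * C.L_g ^ 2 * ‖S.x - S.xPrev‖ ^ 2
          + (2 * r * a.γ₁ ^ 2 * C.σ_g ^ 2 / a.b₁
            + 3 * r * a.γ₁ ^ 2 * (1 / (n : ℝ) * ∑ i, shiftAt q e₀ t i ^ 2)) := fun S => by ring
    simp only [h3]
    refine h2.trans (ENNReal.ofReal_le_ofReal ?_)
    have h4 : 1 / (n : ℝ) * ∑ i, shiftAt q e₀ t i ^ 2 ≤ (q ^ t) ^ 2 * D ^ 2 := by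
      have : ∑ i, shiftAt q e₀ t i ^ 2 = (q ^ t) ^ 2 * ∑ i, e₀ i ^ 2 := by
        rw [Finset.mul_sum]
        refine Finset.sum_congr rfl fun i _ => ?_
        simp [shiftAt, mul_pow]
      rw [this, mul_left_comm]
      gcongr
    have h5 : 3 * r * a.γ₁ ^ 2 * (1 / (n : ℝ) * ∑ i, shiftAt q e₀ t i ^ 2)
        ≤ 3 * r * a.γ₁ ^ 2 * ((q ^ t) ^ 2 * D ^ 2) := by gcongr
    have h6 : s = q * s + 32 / r * C.L_g ^ 2 * M + 2 * r * a.γ₁ ^ 2 * C.σ_g ^ 2 / a.b₁ := by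
      rw [hs, hq]; field_simp; ring
    have h7 : 3 * r * a.γ₁ ^ 2 * ((q ^ t) ^ 2 * D ^ 2)
        ≤ 6 * a.γ₁ * D ^ 2 * ((q ^ t) ^ 2 * q * (r * a.γ₁)) := by
      have : 0 ≤ 3 * r * a.γ₁ ^ 2 * ((q ^ t) ^ 2 * D ^ 2) := by positivity
      nlinarith
    have h8 : 6 * a.γ₁ * D ^ 2 * (q ^ (t + 1) * (1 - q ^ (t + 1)))
        = q * (6 * a.γ₁ * D ^ 2 * (q ^ t * (1 - q ^ t)))
          + 6 * a.γ₁ * D ^ 2 * ((q ^ t) ^ 2 * q * (r * a.γ₁)) := by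
      rw [show r * a.γ₁ = 1 - q by rw [hq]; ring]; ring
    linarith

end Run

/-! ### The sum of the expected gradient norms -/

section GradientSum

theorem average_abs_le_of_average_sq_le {N : ℕ} {e : Fin N → ℝ} {D : ℝ} (hD : 0 ≤ D)
    (h : 1 / (N : ℝ) * ∑ i, e i ^ 2 ≤ D ^ 2) : 1 / (N : ℝ) * ∑ i, |e i| ≤ D := by
  rcases Nat.eq_zero_or_pos N with rfl | hN
  · simpa using hD
  have hN' : (0 : ℝ) < N := by exact_mod_cast hN
  refine le_of_abs_le (abs_le_of_sq_le_sq ?_ hD)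
  have h1 := sq_sum_le_card_mul_sum_sq (s := Finset.univ) (f := fun i => |e i|)
  simp only [sq_abs, Finset.card_univ, Fintype.card_fin] at h1
  calc (1 / (N : ℝ) * ∑ i, |e i|) ^ 2 = (1 / (N : ℝ)) ^ 2 * (∑ i, |e i|) ^ 2 := by ring
    _ ≤ (1 / (N : ℝ)) ^ 2 * (N * ∑ i, e i ^ 2) := by gcongr
    _ = 1 / (N : ℝ) * ∑ i, e i ^ 2 := by field_simp
    _ ≤ D ^ 2 := h

theorem average_abs_smul {N : ℕ} (c : ℝ) (e : Fin N → ℝ) :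
    1 / (N : ℝ) * ∑ i, |(c • e) i| = |c| * (1 / (N : ℝ) * ∑ i, |e i|) := by
  simp only [Pi.smul_apply, smul_eq_mul, abs_mul, ← Finset.mul_sum]
  ring

theorem sum_range_pow_le {q : ℝ} (h0 : 0 ≤ q) (h1 : q < 1) (T : ℕ) :
    ∑ t ∈ Finset.range T, q ^ t ≤ 1 / (1 - q) := by
  rw [one_div]
  exact (summable_geometric_of_lt_one h0 h1).sum_le_tsum _ (fun _ _ => pow_nonneg h0 _)
    |>.trans_eq (tsum_geometric_of_lt_one h0 h1)

/-- From `1 - q = (1 - √q) (1 + √q) ≤ 2 (1 - √q)`. Square roots occur because the error of `u₂`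
enters linearly. -/
theorem sum_range_sqrt_pow_le {q : ℝ} (h0 : 0 ≤ q) (h1 : q < 1) (T : ℕ) :
    ∑ t ∈ Finset.range T, √q ^ t ≤ 2 / (1 - q) := by
  have h2 : √q < 1 := by rw [Real.sqrt_lt' one_pos]; simpa using h1
  refine (sum_range_pow_le (Real.sqrt_nonneg q) h2 T).trans ?_
  rw [div_le_div_iff₀ (by linarith) (by linarith)]
  nlinarith [Real.sq_sqrt h0, Real.sqrt_nonneg q]

theorem sum_drift_le {q₁ q₂ A D c₁ σ X c₂ κ s Y W : ℝ} (hq₁ : 0 ≤ q₁) (hq₁' : q₁ < 1)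
    (hq₂ : 0 ≤ q₂) (hq₂' : q₂ < 1) (hA : 0 ≤ A) (hD : 0 ≤ D) (hc₁ : 0 ≤ c₁) (hc₂ : 0 ≤ c₂)
    (hκ : 0 ≤ κ) (T : ℕ) :
    ∑ t ∈ Finset.range T, (A * ((q₁ ^ t - q₁ ^ (t + 1)) * D)
        + c₁ * (√q₂ ^ t * (D + 1) + σ + X) + c₂ * (2 * (κ * q₁ ^ t + s) + Y) + W)
      ≤ A * D + c₁ * ((D + 1) * (2 / (1 - q₂)) + T * σ + T * X)
        + c₂ * (2 * (κ / (1 - q₁) + T * s) + T * Y) + T * W := by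
  have s1 : (∑ t ∈ Finset.range T, (q₁ ^ t - q₁ ^ (t + 1))) * D ≤ 1 * D := by
    rw [Finset.sum_range_sub']
    have := pow_nonneg hq₁ T
    gcongr
    simpa using this
  have s2 := sum_range_sqrt_pow_le hq₂ hq₂' T
  have s3 := sum_range_pow_le hq₁ hq₁' T
  simp only [Finset.sum_add_distrib, ← Finset.mul_sum, ← Finset.sum_mul, Finset.sum_const,
    Finset.card_range, nsmul_eq_mul]
  have t1 := mul_le_mul_of_nonneg_left s1 hA
  have t2 := mul_le_mul_of_nonneg_left (mul_le_mul_of_nonneg_left s2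
    (by positivity : 0 ≤ D + 1)) hc₁
  have t3 := mul_le_mul_of_nonneg_left (mul_le_mul_of_nonneg_left s3 hκ) hc₂
  rw [mul_one_div] at t3
  linarith

variable {d n m : ℕ} {Z Ξ : Type*} [MeasurableSpace Z] [MeasurableSpace Ξ]
  {p : Problem d n m Z Ξ} {C : Constants} {a : Params} {x₀ : Vec d} {u₁ : Fin n → ℝ}
  {u₂ : Fin m → ℝ} {Ω : Type*} [MeasurableSpace Ω] {μ : Measure Ω}
  {w : ℕ → Ω → Draw n m a.b₁ a.b₂ Z Ξ}
  [IsProbabilityMeasure μ] (hp : p.Assumptions C) (ha : a.Valid n m)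
  (hw : IsDrawSequence p a μ w)
include hp ha hw

/-- The one-step decrease is averaged over the run. The error terms are bounded by their levels at
time `t`, the increments by the uniform second moment of the steps. -/
theorem Problem.Assumptions.lintegral_moreauEnvelope_iterate_succ_le {l : ℝ} (hl : 0 < l)
    (hρ : l * (C.rhoComp + a.β * C.ρ₁) ≤ 1 / 4) (hη : 0 ≤ a.η) {e e' : Fin n → ℝ} {B : ℝ}
    (hB : ∀ y, B ≤ p.shiftedPhi a.β e' y) {κ θ Y τ : ℝ}
    (hκ : 1 / (n : ℝ) * ∑ i, |e' i - e i| ≤ κ)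
    (hκ0 : 0 ≤ κ) (hθ : 0 < θ) (hY : 0 ≤ Y) (hτ : 0 < τ) {t : ℕ}
    (hH : ∫⁻ ω, ENNReal.ofReal (p.errH (p.iterate a x₀ u₁ u₂ w t ω)) ∂μ
      ≤ ENNReal.ofReal (θ ^ 2))
    (hG : ∫⁻ ω, ENNReal.ofReal (p.errG e (p.iterate a x₀ u₁ u₂ w t ω)) ∂μ ≤ ENNReal.ofReal Y) :
    ∫⁻ ω, ENNReal.ofReal (moreauEnvelope (p.shiftedPhi a.β e') l
        (p.iterate a x₀ u₁ u₂ w (t + 1) ω).x - B) ∂μ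
      + ∫⁻ ω, ENNReal.ofReal (a.η / 4 * ‖gradient (moreauEnvelope (p.shiftedPhi a.β e) l)
        (p.iterate a x₀ u₁ u₂ w t ω).x‖ ^ 2) ∂μ
      ≤ ∫⁻ ω, ENNReal.ofReal (moreauEnvelope (p.shiftedPhi a.β e) l
        (p.iterate a x₀ u₁ u₂ w t ω).x - B) ∂μ
        + ENNReal.ofReal (C.L_f * κ
          + 2 * a.β * a.η / l * (θ + C.L_h * (τ / 2
            + a.η ^ 2 * C.gradSq d a.β / (2 * τ)))
          + 2 * a.η * (C.L_df * C.L_g) ^ 2 * (2 * Y + 2 * C.L_g ^ 2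
            * (a.η ^ 2 * C.gradSq d a.β))
          + a.η ^ 2 * C.gradSq d a.β / (2 * l)) := by
  have hn := ha.one_le_b.trans ha.b_le
  have hm := ha.one_le_c.trans ha.c_le
  have hρ1 : l * (C.rhoComp + a.β * C.ρ₁) < 1 := by linarith
  have hβ := ha.β_nonneg
  have hM0 : 0 ≤ a.η ^ 2 * C.gradSq d a.β := mul_nonneg (sq_nonneg _) (C.gradSq_nonneg d a.β)
  have hV : ∀ e, Measurable fun S : State d n m =>
      moreauEnvelope (p.shiftedPhi a.β e) l S.x := fun e =>
    (differentiable_moreauEnvelope (hp.quadMinorized_shiftedPhi hn hm hβ e)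
      (hp.continuous_shiftedPhi e) hl hρ1).continuous.measurable.comp State.measurable_x
  have hgr : Measurable fun S : State d n m =>
      gradient (moreauEnvelope (p.shiftedPhi a.β e) l) S.x :=
    (continuous_gradient_moreauEnvelope (hp.quadMinorized_shiftedPhi hn hm hβ e)
      (hp.continuous_shiftedPhi e) hl hρ1).measurable.comp State.measurable_x
  have h1 := hp.lintegral_iterate_succ_add_le (x₀ := x₀) (u₁ := u₁) (u₂ := u₂) ha hw
    (ψ := fun S => ENNReal.ofReal (moreauEnvelope (p.shiftedPhi a.β e') l S.x - B))
    (c := fun S => ENNReal.ofReal (a.η / 4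
      * ‖gradient (moreauEnvelope (p.shiftedPhi a.β e) l) S.x‖ ^ 2))
    ((hV e').sub_const B).ennreal_ofReal ((hgr.norm.pow_const 2).const_mul _).ennreal_ofReal
    (fun S => hp.lintegral_moreauEnvelope_step_le ha S hl hρ hη e e' hB) t
  refine h1.trans ?_
  set M := a.η ^ 2 * C.gradSq d a.β with hM
  set L : ℝ := (C.L_df * C.L_g) ^ 2 with hL
  have hL0 : 0 ≤ L := by positivity
  set c₁ := 2 * a.β * a.η / l with hc₁
  have hc₁0 : 0 ≤ c₁ := by positivity
  have hit := hp.measurable_iterate (x₀ := x₀) (u₁ := u₁) (u₂ := u₂) ha hw t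
  have hΔ := hp.lintegral_increment_le (x₀ := x₀) (u₁ := u₁) (u₂ := u₂) ha hw t
  rw [← hM] at hΔ
  have hDm := State.measurable_norm_sub_sq.comp hit
  have k1 := lintegral_ofReal_linear_le (μ := μ)
    (f := fun ω => p.errH (p.iterate a x₀ u₁ u₂ w t ω))
    (g := fun ω => ‖(p.iterate a x₀ u₁ u₂ w t ω).x - (p.iterate a x₀ u₁ u₂ w t ω).xPrev‖ ^ 2)
    hDm (α := c₁ * (1 / (2 * θ))) (β := c₁ * (C.L_h / (2 * τ)) + 2 * a.η * L * (2 * C.L_g ^ 2))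
    (c := C.L_f * κ + c₁ * (θ / 2 + C.L_h * τ / 2) + M / (2 * l))
    (by positivity) (by positivity) (by positivity) (by positivity) hM0 hH hΔ
  have k2 := lintegral_ofReal_linear_le (μ := μ)
    (f := fun ω => p.errG e (p.iterate a x₀ u₁ u₂ w t ω))
    (g := fun ω => ‖(p.iterate a x₀ u₁ u₂ w t ω).x - (p.iterate a x₀ u₁ u₂ w t ω).xPrev‖ ^ 2)
    hDm (α := 2 * a.η * L * 2) (β := 0) (c := 0)
    (by positivity) le_rfl le_rfl hY hM0 hG hΔ
  have hpt : ∀ S : State d n m, ENNReal.ofReal (moreauEnvelope (p.shiftedPhi a.β e) l S.x - B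
        + C.L_f * (1 / (n : ℝ) * ∑ i, |e' i - e i|)
        + c₁ * (1 / (m : ℝ) * ∑ k, |S.u₂ k - p.hMean k S.x|)
        + 2 * a.η * L * (1 / (n : ℝ) * ∑ i, (S.u₁ i - p.gMean i S.x - e i) ^ 2)
        + M / (2 * l))
      ≤ ENNReal.ofReal (moreauEnvelope (p.shiftedPhi a.β e) l S.x - B)
        + (ENNReal.ofReal (c₁ * (1 / (2 * θ)) * p.errH S
          + (c₁ * (C.L_h / (2 * τ)) + 2 * a.η * L * (2 * C.L_g ^ 2)) * ‖S.x - S.xPrev‖ ^ 2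
          + (C.L_f * κ + c₁ * (θ / 2 + C.L_h * τ / 2) + M / (2 * l)))
        + ENNReal.ofReal (2 * a.η * L * 2 * p.errG e S + 0 * ‖S.x - S.xPrev‖ ^ 2 + 0)) := by
    intro S
    have b1 := mul_le_mul_of_nonneg_left (hp.average_abs_sub_le S hθ hτ) hc₁0
    have b2 := mul_le_mul_of_nonneg_left (hp.average_sub_sq_le S e)
      (by positivity : 0 ≤ 2 * a.η * L)
    have b3 := mul_le_mul_of_nonneg_left hκ C.L_f.2
    simp only [NNReal.val_eq_coe] at b3
    refine le_trans (ENNReal.ofReal_le_ofReal ?_)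
      (ENNReal.ofReal_add_le.trans (add_le_add_right ENNReal.ofReal_add_le _))
    linarith
  refine (lintegral_mono fun ω => hpt _).trans ?_
  have m1 : Measurable fun ω => ENNReal.ofReal (moreauEnvelope (p.shiftedPhi a.β e) l
      (p.iterate a x₀ u₁ u₂ w t ω).x - B) := ((hV e).comp hit |>.sub_const B).ennreal_ofReal
  have m2 : Measurable fun ω => ENNReal.ofReal (2 * a.η * L * 2
      * p.errG e (p.iterate a x₀ u₁ u₂ w t ω)
      + 0 * ‖(p.iterate a x₀ u₁ u₂ w t ω).x - (p.iterate a x₀ u₁ u₂ w t ω).xPrev‖ ^ 2 + 0) :=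
    ((((hp.measurable_errG e).comp hit).const_mul _).add (hDm.const_mul 0)
      |>.add_const 0).ennreal_ofReal
  rw [lintegral_add_left m1, lintegral_add_right _ m2]
  refine add_le_add_right ((add_le_add k1 k2).trans ?_) _
  rw [← ENNReal.ofReal_add (by positivity) (by positivity)]
  refine ENNReal.ofReal_le_ofReal (le_of_eq ?_)
  field_simp
  ring

/-- The bound of the accumulated squared gradients of the shifted Moreau envelopes. -/
theorem Problem.Assumptions.sum_lintegral_gradient_sq_le {l : ℝ} (hl : 0 < l)
    (hρ : l * (C.rhoComp + a.β * C.ρ₁) ≤ 1 / 4) (hη : 0 ≤ a.η) {e : ℕ → Fin n → ℝ} {B : ℝ}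
    (hB : ∀ t y, B ≤ p.shiftedPhi a.β (e t) y) {κ θ Y : ℕ → ℝ} {τ : ℝ}
    (hκ : ∀ t, 1 / (n : ℝ) * ∑ i, |e (t + 1) i - e t i| ≤ κ t)
    (hκ0 : ∀ t, 0 ≤ κ t) (hθ : ∀ t, 0 < θ t) (hY : ∀ t, 0 ≤ Y t) (hτ : 0 < τ)
    (hH : ∀ t, ∫⁻ ω, ENNReal.ofReal (p.errH (p.iterate a x₀ u₁ u₂ w t ω)) ∂μ
      ≤ ENNReal.ofReal (θ t ^ 2))
    (hG : ∀ t, ∫⁻ ω, ENNReal.ofReal (p.errG (e t) (p.iterate a x₀ u₁ u₂ w t ω)) ∂μ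
      ≤ ENNReal.ofReal (Y t)) (T : ℕ) :
    ∑ t ∈ Finset.range T, ∫⁻ ω, ENNReal.ofReal (a.η / 4
        * ‖gradient (moreauEnvelope (p.shiftedPhi a.β (e t)) l)
        (p.iterate a x₀ u₁ u₂ w t ω).x‖ ^ 2) ∂μ
      ≤ ENNReal.ofReal (p.shiftedPhi a.β (e 0) x₀ - B + ∑ t ∈ Finset.range T, (C.L_f * κ t
          + 2 * a.β * a.η / l * (θ t + C.L_h * (τ / 2
            + a.η ^ 2 * C.gradSq d a.β / (2 * τ)))
          + 2 * a.η * (C.L_df * C.L_g) ^ 2 * (2 * Y t + 2 * C.L_g ^ 2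
            * (a.η ^ 2 * C.gradSq d a.β))
          + a.η ^ 2 * C.gradSq d a.β / (2 * l))) := by
  have hn := ha.one_le_b.trans ha.b_le
  have hm := ha.one_le_c.trans ha.c_le
  have hβ := ha.β_nonneg
  have hM0 : 0 ≤ a.η ^ 2 * C.gradSq d a.β := mul_nonneg (sq_nonneg _) (C.gradSq_nonneg d a.β)
  set Dt : ℕ → ℝ := fun t => C.L_f * κ t
          + 2 * a.β * a.η / l * (θ t + C.L_h * (τ / 2
            + a.η ^ 2 * C.gradSq d a.β / (2 * τ)))
          + 2 * a.η * (C.L_df * C.L_g) ^ 2 * (2 * Y t + 2 * C.L_g ^ 2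
            * (a.η ^ 2 * C.gradSq d a.β))
          + a.η ^ 2 * C.gradSq d a.β / (2 * l) with hDt
  have hDt0 : ∀ t, 0 ≤ Dt t := fun t => by
    have := hκ0 t
    have := (hθ t).le
    have := hY t
    rw [hDt]
    positivity
  have key : ∀ T, ∫⁻ ω, ENNReal.ofReal (moreauEnvelope (p.shiftedPhi a.β (e T)) l
        (p.iterate a x₀ u₁ u₂ w T ω).x - B) ∂μ + ∑ t ∈ Finset.range T, ∫⁻ ω, ENNReal.ofReal
        (a.η / 4 * ‖gradient (moreauEnvelope (p.shiftedPhi a.β (e t)) l)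
        (p.iterate a x₀ u₁ u₂ w t ω).x‖ ^ 2) ∂μ
      ≤ ENNReal.ofReal (p.shiftedPhi a.β (e 0) x₀ - B + ∑ t ∈ Finset.range T, Dt t) := by
    intro T
    induction T with
    | zero =>
      simp only [Finset.range_zero, Finset.sum_empty, add_zero, Problem.iterate, Problem.run,
        lintegral_const, measure_univ, mul_one]
      apply ENNReal.ofReal_le_ofReal
      have := moreauEnvelope_le_self (isProx_prox (hp.quadMinorized_shiftedPhi hn hm hβ (e 0))
        (hp.continuous_shiftedPhi (e 0)) hl (by linarith) x₀)
      linarith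
    | succ T ih =>
      have h1 := hp.lintegral_moreauEnvelope_iterate_succ_le ha hw hl hρ hη (hB (T + 1)) (hκ T)
        (hκ0 T) (hθ T) (hY T) hτ (hH T) (hG T)
      rw [Finset.sum_range_succ, Finset.sum_range_succ, ← add_assoc, ← add_assoc]
      have hB0 : 0 ≤ p.shiftedPhi a.β (e 0) x₀ - B := by linarith [hB 0 x₀]
      rw [ENNReal.ofReal_add (add_nonneg hB0 (Finset.sum_nonneg fun t _ => hDt0 t)) (hDt0 T)]
      refine le_trans ?_ (add_le_add_left ih _)
      rw [add_right_comm, add_right_comm _ _ (ENNReal.ofReal (Dt T))]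
      exact add_le_add_left h1 _
  exact le_add_self.trans (key T)

-- The shifts are `q₁ ^ t` times the initial error. The square bound for the shifted envelopes is
-- turned into a bound for the norms of the true gradients, and all geometric series are summed.
set_option maxHeartbeats 800000 in
theorem Problem.Assumptions.sum_lintegral_norm_gradient_le {l : ℝ} (hl : 0 < l)
    (hρ : l * (C.rhoComp + a.β * C.ρ₁) ≤ 1 / 4) (hη : 0 < a.η)
    (hγ : a.γ₂ = a.γ₁) (hγ0 : 0 < a.γ₁) (hγ1 : a.γ₁ ≤ 1 / 2) {D Δ' ε τ σ₂ s₁ : ℝ} (hD0 : 0 ≤ D)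
    (hD₁ : 1 / (n : ℝ) * ∑ i, (u₁ i - p.gMean i x₀) ^ 2 ≤ D ^ 2)
    (hD₂ : 1 / (m : ℝ) * ∑ k, (u₂ k - p.hMean k x₀) ^ 2 ≤ D ^ 2)
    (hΔ : ∀ y, p.Phi a.β x₀ ≤ p.Phi a.β y + Δ') (hε : 0 < ε) (hτ : 0 < τ) (hσ₂ : 0 < σ₂)
    (hs₂ : 32 * C.L_h ^ 2 * (a.η ^ 2 * C.gradSq d a.β) / (((a.c : ℝ) / m) ^ 2 * a.γ₁)
      + 2 * a.γ₁ * C.σ_h ^ 2 / a.b₂ ≤ σ₂ ^ 2)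
    (hs₁ : 32 * C.L_g ^ 2 * (a.η ^ 2 * C.gradSq d a.β) / (((a.b : ℝ) / n) ^ 2 * a.γ₁)
      + 2 * a.γ₁ * C.σ_g ^ 2 / a.b₁ ≤ s₁) (T : ℕ) :
    ∑ t ∈ Finset.Icc 1 T, ∫⁻ ω, ENNReal.ofReal ‖gradient (moreauEnvelope (p.Phi a.β) l)
        (p.iterate a x₀ u₁ u₂ w t ω).x‖ ∂μ
      ≤ ENNReal.ofReal ((T + 1) * (ε / 4) + 2 * (C.L_df * C.L_g) * D / ((a.b : ℝ) / n * a.γ₁)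
        + 4 / (a.η * ε) * (Δ' + 3 * C.L_f * D
          + 2 * a.β * a.η / l * ((D + 1) * (2 / ((a.c : ℝ) / m * a.γ₁)) + (T + 1) * σ₂
            + (T + 1) * (C.L_h * (τ / 2 + a.η ^ 2 * C.gradSq d a.β / (2 * τ))))
          + 2 * a.η * (C.L_df * C.L_g) ^ 2 * (2 * (6 * D ^ 2 / ((a.b : ℝ) / n) + (T + 1) * s₁)
            + (T + 1) * (2 * C.L_g ^ 2 * (a.η ^ 2 * C.gradSq d a.β)))
          + (T + 1) * (a.η ^ 2 * C.gradSq d a.β / (2 * l)))) := by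
  have hn := ha.one_le_b.trans ha.b_le
  have hm := ha.one_le_c.trans ha.c_le
  have hn0 : (0 : ℝ) < n := by exact_mod_cast hn
  have hm0 : (0 : ℝ) < m := by exact_mod_cast hm
  have hb0 : (0 : ℝ) < a.b := by exact_mod_cast ha.one_le_b
  have hc0 : (0 : ℝ) < a.c := by exact_mod_cast ha.one_le_c
  have hβ := ha.β_nonneg
  have hM0 : 0 ≤ a.η ^ 2 * C.gradSq d a.β := mul_nonneg (sq_nonneg _) (C.gradSq_nonneg d a.β)
  have hr₁ : (a.b : ℝ) / n ≤ 1 := by rw [div_le_one hn0]; exact_mod_cast ha.b_le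
  have hr₂ : (a.c : ℝ) / m ≤ 1 := by rw [div_le_one hm0]; exact_mod_cast ha.c_le
  have hH := hp.lintegral_errH_iterate_le (x₀ := x₀) (u₁ := u₁) ha hw (by rwa [hγ])
    (by rwa [hγ]) hD₂
  have hG := hp.lintegral_errG_iterate_le (x₀ := x₀) (u₂ := u₂) ha hw hγ0 hγ1 hD₁
  rw [hγ] at hH
  set r₁ := (a.b : ℝ) / n
  set r₂ := (a.c : ℝ) / m
  have hr₁0 : 0 < r₁ := by positivity
  have hr₂0 : 0 < r₂ := by positivity
  set q₁ := 1 - r₁ * a.γ₁ with hq₁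
  set q₂ := 1 - r₂ * a.γ₁ with hq₂
  have hq₁0 : 0 ≤ q₁ := sub_nonneg.2 (mul_le_one₀ hr₁ hγ0.le (by linarith))
  have hq₁1 : q₁ < 1 := sub_lt_self _ (mul_pos hr₁0 hγ0)
  have hq₂0 : 0 ≤ q₂ := sub_nonneg.2 (mul_le_one₀ hr₂ hγ0.le (by linarith))
  have hq₂1 : q₂ < 1 := sub_lt_self _ (mul_pos hr₂0 hγ0)
  set M := a.η ^ 2 * C.gradSq d a.β with hM
  set e₀ : Fin n → ℝ := fun i => u₁ i - p.gMean i x₀ with he₀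
  set e := shiftAt q₁ e₀ with he
  have he₀D : 1 / (n : ℝ) * ∑ i, |e₀ i| ≤ D := average_abs_le_of_average_sq_le hD0 hD₁
  have heD : ∀ t, 1 / (n : ℝ) * ∑ i, |e t i| ≤ q₁ ^ t * D := fun t => by
    rw [he, shiftAt, average_abs_smul, abs_of_nonneg (pow_nonneg hq₁0 t)]
    exact mul_le_mul_of_nonneg_left he₀D (pow_nonneg hq₁0 t)
  have hqt : ∀ t, q₁ ^ t ≤ 1 := fun t => pow_le_one₀ hq₁0 hq₁1.le
  have heD' : ∀ t, 1 / (n : ℝ) * ∑ i, |e t i| ≤ D := fun t =>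
    (heD t).trans (mul_le_of_le_one_left hD0 (hqt t))
  have hshift : ∀ t y, |p.shiftedPhi a.β (e t) y - p.Phi a.β y| ≤ C.L_f * D := fun t y => by
    have := hp.abs_shiftedPhi_sub_le (β := a.β) (e t) 0 y
    rw [p.shiftedPhi_zero] at this
    simp only [Pi.zero_apply, sub_zero] at this
    exact this.trans (mul_le_mul_of_nonneg_left (heD' t) C.L_f.2)
  have hκ : ∀ t, 1 / (n : ℝ) * ∑ i, |e (t + 1) i - e t i| ≤ (q₁ ^ t - q₁ ^ (t + 1)) * D := by
    intro t
    have h1 : ∀ i, e (t + 1) i - e t i = ((q₁ ^ (t + 1) - q₁ ^ t) • e₀) i := fun i => by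
      simp only [he, shiftAt, Pi.smul_apply, smul_eq_mul]; ring
    have h2 : q₁ ^ (t + 1) ≤ q₁ ^ t := pow_le_pow_of_le_one hq₁0 hq₁1.le t.le_succ
    simp only [h1]
    rw [average_abs_smul, abs_sub_comm, abs_of_nonneg (sub_nonneg.2 h2)]
    exact mul_le_mul_of_nonneg_left he₀D (sub_nonneg.2 h2)
  -- The lower bound `B` is valid for all shifted objectives at once. The total `3 L_f D` consists
  -- of one part from `B`, one from the initial value and one from the telescoping drift.
  have hsum := hp.sum_lintegral_gradient_sq_le (x₀ := x₀) (u₁ := u₁) (u₂ := u₂) ha hw hl hρ hη.le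
    (e := e) (B := p.Phi a.β x₀ - Δ' - C.L_f * D)
    (fun t y => by linarith [(abs_le.1 (hshift t y)).1, hΔ y])
    (κ := fun t => (q₁ ^ t - q₁ ^ (t + 1)) * D) (θ := fun t => √q₂ ^ t * (D + 1) + σ₂)
    (Y := fun t => 6 * a.γ₁ * D ^ 2 * q₁ ^ t + s₁) (τ := τ) hκ
    (fun t => mul_nonneg (sub_nonneg.2 (pow_le_pow_of_le_one hq₁0 hq₁1.le t.le_succ)) hD0)
    (fun t => by positivity)
    (fun t => add_nonneg (by positivity) (le_trans (by positivity) hs₁)) hτ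
    (fun t => (hH t).trans (ENNReal.ofReal_le_ofReal (by
      have h1 : (√q₂ ^ t) ^ 2 = q₂ ^ t := by
        rw [← pow_mul, mul_comm, pow_mul, Real.sq_sqrt hq₂0]
      have h2 : 0 ≤ √q₂ ^ t * (D + 1) * σ₂ := by positivity
      have h3 : q₂ ^ t * D ^ 2 ≤ q₂ ^ t * (D + 1) ^ 2 := by gcongr; linarith
      have h4 : (√q₂ ^ t * (D + 1) + σ₂) ^ 2 = q₂ ^ t * (D + 1) ^ 2
          + 2 * (√q₂ ^ t * (D + 1) * σ₂) + σ₂ ^ 2 := by rw [← h1]; ring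
      rw [h4]
      linarith)))
    (fun t => (hG t).trans (ENNReal.ofReal_le_ofReal (by
      have h1 : q₁ ^ t * (1 - q₁ ^ t) ≤ q₁ ^ t := mul_le_of_le_one_right (pow_nonneg hq₁0 t)
        (sub_le_self _ (pow_nonneg hq₁0 t))
      have h2 : 6 * a.γ₁ * D ^ 2 * (q₁ ^ t * (1 - q₁ ^ t)) ≤ 6 * a.γ₁ * D ^ 2 * q₁ ^ t := by
        gcongr
      linarith))) (T + 1)
  set R := Δ' + 3 * C.L_f * D + 2 * a.β * a.η / l * ((D + 1) * (2 / (r₂ * a.γ₁)) + (T + 1) * σ₂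
            + (T + 1) * (C.L_h * (τ / 2 + M / (2 * τ))))
          + 2 * a.η * (C.L_df * C.L_g) ^ 2 * (2 * (6 * D ^ 2 / r₁ + (T + 1) * s₁)
            + (T + 1) * (2 * C.L_g ^ 2 * M)) + (T + 1) * (M / (2 * l)) with hR
  have hsum' := hsum.trans (ENNReal.ofReal_le_ofReal (q := R) (by
    have s1 := sum_drift_le (A := C.L_f) (c₁ := 2 * a.β * a.η / l) (σ := σ₂)
      (X := C.L_h * (τ / 2 + M / (2 * τ))) (c₂ := 2 * a.η * (C.L_df * C.L_g) ^ 2)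
      (κ := 6 * a.γ₁ * D ^ 2) (s := s₁) (Y := 2 * C.L_g ^ 2 * M) (W := M / (2 * l))
      hq₁0 hq₁1 hq₂0 hq₂1 C.L_f.2 hD0 (by positivity) (by positivity) (by positivity) (T + 1)
    have s2 := (abs_le.1 (hshift 0 x₀)).2
    have s3 : 6 * a.γ₁ * D ^ 2 / (r₁ * a.γ₁) = 6 * D ^ 2 / r₁ := by field_simp
    simp only [hq₁, hq₂, sub_sub_cancel, s3, Nat.cast_add, Nat.cast_one] at s1
    rw [hR]
    linarith))
  have hQ : QuadMinorized (C.rhoComp + a.β * C.ρ₁) (p.Phi a.β) := by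
    rw [← p.shiftedPhi_zero]; exact hp.quadMinorized_shiftedPhi hn hm hβ 0
  have hc : Continuous (p.Phi a.β) := by
    rw [← p.shiftedPhi_zero]; exact hp.continuous_shiftedPhi 0
  -- Uses `V ≤ V² / ε + ε / 4`. The factor 2 covers `1 / (1 - l ρ) ≤ 4 / 3`, where `ρ` is the
  -- curvature.
  have hpt : ∀ t x, ‖gradient (moreauEnvelope (p.Phi a.β) l) x‖
      ≤ 4 / (a.η * ε) * (a.η / 4 * ‖gradient (moreauEnvelope (p.shiftedPhi a.β (e t)) l) x‖ ^ 2)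
        + (ε / 4 + 2 * (C.L_df * C.L_g) * D * q₁ ^ t) := by
    intro t x
    have h1 := norm_gradient_moreauEnvelope_sub_le
      (hp.quadMinorized_shiftedPhi hn hm hβ (e t)) (hp.continuous_shiftedPhi (e t)) hQ hc hl
      (by linarith) (K := C.L_df * C.L_g * (1 / (n : ℝ) * ∑ i, |e t i|)) (by positivity)
      (fun y z => hp.abs_shiftedPhi_sub_sub_le (e t) y z) x
    have h2 : C.L_df * C.L_g * (1 / (n : ℝ) * ∑ i, |e t i|) ≤ C.L_df * C.L_g * (q₁ ^ t * D) :=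
      mul_le_mul_of_nonneg_left (heD t) (by positivity)
    have h3 := norm_sub_norm_le (gradient (moreauEnvelope (p.Phi a.β) l) x)
      (gradient (moreauEnvelope (p.shiftedPhi a.β (e t)) l) x)
    rw [norm_sub_rev] at h3
    set V := ‖gradient (moreauEnvelope (p.shiftedPhi a.β (e t)) l) x‖
    have h4 : 4 / (a.η * ε) * (a.η / 4 * V ^ 2) = V ^ 2 / ε := by field_simp
    have h5 : V ≤ V ^ 2 / ε + ε / 4 := by
      have : V ^ 2 / ε + ε / 4 = (V ^ 2 + ε ^ 2 / 4) / ε := by field_simp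
      rw [this, le_div_iff₀ hε]
      have : (V - ε / 2) ^ 2 = V ^ 2 - V * ε + ε ^ 2 / 4 := by ring
      linarith [sq_nonneg (V - ε / 2)]
    have h6 : 0 ≤ C.L_df * C.L_g * (q₁ ^ t * D) := by positivity
    have h7 := norm_nonneg (gradient (moreauEnvelope (p.shiftedPhi a.β (e t)) l) x
      - gradient (moreauEnvelope (p.Phi a.β) l) x)
    rw [h4]
    linarith [mul_le_mul_of_nonneg_right hρ h7]
  have hint : ∀ t, ∫⁻ ω, ENNReal.ofReal ‖gradient (moreauEnvelope (p.Phi a.β) l)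
        (p.iterate a x₀ u₁ u₂ w t ω).x‖ ∂μ
      ≤ ENNReal.ofReal (4 / (a.η * ε)) * ∫⁻ ω, ENNReal.ofReal (a.η / 4
        * ‖gradient (moreauEnvelope (p.shiftedPhi a.β (e t)) l)
          (p.iterate a x₀ u₁ u₂ w t ω).x‖ ^ 2) ∂μ
        + ENNReal.ofReal (ε / 4 + 2 * (C.L_df * C.L_g) * D * q₁ ^ t) := by
    intro t
    rw [← lintegral_const_mul' _ _ ENNReal.ofReal_ne_top]
    refine (lintegral_mono fun ω => (ENNReal.ofReal_le_ofReal (hpt t _)).trans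
      ENNReal.ofReal_add_le).trans ?_
    rw [lintegral_add_right _ measurable_const]
    simp only [lintegral_const, measure_univ, mul_one]
    refine add_le_add_left (lintegral_mono fun ω => ?_) _
    rw [ENNReal.ofReal_mul (by positivity)]
  -- The descent argument starts at time 0 while the output index starts at 1, hence the factors `T
  -- + 1`.
  have hsub : Finset.Icc 1 T ⊆ Finset.range (T + 1) := fun t ht => by
    rw [Finset.mem_Icc] at ht; rw [Finset.mem_range]; omega
  have hbn : ∀ t, 0 ≤ ε / 4 + 2 * (C.L_df * C.L_g) * D * q₁ ^ t := fun t => by positivity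
  calc ∑ t ∈ Finset.Icc 1 T, ∫⁻ ω, ENNReal.ofReal ‖gradient (moreauEnvelope (p.Phi a.β) l)
        (p.iterate a x₀ u₁ u₂ w t ω).x‖ ∂μ
      ≤ ∑ t ∈ Finset.range (T + 1), ∫⁻ ω, ENNReal.ofReal ‖gradient
        (moreauEnvelope (p.Phi a.β) l) (p.iterate a x₀ u₁ u₂ w t ω).x‖ ∂μ :=
        Finset.sum_le_sum_of_subset hsub
    _ ≤ ∑ t ∈ Finset.range (T + 1), (ENNReal.ofReal (4 / (a.η * ε)) * ∫⁻ ω, ENNReal.ofReal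
        (a.η / 4 * ‖gradient (moreauEnvelope (p.shiftedPhi a.β (e t)) l)
          (p.iterate a x₀ u₁ u₂ w t ω).x‖ ^ 2) ∂μ
        + ENNReal.ofReal (ε / 4 + 2 * (C.L_df * C.L_g) * D * q₁ ^ t)) :=
        Finset.sum_le_sum fun t _ => hint t
    _ ≤ ENNReal.ofReal (4 / (a.η * ε)) * ENNReal.ofReal R + ENNReal.ofReal
        (∑ t ∈ Finset.range (T + 1), (ε / 4 + 2 * (C.L_df * C.L_g) * D * q₁ ^ t)) := by
        rw [Finset.sum_add_distrib, ← Finset.mul_sum,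
          ENNReal.ofReal_sum_of_nonneg fun t _ => hbn t]
        gcongr
    _ ≤ _ := by
        have hΔ0 : 0 ≤ Δ' := by linarith [hΔ x₀]
        have hs10 : 0 ≤ s₁ := le_trans (by positivity) hs₁
        have hR0 : 0 ≤ R := by rw [hR]; positivity
        rw [← ENNReal.ofReal_mul (by positivity), ← ENNReal.ofReal_add (by positivity)
          (Finset.sum_nonneg fun t _ => hbn t)]
        apply ENNReal.ofReal_le_ofReal
        have s3 : ∑ t ∈ Finset.range (T + 1), q₁ ^ t ≤ 1 / (r₁ * a.γ₁) := by
          have := sum_range_pow_le hq₁0 hq₁1 (T + 1)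
          rwa [hq₁, sub_sub_cancel, ← hq₁] at this
        have s4 := mul_le_mul_of_nonneg_left s3
          (by positivity : 0 ≤ 2 * (C.L_df * C.L_g : ℝ) * D)
        rw [mul_one_div] at s4
        rw [Finset.sum_add_distrib, ← Finset.mul_sum, Finset.sum_const, Finset.card_range,
          nsmul_eq_mul]
        push_cast
        linarith

end GradientSum

/-! ### Choice of the parameters -/

section Parameters

theorem exists_pos_mul_le {k r : ℝ} (hk : 0 ≤ k) (hr : 0 < r) : ∃ c, 0 < c ∧ c ≤ 1 ∧ c * k ≤ r := by
  refine ⟨min 1 (r / (k + 1)), by positivity, min_le_left _ _, ?_⟩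
  calc min 1 (r / (k + 1)) * k ≤ r / (k + 1) * (k + 1) := by
        gcongr
        · exact min_le_right _ _
        · linarith
    _ = r := by field_simp

/-- The existence of constants `cγ`, `cη`, `cT` and of an error level `δ` that make all the terms of
the final bound small. -/
theorem exists_constants {β₀ D L Lg Lh σg σh KG Kl KΔ : ℝ} (hβ₀ : 0 < β₀) (hD : 0 ≤ D)
    (hL : 0 ≤ L) (hLh : 0 ≤ Lh) (hKG : 0 ≤ KG) (hKl : 0 ≤ Kl) (hKΔ : 0 ≤ KΔ) :
    ∃ cγ cη cT δ : ℝ, 0 < cγ ∧ cγ ≤ 1 / 2 ∧ 0 < cη ∧ 0 < cT ∧ 0 < δ ∧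
      32 * Lh ^ 2 * KG * (cη ^ 2 / cγ) + 2 * cγ * σh ^ 2 ≤ δ ^ 2 ∧
      32 * Lg ^ 2 * KG * (cη ^ 2 / cγ) / β₀ ^ 2 + 2 * cγ * σg ^ 2 / β₀ ≤ δ ∧
      2 * L * D / (cT * cγ * β₀) + 4 * KΔ / (cη * cT) + 16 * (D + 1) * Kl / (cT * cγ)
        + 16 * Kl * δ + 8 * Kl * Lh * (1 + KG) * cη + 96 * L ^ 2 * D ^ 2 / (cT * β₀ ^ 2)
        + 32 * L ^ 2 * δ + 32 * L ^ 2 * Lg ^ 2 * KG * cη ^ 2 / β₀ ^ 2 + 4 * KG * Kl * cη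
        ≤ 1 / 2 := by
  -- The order of choice matters: `δ` first, then `cγ` small compared with `δ`, then `cη` small
  -- compared with `δ` and `cγ`, and last `cT = 1 / c`, large compared with the inverses of `cγ` and
  -- `cη`.
  obtain ⟨δ, hδ, -, hδ1⟩ := exists_pos_mul_le (k := 16 * Kl + 32 * L ^ 2) (r := 1 / 8)
    (by positivity) (by norm_num)
  obtain ⟨cγ, hcγ, -, hcγ1⟩ := exists_pos_mul_le
    (k := 1 + 2 * σh ^ 2 + 2 * σg ^ 2 / β₀) (r := min (1 / 2) (min (δ ^ 2 / 2) (δ / 2)))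
    (by positivity) (by positivity)
  obtain ⟨cη, hcη, hcη1, hcη2⟩ := exists_pos_mul_le
    (k := 32 * Lh ^ 2 * KG / cγ + 32 * Lg ^ 2 * KG / cγ / β₀ ^ 2 + 8 * Kl * Lh * (1 + KG)
      + 32 * L ^ 2 * Lg ^ 2 * KG / β₀ ^ 2 + 4 * KG * Kl)
    (r := min (1 / 8) (min (δ ^ 2 / 2) (δ / 2))) (by positivity) (by positivity)
  obtain ⟨c, hc, -, hc1⟩ := exists_pos_mul_le
    (k := 2 * L * D / (cγ * β₀) + 4 * KΔ / cη + 16 * (D + 1) * Kl / cγ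
      + 96 * L ^ 2 * D ^ 2 / β₀ ^ 2) (r := 1 / 8) (by positivity) (by norm_num)
  rw [le_min_iff, le_min_iff] at hcγ1 hcη2
  obtain ⟨g1, g2, g3⟩ := hcγ1
  obtain ⟨e1, e2, e3⟩ := hcη2
  have hsq : cη ^ 2 ≤ cη := pow_le_of_le_one hcη.le hcη1 two_ne_zero
  have p1 : 0 ≤ cγ * (2 * σh ^ 2) := by positivity
  have p2 : 0 ≤ cγ * (2 * σg ^ 2 / β₀) := by positivity
  have q1 : 0 ≤ cη * (32 * Lh ^ 2 * KG / cγ) := by positivity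
  have q2 : 0 ≤ cη * (32 * Lg ^ 2 * KG / cγ / β₀ ^ 2) := by positivity
  have q3 : 0 ≤ cη * (8 * Kl * Lh * (1 + KG)) := by positivity
  have q4 : 0 ≤ cη * (32 * L ^ 2 * Lg ^ 2 * KG / β₀ ^ 2) := by positivity
  have q5 : 0 ≤ cη * (4 * KG * Kl) := by positivity
  have r1 := mul_le_mul_of_nonneg_right hsq (by positivity : 0 ≤ 32 * Lh ^ 2 * KG / cγ)
  have r2 := mul_le_mul_of_nonneg_right hsq (by positivity : 0 ≤ 32 * Lg ^ 2 * KG / cγ / β₀ ^ 2)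
  have r3 := mul_le_mul_of_nonneg_right hsq
    (by positivity : 0 ≤ 32 * L ^ 2 * Lg ^ 2 * KG / β₀ ^ 2)
  simp only [mul_add] at g1 g2 g3 e1 e2 e3
  refine ⟨cγ, cη, 1 / c, δ, hcγ, by linarith, hcη, by positivity, hδ, ?_, ?_, ?_⟩
  · have : 32 * Lh ^ 2 * KG * (cη ^ 2 / cγ) = cη ^ 2 * (32 * Lh ^ 2 * KG / cγ) := by ring
    linarith
  · have : 32 * Lg ^ 2 * KG * (cη ^ 2 / cγ) / β₀ ^ 2
      = cη ^ 2 * (32 * Lg ^ 2 * KG / cγ / β₀ ^ 2) := by ring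
    have : 2 * cγ * σg ^ 2 / β₀ = cγ * (2 * σg ^ 2 / β₀) := by ring
    linarith
  · have h1 : 2 * L * D / (1 / c * cγ * β₀) + 4 * KΔ / (cη * (1 / c))
        + 16 * (D + 1) * Kl / (1 / c * cγ) + 96 * L ^ 2 * D ^ 2 / (1 / c * β₀ ^ 2)
        = c * (2 * L * D / (cγ * β₀) + 4 * KΔ / cη + 16 * (D + 1) * Kl / cγ
      + 96 * L ^ 2 * D ^ 2 / β₀ ^ 2) := by field_simp
    have h2 : 32 * L ^ 2 * Lg ^ 2 * KG * cη ^ 2 / β₀ ^ 2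
        = cη ^ 2 * (32 * L ^ 2 * Lg ^ 2 * KG / β₀ ^ 2) := by ring
    linarith

set_option maxHeartbeats 800000 in
/-- The final bound, in terms of the orders of magnitude of the parameters. -/
theorem gradient_sum_bound_le {β₀ D L Lf Lg Lh KG Kl KΔ cγ cη cT δ β ε l p₁ p₂ γ η T G Δ' : ℝ}
    (hβ₀ : 0 < β₀) (hD : 0 ≤ D) (hL : 0 ≤ L) (hLh : 0 ≤ Lh) (hKG : 0 ≤ KG) (hKl : 0 ≤ Kl)
    (hKΔ : 0 ≤ KΔ) (hcγ : 0 < cγ) (hcη : 0 < cη) (hcT : 0 < cT) (hδ : 0 < δ)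
    (hc : 2 * L * D / (cT * cγ * β₀) + 4 * KΔ / (cη * cT) + 16 * (D + 1) * Kl / (cT * cγ)
        + 16 * Kl * δ + 8 * Kl * Lh * (1 + KG) * cη + 96 * L ^ 2 * D ^ 2 / (cT * β₀ ^ 2)
        + 32 * L ^ 2 * δ + 32 * L ^ 2 * Lg ^ 2 * KG * cη ^ 2 / β₀ ^ 2 + 4 * KG * Kl * cη
        ≤ 1 / 2)
    (hβ : β₀ ≤ β) (hε : 0 < ε) (hεβ : ε ≤ β) (hp₁ : 0 < p₁) (hp₂ : 0 < p₂) (hγ : 0 < γ)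
    (hη : 0 < η) (hT : 1 ≤ T) (hl : 0 < l) (hl' : 1 / l ≤ Kl * β) (hG0 : 0 ≤ G)
    (hG : G ≤ KG * β ^ 2) (hΔ : Δ' + 3 * Lf * D ≤ KΔ * β)
    (h1 : η * β ^ 3 ≤ cη * ε ^ 2) (h2 : cT * cγ * β ^ 2 ≤ p₂ * γ * T * ε ^ 2)
    (h3 : cT * cγ * β ≤ p₁ * γ * T * ε) (h4 : cT * β ^ 2 ≤ p₁ * T * ε ^ 2)
    (h5 : cη * cT * β ≤ η * T * ε ^ 2) :
    (T + 1) * (ε / 4) + 2 * L * D / (p₁ * γ)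
        + 4 / (η * ε) * (Δ' + 3 * Lf * D
          + 2 * β * η / l * ((D + 1) * (2 / (p₂ * γ)) + (T + 1) * (δ * ε ^ 2 / β ^ 2)
            + (T + 1) * (Lh * (η * β / 2 + η ^ 2 * G / (2 * (η * β)))))
          + 2 * η * L ^ 2 * (2 * (6 * D ^ 2 / p₁ + (T + 1) * (δ * ε ^ 2))
            + (T + 1) * (2 * Lg ^ 2 * (η ^ 2 * G)))
          + (T + 1) * (η ^ 2 * G / (2 * l))) ≤ T * ε := by
  have hβ0 : 0 < β := hβ₀.trans_le hβ
  have hT0 : 0 < T := by linarith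
  have hN : T + 1 ≤ 2 * T := by linarith
  have e0 : (T + 1) * (ε / 4) ≤ 1 / 2 * (T * ε) := by
    linarith [mul_le_mul_of_nonneg_right hT hε.le]
  have e1 : 2 * L * D / (p₁ * γ) ≤ 2 * L * D / (cT * cγ * β₀) * (T * ε) := by
    rw [div_mul_eq_mul_div, div_le_div_iff₀ (by positivity) (by positivity)]
    have : cT * cγ * β₀ ≤ p₁ * γ * T * ε := le_trans (by gcongr) h3
    linarith [mul_le_mul_of_nonneg_left this (by positivity : 0 ≤ 2 * L * D)]
  have e2 : 4 / (η * ε) * (Δ' + 3 * Lf * D) ≤ 4 * KΔ / (cη * cT) * (T * ε) := by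
    calc 4 / (η * ε) * (Δ' + 3 * Lf * D) ≤ 4 / (η * ε) * (KΔ * β) := by gcongr
      _ = 4 * KΔ * β / (η * ε) := by ring
      _ ≤ _ := by
        rw [div_mul_eq_mul_div, div_le_div_iff₀ (by positivity) (by positivity)]
        linarith [mul_le_mul_of_nonneg_left h5 (by positivity : 0 ≤ 4 * KΔ)]
  have e3 : 8 * β / ε * (1 / l) * ((D + 1) * (2 / (p₂ * γ)))
      ≤ 16 * (D + 1) * Kl / (cT * cγ) * (T * ε) := by
    calc _ ≤ 8 * β / ε * (Kl * β) * ((D + 1) * (2 / (p₂ * γ))) := by gcongr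
      _ = 16 * (D + 1) * Kl * β ^ 2 / (ε * (p₂ * γ)) := by field_simp; ring
      _ ≤ _ := by
        rw [div_mul_eq_mul_div, div_le_div_iff₀ (by positivity) (by positivity)]
        linarith [mul_le_mul_of_nonneg_left h2 (by positivity : 0 ≤ 16 * (D + 1) * Kl)]
  have e4 : 8 * β / ε * (1 / l) * ((T + 1) * (δ * ε ^ 2 / β ^ 2)) ≤ 16 * Kl * δ * (T * ε) := by
    calc _ ≤ 8 * β / ε * (Kl * β) * (2 * T * (δ * ε ^ 2 / β ^ 2)) := by gcongr
      _ = _ := by field_simp; ring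
  have e5 : 8 * β / ε * (1 / l) * ((T + 1) * (Lh * (η * β / 2 + η ^ 2 * G / (2 * (η * β)))))
      ≤ 8 * Kl * Lh * (1 + KG) * cη * (T * ε) := by
    calc _ ≤ 8 * β / ε * (Kl * β) * (2 * T * (Lh * (η * β / 2 + η ^ 2 * (KG * β ^ 2)
          / (2 * (η * β))))) := by gcongr
      _ = 8 * Kl * Lh * (1 + KG) * T / ε * (η * β ^ 3) := by field_simp
      _ ≤ 8 * Kl * Lh * (1 + KG) * T / ε * (cη * ε ^ 2) := by gcongr
      _ = _ := by field_simp
  have e6 : 8 * L ^ 2 / ε * (2 * (6 * D ^ 2 / p₁))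
      ≤ 96 * L ^ 2 * D ^ 2 / (cT * β₀ ^ 2) * (T * ε) := by
    calc _ = 96 * L ^ 2 * D ^ 2 / (ε * p₁) := by field_simp; ring
      _ ≤ _ := by
        rw [div_mul_eq_mul_div, div_le_div_iff₀ (by positivity) (by positivity)]
        have : cT * β₀ ^ 2 ≤ p₁ * T * ε ^ 2 := le_trans (by gcongr) h4
        linarith [mul_le_mul_of_nonneg_left this (by positivity : 0 ≤ 96 * L ^ 2 * D ^ 2)]
  have e7 : 8 * L ^ 2 / ε * (2 * ((T + 1) * (δ * ε ^ 2))) ≤ 32 * L ^ 2 * δ * (T * ε) := by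
    calc _ ≤ 8 * L ^ 2 / ε * (2 * (2 * T * (δ * ε ^ 2))) := by gcongr
      _ = _ := by field_simp; ring
  have e8 : 8 * L ^ 2 / ε * ((T + 1) * (2 * Lg ^ 2 * (η ^ 2 * G)))
      ≤ 32 * L ^ 2 * Lg ^ 2 * KG * cη ^ 2 / β₀ ^ 2 * (T * ε) := by
    -- One factor `ε` of `ε²` is traded for `β` by `ε ≤ β`.
    have h6 : η * β * β₀ ≤ cη * ε := by
      have h7 : η * β ^ 2 * β ≤ cη * ε * β := by
        calc η * β ^ 2 * β = η * β ^ 3 := by ring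
          _ ≤ cη * ε ^ 2 := h1
          _ = cη * ε * ε := by ring
          _ ≤ _ := by gcongr
      calc η * β * β₀ ≤ η * β * β := by gcongr
        _ = η * β ^ 2 := by ring
        _ ≤ _ := le_of_mul_le_mul_right h7 hβ0
    calc _ ≤ 8 * L ^ 2 / ε * (2 * T * (2 * Lg ^ 2 * (η ^ 2 * (KG * β ^ 2)))) := by gcongr
      _ = 32 * L ^ 2 * Lg ^ 2 * KG * T / (ε * β₀ ^ 2) * (η * β * β₀) ^ 2 := by
        field_simp; ring
      _ ≤ 32 * L ^ 2 * Lg ^ 2 * KG * T / (ε * β₀ ^ 2) * (cη * ε) ^ 2 := by gcongr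
      _ = _ := by field_simp
  have e9 : 4 / (η * ε) * ((T + 1) * (η ^ 2 * G / 2 * (1 / l)))
      ≤ 4 * KG * Kl * cη * (T * ε) := by
    calc _ ≤ 4 / (η * ε) * (2 * T * (η ^ 2 * (KG * β ^ 2) / 2 * (Kl * β))) := by gcongr
      _ = 4 * KG * Kl * T / ε * (η * β ^ 3) := by field_simp
      _ ≤ 4 * KG * Kl * T / ε * (cη * ε ^ 2) := by gcongr
      _ = _ := by field_simp
  have e10 := mul_le_mul_of_nonneg_right hc (by positivity : 0 ≤ T * ε)
  simp only [add_mul] at e10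
  have a1 : ∀ X : ℝ, 4 / (η * ε) * (2 * β * η / l * X) = 8 * β / ε * (1 / l) * X := fun X => by
    field_simp; ring
  have a2 : ∀ X : ℝ, 4 / (η * ε) * (2 * η * L ^ 2 * X) = 8 * L ^ 2 / ε * X := fun X => by
    field_simp; ring
  have a3 : η ^ 2 * G / (2 * l) = η ^ 2 * G / 2 * (1 / l) := by field_simp
  rw [mul_add (4 / (η * ε)), mul_add (4 / (η * ε)), mul_add (4 / (η * ε)), a1, a2, a3]
  simp only [mul_add (8 * β / ε * (1 / l)), mul_add (8 * L ^ 2 / ε)]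
  rw [mul_add (2 : ℝ), mul_add (8 * L ^ 2 / ε)]
  linarith

end Parameters

/-! ### Orders of magnitude of the parameters -/

section Rates

variable {cγ cη cT β ε p₁ p₂ b₁ b₂ v γ η T : ℝ}

theorem sq_div_le_of_le {q : ℝ} (hcγ : 0 < cγ) (hβ : 0 < β) (hv0 : 0 < v) (hq : 0 < q)
    (hη0 : 0 ≤ η) {x : ℝ} (hη : η ≤ cη * (q * v * x / β)) :
    η ^ 2 * β ^ 2 / (q ^ 2 * (cγ * v ^ 2)) ≤ cη ^ 2 / cγ * x ^ 2 := by
  calc η ^ 2 * β ^ 2 / (q ^ 2 * (cγ * v ^ 2))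
      ≤ (cη * (q * v * x / β)) ^ 2 * β ^ 2 / (q ^ 2 * (cγ * v ^ 2)) := by gcongr
    _ = cη ^ 2 / cγ * x ^ 2 := by field_simp

/-- The orders of magnitude of `γ`, `η` and `T`, where `v` is `√b₂ * ε ^ 2 / β ^ 2`. -/
theorem parameter_rates (hcγ : 0 < cγ) (hcη : 0 < cη)
    (hcT : 0 < cT) (hβ : 0 < β) (hε : 0 < ε) (hεβ : ε ≤ β) (hp₁ : 0 < p₁) (hp₂ : 0 < p₂)
    (hp₂1 : p₂ ≤ 1) (hb₁ : 0 < b₁) (hb₂ : 0 < b₂) (hv0 : 0 < v) (hv1 : v ≤ 1)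
    (hεv : ε ^ 2 ≤ v * β ^ 2) (hv : v ^ 2 * β ^ 4 = b₂ * ε ^ 4)
    (hb : b₂ * ε ^ 2 ≤ b₁ * β ^ 3) (hp : p₂ * ε ≤ p₁ * β) (hγ : γ = cγ * v ^ 2) (hη0 : 0 < η)
    (hη : η ≤ cη * (p₂ * v * ε ^ 2 / β ^ 3)) (hT : cT * (β ^ 4 / (v * p₂ * ε ^ 4)) ≤ T) :
    (η * β ^ 3 ≤ cη * ε ^ 2 ∧ cT * cγ * β ^ 2 ≤ p₂ * γ * T * ε ^ 2
      ∧ cT * cγ * β ≤ p₁ * γ * T * ε ∧ cT * β ^ 2 ≤ p₁ * T * ε ^ 2)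
    ∧ η ^ 2 * β ^ 2 / (p₂ ^ 2 * γ) ≤ cη ^ 2 / cγ * (ε ^ 2 / β ^ 2) ^ 2
    ∧ η ^ 2 * β ^ 2 / (p₁ ^ 2 * γ) ≤ cη ^ 2 / cγ * (ε / β) ^ 2
    ∧ γ / b₂ = cγ * (ε ^ 2 / β ^ 2) ^ 2 ∧ γ / b₁ ≤ cγ * (ε ^ 2 / β) := by
  have hT' : cT * β ^ 4 ≤ T * (v * p₂ * ε ^ 4) := by
    rwa [← mul_div_assoc, div_le_iff₀ (by positivity)] at hT
  have hT0 : 0 < T := lt_of_lt_of_le (by positivity) hT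
  have h2 : cT * cγ * β ^ 2 ≤ p₂ * γ * T * ε ^ 2 := by
    refine le_of_mul_le_mul_right ?_ (by positivity : 0 < ε ^ 2)
    calc cT * cγ * β ^ 2 * ε ^ 2 ≤ cT * cγ * β ^ 2 * (v * β ^ 2) := by gcongr
      _ = cγ * v * (cT * β ^ 4) := by ring
      _ ≤ cγ * v * (T * (v * p₂ * ε ^ 4)) := by gcongr
      _ = _ := by rw [hγ]; ring
  have hγ0 : 0 < γ := by rw [hγ]; positivity
  refine ⟨⟨?_, h2, ?_, ?_⟩, ?_, ?_, ?_, ?_⟩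
  · calc η * β ^ 3 ≤ cη * (p₂ * v * ε ^ 2 / β ^ 3) * β ^ 3 := by gcongr
      _ = cη * (p₂ * v * ε ^ 2) := by field_simp
      _ ≤ cη * (1 * 1 * ε ^ 2) := by gcongr
      _ = _ := by ring
  -- The comparison of the outer sampling fractions, `p₂ ε ≤ p₁ β`, lets the bound for the
  -- constraints serve for the objective as well. This is the condition under which the linear cost
  -- of the initial error of `u₁` is affordable.
  · refine le_of_mul_le_mul_right ?_ hβ
    calc cT * cγ * β * β = cT * cγ * β ^ 2 := by ring
      _ ≤ γ * T * ε * (p₂ * ε) := h2.trans_eq (by ring)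
      _ ≤ γ * T * ε * (p₁ * β) := by gcongr
      _ = _ := by ring
  · refine le_of_mul_le_mul_right ?_ (by positivity : 0 < β ^ 2)
    calc cT * β ^ 2 * β ^ 2 = cT * β ^ 4 := by ring
      _ ≤ T * v * ε ^ 3 * (p₂ * ε) := hT'.trans_eq (by ring)
      _ ≤ T * 1 * (ε ^ 2 * β) * (p₁ * β) := by
        rw [pow_succ ε 2]
        gcongr
      _ = _ := by ring
  · rw [hγ]
    exact sq_div_le_of_le hcγ hβ hv0 hp₂ hη0.le (hη.trans_eq (by field_simp))
  · rw [hγ]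
    refine sq_div_le_of_le hcγ hβ hv0 hp₁ hη0.le (hη.trans ?_)
    calc cη * (p₂ * v * ε ^ 2 / β ^ 3) = cη * v * ε / β ^ 3 * (p₂ * ε) := by ring
      _ ≤ cη * v * ε / β ^ 3 * (p₁ * β) := by gcongr
      _ = _ := by field_simp
  · rw [div_eq_iff hb₂.ne', hγ]
    field_simp
    linarith
  · rw [div_le_iff₀ hb₁, hγ]
    refine le_of_mul_le_mul_right ?_ (by positivity : 0 < β ^ 4)
    calc cγ * v ^ 2 * β ^ 4 = cγ * ε ^ 2 * (b₂ * ε ^ 2) := by rw [mul_assoc, hv]; ring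
      _ ≤ cγ * ε ^ 2 * (b₁ * β ^ 3) := by gcongr
      _ = _ := by field_simp

/-- Whichever entry attains the minimum in `η`, its product with `T` is large enough. -/
theorem stepSize_mul_le {x y A : ℝ} (hcη : 0 ≤ cη)
    (hA : A ≤ T * x) (hB : A ≤ T * y) (hη : η = cη * min x y) : cη * A ≤ η * T := by
  rw [hη, mul_assoc]
  rcases min_choice x y with h | h <;> rw [h] <;> gcongr <;> linarith

end Rates
-- Expectation at the random output time
section Output

theorem measurable_apply_time {Ω Y R : Type*} [MeasurableSpace Ω] [MeasurableSpace Y]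
    [MeasurableSpace R] {τ : Ω → ℕ} {X : Ω → Y} {f : ℕ → Y → R} (hτ : Measurable τ)
    (hX : Measurable X) (hf : ∀ t, Measurable (f t)) : Measurable fun ω => f (τ ω) (X ω) :=
  (measurable_from_prod_countable_right (f := fun y : ℕ × Y => f y.1 y.2) hf).comp
    (hτ.prodMk hX)

variable {d n m : ℕ} {Z Ξ : Type*} [MeasurableSpace Z] [MeasurableSpace Ξ]
  {p : Problem d n m Z Ξ} {C : Constants} {a : Params} {x₀ : Vec d} {u₁ : Fin n → ℝ}
  {u₂ : Fin m → ℝ} {Ω : Type*} [MeasurableSpace Ω] {μ : Measure Ω}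
  {w : ℕ → Ω → Draw n m a.b₁ a.b₂ Z Ξ} [IsProbabilityMeasure μ]

theorem Problem.Assumptions.integral_output_le (hp : p.Assumptions C) (ha : a.Valid n m)
    (hw : IsDrawSequence p a μ w) {T : ℕ} {τ : Ω → ℕ} (hτ : Measurable τ)
    (hτlaw : μ.map τ = uniformOn (Set.Icc 1 T)) (hind : IndepFun τ (fun ω t => w t ω) μ)
    {φ : Vec d → Vec d} (hφ : Continuous φ) {ε : ℝ} (hε : 0 ≤ ε) (hT : 1 ≤ T)
    (h : ∑ t ∈ Finset.Icc 1 T, ∫⁻ ω, ENNReal.ofReal ‖φ (p.iterate a x₀ u₁ u₂ w t ω).x‖ ∂μ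
      ≤ ENNReal.ofReal (T * ε)) :
    Integrable (fun ω => ‖φ (p.run a x₀ u₁ u₂ (fun t => w t ω) (τ ω)).x‖) μ ∧
      ∫ ω, ‖φ (p.run a x₀ u₁ u₂ (fun t => w t ω) (τ ω)).x‖ ∂μ ≤ ε := by
  have hX : Measurable fun ω t => w t ω := measurable_pi_iff.2 hw.meas
  have hf : ∀ t, Measurable fun W => ‖φ (p.run a x₀ u₁ u₂ W t).x‖ := fun t =>
    (hφ.norm.measurable.comp State.measurable_x).comp
      (hp.measurable_run (measurable_hinge_subgradient ha.s_mem) t)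
  have hm : Measurable fun ω => ‖φ (p.run a x₀ u₁ u₂ (fun t => w t ω) (τ ω)).x‖ :=
    measurable_apply_time hτ hX hf
  have hT0 : (0 : ℝ) < T := by exact_mod_cast hT
  have hl : ∫⁻ ω, ENNReal.ofReal ‖φ (p.run a x₀ u₁ u₂ (fun t => w t ω) (τ ω)).x‖ ∂μ
      ≤ ENNReal.ofReal ε := by
    rw [lintegral_uniform_time hτ hX hτlaw hind (f := fun t W =>
      ENNReal.ofReal ‖φ (p.run a x₀ u₁ u₂ W t).x‖) fun t => (hf t).ennreal_ofReal]
    refine (mul_le_mul_right h _).trans_eq ?_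
    rw [← ENNReal.ofReal_natCast, ← ENNReal.ofReal_inv_of_pos hT0,
      ← ENNReal.ofReal_mul (by positivity), inv_mul_cancel_left₀ hT0.ne']
  refine ⟨⟨hm.aestronglyMeasurable, ?_⟩, ?_⟩
  · rw [hasFiniteIntegral_iff_ofReal (Filter.Eventually.of_forall fun _ => norm_nonneg _)]
    exact hl.trans_lt ENNReal.ofReal_lt_top
  · rw [integral_eq_lintegral_of_nonneg_ae (Filter.Eventually.of_forall fun _ => norm_nonneg _)
      hm.aestronglyMeasurable]
    exact ENNReal.toReal_le_of_le_ofReal hε hl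

end Output

end FCCO

/-! ### The convergence theorem -/

set_option maxHeartbeats 1000000 in
theorem theorem4 (d : ℕ) (C : FCCO.Constants) (D Δ : ℝ≥0) (β₀ : ℝ) (hβ₀ : 0 < β₀) :
    -- hidden constants, depending only on `d`, `C`, `D`, `Δ`, `β₀`
    ∃ cγ cη cT cl : ℝ, 0 < cγ ∧ 0 < cη ∧ 0 < cT ∧ 0 < cl ∧ cl < 1 ∧
    ∀ (n m b c b₁ b₂ : ℕ), 1 ≤ b → b ≤ n → 1 ≤ c → c ≤ m → 1 ≤ b₁ → 1 ≤ b₂ →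
    ∀ (Z : Type*) [MeasurableSpace Z] (Ξ : Type*) [MeasurableSpace Ξ]
      (p : FCCO.Problem d n m Z Ξ), p.Assumptions C →
    ∀ (β ε : ℝ), β₀ ≤ β → 0 < ε →
    -- the accuracy is small in comparison with the mini-batch sizes
    (b₂ : ℝ) * ε ^ 4 ≤ β ^ 4 → (b₂ : ℝ) * ε ^ 2 ≤ b₁ * β ^ 3 →
    (c : ℝ) / m * ε ≤ (b : ℝ) / n * β →
    -- the initial point and the initial estimators
    ∀ (x₀ : FCCO.Vec d) (u₁ : Fin n → ℝ) (u₂ : Fin m → ℝ),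
    (∀ y, p.Phi β x₀ ≤ p.Phi β y + Δ * (1 + β)) →
    1 / (n : ℝ) * ∑ i, (u₁ i - p.gMean i x₀) ^ 2 ≤ (D : ℝ) ^ 2 →
    1 / (m : ℝ) * ∑ k, (u₂ k - p.hMean k x₀) ^ 2 ≤ (D : ℝ) ^ 2 →
    ∀ s : ℝ → ℝ, (∀ u, s u ∈ FCCO.subdifferential FCCO.hinge u) →
    -- the parameters of the algorithm and of the Moreau envelope
    ∀ (γ η l : ℝ),
    γ = cγ * min ((b₂ : ℝ) / β ^ 4 * ε ^ 4) ((b₁ : ℝ) / β * ε ^ 2) →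
    η = cη * min ((b : ℝ) * √(b₁ : ℝ) * ε ^ 2 / (n * β ^ 2))
          ((c : ℝ) * √(b₂ : ℝ) * ε ^ 4 / (β ^ 5 * m)) →
    l = cl / (C.ρ₀ + C.ρ₁ * β) →
    -- the number of iterations
    ∀ T : ℕ,
    cT * max (max ((m : ℝ) * β ^ 6 / (√(b₂ : ℝ) * c * ε ^ 6))
        ((n : ℝ) * β ^ 3 / (b * √(b₁ : ℝ) * ε ^ 4)))
        ((n : ℝ) * β ^ 2 / (b * b₁ * ε ^ 4)) ≤ T →
    -- the randomness: draws `w 0, w 1, …` of the iterations, and the output index `τ`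
    ∀ (Ω : Type*) [MeasurableSpace Ω] (μ : Measure Ω) [IsProbabilityMeasure μ]
      (w : ℕ → Ω → FCCO.Draw n m b₁ b₂ Z Ξ) (τ : Ω → ℕ),
    (∀ t, Measurable (w t)) → (∀ t, μ.map (w t) = p.drawLaw b c b₁ b₂) → iIndepFun w μ →
    Measurable τ → μ.map τ = uniformOn (Set.Icc 1 T) → IndepFun τ (fun ω t => w t ω) μ →
    γ < 1 ∧ Differentiable ℝ (FCCO.moreauEnvelope (p.Phi β) l) ∧
    Integrable (fun ω => ‖gradient (FCCO.moreauEnvelope (p.Phi β) l)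
      (p.run ⟨b, c, b₁, b₂, β, γ, γ, η, s⟩ x₀ u₁ u₂ (fun t => w t ω) (τ ω)).x‖) μ ∧
    ∫ ω, ‖gradient (FCCO.moreauEnvelope (p.Phi β) l)
      (p.run ⟨b, c, b₁, b₂, β, γ, γ, η, s⟩ x₀ u₁ u₂ (fun t => w t ω) (τ ω)).x‖ ∂μ ≤ ε := by
  have hρ₀ := C.ρ₀_pos
  have hρ₁ := C.ρ₁_pos
  have hrc : 0 ≤ C.rhoComp := by unfold FCCO.Constants.rhoComp; positivity
  -- Chosen so that `cl ≤ 1 / 4` and `cl * rhoComp ≤ ρ₀ / 4`; together they give `l (rhoComp + β ρ₁)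
  -- ≤ 1 / 4` for every `β`.
  set cl : ℝ := C.ρ₀ / (4 * (C.ρ₀ + C.rhoComp)) with hcl
  have hcl0 : 0 < cl := by positivity
  have hcl1 : cl ≤ 1 / 4 := by
    rw [hcl, div_le_div_iff₀ (by positivity) (by norm_num)]
    linarith
  have hclrc : cl * C.rhoComp ≤ C.ρ₀ / 4 := by
    rw [hcl, div_mul_eq_mul_div, div_le_div_iff₀ (by positivity) (by norm_num)]
    linarith [mul_pos hρ₀ hρ₀]
  -- What remains of the gradient second moment, of `1 / l` and of the initial gap after extracting
  -- `β²`, `β` and `β`; terms of lower order in `β` are absorbed by `β ≥ β₀`.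
  set KG : ℝ := 4 * d * ((C.L_f : ℝ) ^ 2 * C.L_g ^ 2 / β₀ ^ 2 + C.L_h ^ 2) with hKG
  set Kl : ℝ := (C.ρ₀ / β₀ + C.ρ₁) / cl with hKl
  set KΔ : ℝ := Δ * (1 / β₀ + 1) + 3 * C.L_f * D / β₀ with hKΔ
  obtain ⟨cγ, cη, cT, δ, hcγ, hcγ1, hcη, hcT, hδ, hc₂, hc₁, hc⟩ :=
    FCCO.exists_constants (β₀ := β₀) (D := D) (L := C.L_df * C.L_g) (Lg := C.L_g) (Lh := C.L_h)
      (σg := C.σ_g) (σh := C.σ_h) (KG := KG) (Kl := Kl) (KΔ := KΔ) hβ₀ D.2 (by positivity)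
      C.L_h.2 (by positivity) (by positivity) (by positivity)
  refine ⟨cγ, cη, cT, cl, hcγ, hcη, hcT, hcl0, by linarith, ?_⟩
  intro n m b c b₁ b₂ hb hbn hc' hcm hb₁ hb₂ Z _ Ξ _ p hp β ε hβ hε hε₁ hε₂ hε₃ x₀ u₁ u₂ hΔ hD₁
    hD₂ s hs γ η l hγ hη hl T hT Ω _ μ _ w τ hwm hwl hwi hτ hτl hτi
  have hβ0 : 0 < β := hβ₀.trans_le hβ
  have hb0 : (1 : ℝ) ≤ b := by exact_mod_cast hb
  have hc0 : (1 : ℝ) ≤ c := by exact_mod_cast hc'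
  have hn0 : (1 : ℝ) ≤ n := by exact_mod_cast hb.trans hbn
  have hm0 : (1 : ℝ) ≤ m := by exact_mod_cast hc'.trans hcm
  have hb₁0 : (1 : ℝ) ≤ b₁ := by exact_mod_cast hb₁
  have hb₂0 : (1 : ℝ) ≤ b₂ := by exact_mod_cast hb₂
  have hr₂ : √(b₂ : ℝ) ^ 2 = b₂ := Real.sq_sqrt (by linarith)
  have hr₁1 : 1 ≤ √(b₁ : ℝ) := Real.one_le_sqrt.2 hb₁0
  have hr₂1 : 1 ≤ √(b₂ : ℝ) := Real.one_le_sqrt.2 hb₂0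
  -- With this quantity `γ = cγ v²`, and the smallness of `ε` gives `v ≤ 1`, hence both `γ ≤ 1 / 2`
  -- and `ε ≤ β`.
  set v : ℝ := √(b₂ : ℝ) * ε ^ 2 / β ^ 2 with hv
  have hv0 : 0 < v := by positivity
  have hvsq : v ^ 2 * β ^ 4 = b₂ * ε ^ 4 := by
    have : v ^ 2 * β ^ 4 = √(b₂ : ℝ) ^ 2 * ε ^ 4 := by rw [hv]; field_simp
    rw [this, hr₂]
  have hv1 : v ≤ 1 := by
    refine (sq_le_sq₀ hv0.le zero_le_one).1 ?_
    refine le_of_mul_le_mul_right ?_ (by positivity : 0 < β ^ 4)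
    rw [hvsq]; linarith
  have hεv : ε ^ 2 ≤ v * β ^ 2 := by
    rw [hv, div_mul_cancel₀ _ (by positivity)]
    exact le_mul_of_one_le_left (by positivity) hr₂1
  have hεβ : ε ≤ β := by
    refine (sq_le_sq₀ hε.le hβ0.le).1 ?_
    exact hεv.trans (mul_le_of_le_one_left (by positivity) hv1)
  -- The condition `b₂ ε² ≤ b₁ β³` says precisely that the first entry attains the minimum.
  have hγv : γ = cγ * v ^ 2 := by
    rw [hγ, min_eq_left]
    · have : v ^ 2 = √(b₂ : ℝ) ^ 2 / β ^ 4 * ε ^ 4 := by rw [hv]; field_simp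
      rw [this, hr₂]
    · calc (b₂ : ℝ) / β ^ 4 * ε ^ 4 = b₂ * ε ^ 2 * (ε ^ 2 / β ^ 4) := by ring
        _ ≤ b₁ * β ^ 3 * (ε ^ 2 / β ^ 4) := by gcongr
        _ = _ := by field_simp
  have hγ0 : 0 < γ := by rw [hγv]; positivity
  have hγ1 : γ ≤ 1 / 2 := by
    rw [hγv]
    exact (mul_le_of_le_one_right hcγ.le (pow_le_one₀ hv0.le hv1)).trans hcγ1
  have hη0 : 0 < η := by rw [hη]; positivity
  have hl0 : 0 < l := by rw [hl]; positivity
  have hρ : l * (C.rhoComp + β * C.ρ₁) ≤ 1 / 4 := by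
    rw [hl, div_mul_eq_mul_div, div_le_iff₀ (by positivity)]
    linarith [mul_le_mul_of_nonneg_right hcl1 (mul_pos hβ0 hρ₁).le]
  have hl' : 1 / l ≤ Kl * β := by
    rw [hl, hKl, one_div_div, div_mul_eq_mul_div]
    gcongr
    rw [add_mul, div_mul_eq_mul_div]
    gcongr
    rw [le_div_iff₀ hβ₀]
    gcongr
  have hβsq : 1 ≤ β ^ 2 / β₀ ^ 2 := by
    rw [one_le_div (by positivity)]; gcongr
  have hG : C.gradSq d β ≤ KG * β ^ 2 := by
    have h1 : (C.L_f : ℝ) ^ 2 * C.L_g ^ 2 * (4 * d) * 1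
        ≤ (C.L_f : ℝ) ^ 2 * C.L_g ^ 2 * (4 * d) * (β ^ 2 / β₀ ^ 2) := by gcongr
    have h2 : KG * β ^ 2 = (C.L_f : ℝ) ^ 2 * C.L_g ^ 2 * (4 * d) * (β ^ 2 / β₀ ^ 2)
        + 4 * d * C.L_h ^ 2 * β ^ 2 := by rw [hKG]; ring
    rw [h2]
    unfold FCCO.Constants.gradSq
    linarith
  have hG0 := C.gradSq_nonneg d β
  have hΔ' : Δ * (1 + β) + 3 * C.L_f * D ≤ KΔ * β := by
    have h1 : 1 ≤ β / β₀ := by rwa [one_le_div hβ₀]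
    have h2 := mul_le_mul_of_nonneg_left h1
      (by positivity : 0 ≤ (Δ : ℝ) + 3 * (C.L_f : ℝ) * D)
    have h3 : KΔ * β = (Δ + 3 * C.L_f * D) * (β / β₀) + Δ * β := by rw [hKΔ]; ring
    rw [h3]
    linarith
  set p₁ : ℝ := (b : ℝ) / n with hp₁
  set p₂ : ℝ := (c : ℝ) / m with hp₂
  have hp₁0 : 0 < p₁ := by positivity
  have hp₂0 : 0 < p₂ := by positivity
  have hp₂1 : p₂ ≤ 1 := by
    rw [hp₂, div_le_one (by positivity)]; exact_mod_cast hcm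
  have hηle : η ≤ cη * (p₂ * v * ε ^ 2 / β ^ 3) := by
    rw [hη]
    gcongr
    refine (min_le_right _ _).trans_eq ?_
    rw [hp₂, hv]; field_simp
  have hT₂ : cT * ((m : ℝ) * β ^ 6 / (√(b₂ : ℝ) * c * ε ^ 6)) ≤ T :=
    le_trans (by gcongr; exact (le_max_left _ _).trans (le_max_left _ _)) hT
  have hT₁ : cT * ((n : ℝ) * β ^ 3 / (b * √(b₁ : ℝ) * ε ^ 4)) ≤ T :=
    le_trans (by gcongr; exact (le_max_right _ _).trans (le_max_left _ _)) hT
  have hT0 : (0 : ℝ) < T := lt_of_lt_of_le (by positivity) hT₂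
  have hT1 : 1 ≤ T := by exact_mod_cast hT0
  have hTv : cT * (β ^ 4 / (v * p₂ * ε ^ 4)) ≤ T := by
    refine le_trans (le_of_eq ?_) hT₂
    rw [hp₂, hv]; field_simp
  -- Each entry of the minimum defining `η` is matched with the entry of the maximum for `T` whose
  -- product with it is `β / ε²`.
  have hηT : cη * (cT * β / ε ^ 2) ≤ η * T := by
    refine FCCO.stepSize_mul_le hcη.le ?_ ?_ hη
    · calc cT * β / ε ^ 2 = cT * ((n : ℝ) * β ^ 3 / (b * √(b₁ : ℝ) * ε ^ 4))
          * ((b : ℝ) * √(b₁ : ℝ) * ε ^ 2 / (n * β ^ 2)) := by field_simp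
        _ ≤ _ := by gcongr
    · calc cT * β / ε ^ 2 = cT * ((m : ℝ) * β ^ 6 / (√(b₂ : ℝ) * c * ε ^ 6))
          * ((c : ℝ) * √(b₂ : ℝ) * ε ^ 4 / (β ^ 5 * m)) := by field_simp
        _ ≤ _ := by gcongr
  have hηT' : cη * cT * β ≤ η * T * ε ^ 2 := by
    have := mul_le_mul_of_nonneg_right hηT (sq_nonneg ε)
    refine le_trans (le_of_eq ?_) this
    field_simp
  obtain ⟨⟨h1, h2, h3, h4⟩, h5, h6, h7, h8⟩ := FCCO.parameter_rates hcγ hcη hcT hβ0 hε hεβ hp₁0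
    hp₂0 hp₂1 (by linarith) (by linarith) hv0 hv1 hεv hvsq hε₂ hε₃ hγv hη0 hηle hTv
  set a : FCCO.Params := ⟨b, c, b₁, b₂, β, γ, γ, η, s⟩ with ha'
  have ha : a.Valid n m := ⟨hb, hbn, hc', hcm, hb₁, hb₂, hβ0.le, hs⟩
  have hw : FCCO.IsDrawSequence p a μ w := ⟨hwm, hwl, hwi⟩
  have hQ : FCCO.QuadMinorized (C.rhoComp + β * C.ρ₁) (p.Phi β) := by
    rw [← p.shiftedPhi_zero]
    exact hp.quadMinorized_shiftedPhi (hb.trans hbn) (hc'.trans hcm) hβ0.le 0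
  have hcont : Continuous (p.Phi β) := by
    rw [← p.shiftedPhi_zero]; exact hp.continuous_shiftedPhi 0
  refine ⟨by linarith, FCCO.differentiable_moreauEnvelope hQ hcont hl0 (by linarith), ?_⟩
  refine hp.integral_output_le (a := a) ha hw hτ hτl hτi
    (FCCO.continuous_gradient_moreauEnvelope hQ hcont hl0 (by linarith)) hε.le hT1 ?_
  have hs₂ : 32 * C.L_h ^ 2 * (η ^ 2 * C.gradSq d β) / (p₂ ^ 2 * γ) + 2 * γ * C.σ_h ^ 2 / b₂
      ≤ (δ * ε ^ 2 / β ^ 2) ^ 2 := by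
    calc _ ≤ 32 * C.L_h ^ 2 * (η ^ 2 * (KG * β ^ 2)) / (p₂ ^ 2 * γ)
          + 2 * γ * C.σ_h ^ 2 / b₂ := by gcongr
      _ = 32 * C.L_h ^ 2 * KG * (η ^ 2 * β ^ 2 / (p₂ ^ 2 * γ)) + 2 * C.σ_h ^ 2 * (γ / b₂) := by
        ring
      _ ≤ 32 * C.L_h ^ 2 * KG * (cη ^ 2 / cγ * (ε ^ 2 / β ^ 2) ^ 2)
          + 2 * C.σ_h ^ 2 * (cγ * (ε ^ 2 / β ^ 2) ^ 2) := by
        rw [h7]; gcongr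
      _ = (32 * C.L_h ^ 2 * KG * (cη ^ 2 / cγ) + 2 * cγ * C.σ_h ^ 2) * (ε ^ 2 / β ^ 2) ^ 2 := by
        ring
      _ ≤ δ ^ 2 * (ε ^ 2 / β ^ 2) ^ 2 := by gcongr
      _ = _ := by ring
  have hs₁ : 32 * C.L_g ^ 2 * (η ^ 2 * C.gradSq d β) / (p₁ ^ 2 * γ) + 2 * γ * C.σ_g ^ 2 / b₁
      ≤ δ * ε ^ 2 := by
    calc _ ≤ 32 * C.L_g ^ 2 * (η ^ 2 * (KG * β ^ 2)) / (p₁ ^ 2 * γ)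
          + 2 * γ * C.σ_g ^ 2 / b₁ := by gcongr
      _ = 32 * C.L_g ^ 2 * KG * (η ^ 2 * β ^ 2 / (p₁ ^ 2 * γ)) + 2 * C.σ_g ^ 2 * (γ / b₁) := by
        ring
      _ ≤ 32 * C.L_g ^ 2 * KG * (cη ^ 2 / cγ * (ε / β₀) ^ 2)
          + 2 * C.σ_g ^ 2 * (cγ * (ε ^ 2 / β₀)) := by
        refine add_le_add (mul_le_mul_of_nonneg_left (h6.trans ?_) (by positivity))
          (mul_le_mul_of_nonneg_left (h8.trans ?_) (by positivity)) <;> gcongr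
      _ = (32 * C.L_g ^ 2 * KG * (cη ^ 2 / cγ) / β₀ ^ 2 + 2 * cγ * C.σ_g ^ 2 / β₀) * ε ^ 2 := by
        ring
      _ ≤ _ := by gcongr
  -- The choice `τ = η β` balances `τ / 2` against the increment term, whose numerator is of order
  -- `η² β²`. The level `σ₂` is the accuracy `ε² / β²` demanded by the hinge.
  refine (hp.sum_lintegral_norm_gradient_le (a := a) (x₀ := x₀) (u₁ := u₁) (u₂ := u₂) ha hw hl0 hρ
    hη0 rfl hγ0 hγ1 D.2 hD₁ hD₂ hΔ hε (τ := η * β) (by positivity) (σ₂ := δ * ε ^ 2 / β ^ 2)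
    (by positivity) hs₂ hs₁ T).trans (ENNReal.ofReal_le_ofReal ?_)
  exact FCCO.gradient_sum_bound_le (Lg := C.L_g) hβ₀ D.2 (by positivity) C.L_h.2 (by positivity)
    (by positivity) (by positivity) hcγ hcη hcT hδ hc hβ hε hεβ hp₁0 hp₂0 hγ0 hη0
    (by exact_mod_cast hT1) hl0 hl' hG0 hG hΔ' h1 h2 h3 h4 hηT'
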